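/- Let $\Bbbk$ be an algebraically closed field of characteristic zero and let $C$ be a $\Bbbk$-coalgebra that is artinian on both sides, i.e. $C$ satisfies the descending chain condition on left coideals and on right coideals. Let $C^*=\operatorname{Hom}_\Bbbk(C,\Bbbk)$ be its dual (convolution) algebra, with Jacobson radical $J$. Write ${}_{C^*}\mathcal M$ and $\mathcal M_{C^*}$ for the categories of left and right $C^*$-modules and ${}^C\mathcal M$ for the abelian category of left $C$-comodules; a left comodule $M$ is a right $C^*$-module by $m\cdot f=\sum f(m_{(-1)})m_{(0)}$, and this identifies ${}^C\mathcal M$ with the category of rational right $C^*$-modules. A left comodule $M$ is quasi-finite if $\operatorname{Hom}_C(N,M)$ is finite dimensional for every finite dimensional left comodule $N$. For a right $C^*$-module $N$ put $\Gamma^\circ(N)=\{m\in N\mid mJ^n=0 \text{ for some } n\}$. Then $\Gamma^\circ(N)$ is the largest rational submodule of $N$, so that $\Gamma^\circ$ is a left exact functor $\mathcal M_{C^*}\to{}^C\mathcal M$; let $R\Gamma^\circ:\mathcal D^+(\mathcal M_{C^*})\to\mathcal D^+({}^C\mathcal M)$ be its right derived functor. Let $(-)^*=\operatorname{Hom}_\Bbbk(-,\Bbbk)$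 denote the exact contravariant functors from left to right $C^*$-modules and from left $C$-comodules to left $C^*$-modules, as well as the functors $\mathcal D^-({}_{C^*}\mathcal M)^{op}\to\mathcal D^+(\mathcal M_{C^*})$ and $\mathcal D^+({}^C\mathcal M)^{op}\to\mathcal D^-({}_{C^*}\mathcal M)$ which they induce. Let $\mathcal D^-_{fg}({}_{C^*}\mathcal M)\subseteq\mathcal D^-({}_{C^*}\mathcal M)$ be the full subcategory of complexes with finitely generated cohomology modules, $\mathcal D^+_{qf}({}^C\mathcal M)\subseteq\mathcal D^+({}^C\mathcal M)$ the full subcategory of complexes with quasi-finite cohomology comodules, and $\mathcal D^b_{fg}({}_{C^*}\mathcal M)$, $\mathcal D^b_{qf}({}^C\mathcal M)$ the full subcategories of these whose objects have bounded cohomology. Then these are triangulated subcategories, and the contravariant functors $R\Gamma^\circ\circ(-)^*$ and $(-)^*$ restrict to mutually quasi-inverse dualities of triangulated categories $$\mathcal D^-_{fg}({}_{C^*}\mathcal M)^{op}\;\simeq\;\mathcal D^+_{qf}({}^C\mathcal M),\qquad \mathcal D^b_{fg}({}_{C^*}\mathcal M)^{op}\;\simeq\;\mathcal D^b_{qf}({}^C\mathcal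 M).$$ -/

import Mathlib

open CategoryTheory Limits TensorProduct

universe u w₁ w₂ w₃

namespace CoalgDuality

section Dual

/-- The dual algebra `C^*` of a coalgebra `C`, with the convolution product
`(f * g) c = ∑ f c₍₁₎ * g c₍₂₎` and unit `ε`. -/
abbrev DualAlgebra (k C : Type u) [Field k] [AddCommGroup C] [Module k C] [Coalgebra k C] :
    Type u :=
  WithConv (C →ₗ[k] k)

end Dual

noncomputable section

open scoped ModuleCat

section Contract

variable {k C : Type u} [Field k] [AddCommGroup C] [Module k C]

/-- The contraction `f ⊗ id : C ⊗ N → N`, `c ⊗ n ↦ f c • n`. -/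
def contr {N : Type u} [AddCommGroup N] [Module k N] (f : C →ₗ[k] k) :
    C ⊗[k] N →ₗ[k] N :=
  (TensorProduct.lid k N).toLinearMap ∘ₗ f.rTensor N

variable {N : Type u} [AddCommGroup N] [Module k N] {P : Type u} [AddCommGroup P] [Module k P]

@[simp]
lemma contr_tmul (f : C →ₗ[k] k) (c : C) (n : N) :
    contr f (c ⊗ₜ[k] n) = f c • n := by
  simp [contr]

lemma contr_ext {t t' : C ⊗[k] N}
    (h : ∀ f : C →ₗ[k] k, contr f t = contr f t') : t = t' := by
  classical
  let b := Module.Basis.ofVectorSpace k C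
  apply (TensorProduct.equivFinsuppOfBasisLeft (N := N) b).injective
  ext i
  have key : ∀ s : C ⊗[k] N,
      TensorProduct.equivFinsuppOfBasisLeft (N := N) b s i = contr (b.coord i) s := by
    intro s
    induction s using TensorProduct.induction_on with
    | zero => simp
    | tmul c n => simp
    | add x y hx hy => simp [hx, hy]
  rw [key, key, h]

lemma contr_lTensor (g : N →ₗ[k] P) (f : C →ₗ[k] k) (t : C ⊗[k] N) :
    contr f (g.lTensor C t) = g (contr f t) := by
  induction t using TensorProduct.induction_on with
  | zero => simp
  | tmul c n => simp
  | add x y hx hy => simp [hx, hy]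

lemma contr_rTensor (g : C →ₗ[k] C) (f : C →ₗ[k] k) (t : C ⊗[k] N) :
    contr f (g.rTensor N t) = contr (f ∘ₗ g) t := by
  induction t using TensorProduct.induction_on with
  | zero => simp
  | tmul c n => simp
  | add x y hx hy => simp [hx, hy]

/-- An element of `C ⊗ N` all of whose contractions lie in a subspace `K` comes from `C ⊗ K`. -/
lemma exists_lTensor_of_contr_mem (i : P →ₗ[k] N) (t : C ⊗[k] N)
    (h : ∀ f : C →ₗ[k] k, contr f t ∈ LinearMap.range i) :
    ∃ s : C ⊗[k] P, i.lTensor C s = t := by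
  have hex : Function.Exact i (LinearMap.range i).mkQ := by
    rw [LinearMap.exact_iff, Submodule.ker_mkQ]
  refine (lTensor_exact C hex (Submodule.mkQ_surjective _) t).1 ?_
  apply contr_ext
  intro f
  rw [contr_lTensor, map_zero]
  simpa using h f

end Contract

section Rational

variable (k C : Type u) [Field k] [AddCommGroup C] [Module k C] [Coalgebra k C]

/-- The hit action `c ↦ ∑ f c₍₁₎ • c₍₂₎` of `f : C^*` on `C`. -/
def coalgHit (f : DualAlgebra k C) : C →ₗ[k] C := contr f.ofConv ∘ₗ Coalgebra.comul

variable {k C}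

lemma dualAlgebra_mul_ofConv (f g : DualAlgebra k C) :
    (f * g).ofConv = g.ofConv ∘ₗ coalgHit k C f := by
  ext c
  have : ∀ t : C ⊗[k] C, LinearMap.mul' k k (TensorProduct.map f.ofConv g.ofConv t) =
      g.ofConv (contr f.ofConv t) := by
    intro t
    induction t using TensorProduct.induction_on with
    | zero => simp
    | tmul c n => simp
    | add x y hx hy => simp [hx, hy]
  exact this _

lemma dualAlgebra_one_ofConv : (1 : DualAlgebra k C).ofConv = Coalgebra.counit := by
  ext c
  simp [LinearMap.convOne_def]

/-- An element `m` of a right `C^*`-module `N` is rational if there is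
`t = ∑ cᵢ ⊗ nᵢ ∈ C ⊗ N` with `m · f = ∑ f cᵢ • nᵢ` for all `f ∈ C^*`. -/
def IsRationalElement {N : Type u} [AddCommGroup N] [Module k N] [Module (DualAlgebra k C)ᵐᵒᵖ N]
    (m : N) : Prop :=
  ∃ t : C ⊗[k] N, ∀ f : DualAlgebra k C, MulOpposite.op f • m = contr f.ofConv t

variable (k C) in
/-- The rational submodule of a right `C^*`-module. -/
def rationalSubmodule (N : Type u) [AddCommGroup N] [Module k N]
    [Module (DualAlgebra k C)ᵐᵒᵖ N] : Submodule (DualAlgebra k C)ᵐᵒᵖ N where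
  carrier := {m | IsRationalElement (k := k) (C := C) m}
  zero_mem' := ⟨0, by simp⟩
  add_mem' := by
    rintro a b ⟨s, hs⟩ ⟨t, ht⟩
    exact ⟨s + t, fun f => by simp [smul_add, hs f, ht f]⟩
  smul_mem' := by
    rintro r m ⟨t, ht⟩
    refine ⟨(coalgHit k C r.unop).rTensor N t, fun f => ?_⟩
    rw [contr_rTensor, ← dualAlgebra_mul_ofConv, ← ht, smul_smul, MulOpposite.op_mul, MulOpposite.op_unop]

end Rational

section Comod

variable (k C : Type u) [Field k] [AddCommGroup C] [Module k C] [Coalgebra k C]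

/-- Left comodules over a `k`-coalgebra `C`: a vector space `M` with a coassociative and counital
coaction `M → C ⊗ M`. -/
structure LeftComod : Type (u + 1) where
  carrier : Type u
  [addCommGroup : AddCommGroup carrier]
  [module : Module k carrier]
  coact : carrier →ₗ[k] C ⊗[k] carrier
  coassoc : (TensorProduct.assoc k C C carrier).toLinearMap ∘ₗ
      Coalgebra.comul.rTensor carrier ∘ₗ coact = coact.lTensor C ∘ₗ coact
  counit : (TensorProduct.lid k carrier).toLinearMap ∘ₗ
      Coalgebra.counit.rTensor carrier ∘ₗ coact = LinearMap.id

namespace LeftComod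

attribute [instance] LeftComod.addCommGroup LeftComod.module

variable {k C}

/-- The `k`-vector space `Hom_C(M, N)` of comodule morphisms. -/
def homSubmodule (M N : LeftComod k C) : Submodule k (M.carrier →ₗ[k] N.carrier) where
  carrier := {f | N.coact ∘ₗ f = f.lTensor C ∘ₗ M.coact}
  zero_mem' := by simp
  add_mem' := by
    intro f g hf hg
    simp only [Set.mem_ofPred_eq] at *
    rw [LinearMap.comp_add, hf, hg, LinearMap.lTensor_add, LinearMap.add_comp]
  smul_mem' := by
    intro a f hf
    simp only [Set.mem_ofPred_eq] at *
    rw [LinearMap.comp_smul, hf, LinearMap.lTensor_smul, LinearMap.smul_comp]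

/-- Morphisms of left comodules. -/
@[ext]
structure Hom (M N : LeftComod k C) where
  lin : M.carrier →ₗ[k] N.carrier
  comm : lin ∈ homSubmodule M N

instance : Category (LeftComod k C) where
  Hom M N := Hom M N
  id M := ⟨LinearMap.id, by simp [homSubmodule]⟩
  comp {M N P} f g := ⟨g.lin ∘ₗ f.lin, by
    have hf : N.coact ∘ₗ f.lin = f.lin.lTensor C ∘ₗ M.coact := f.comm
    have hg : P.coact ∘ₗ g.lin = g.lin.lTensor C ∘ₗ N.coact := g.comm
    change P.coact ∘ₗ g.lin ∘ₗ f.lin = (g.lin ∘ₗ f.lin).lTensor C ∘ₗ M.coact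
    rw [LinearMap.lTensor_comp, LinearMap.comp_assoc, ← hf, ← LinearMap.comp_assoc, hg,
      LinearMap.comp_assoc]⟩

@[ext]
lemma hom_ext {M N : LeftComod k C} {f g : M ⟶ N} (h : f.lin = g.lin) : f = g := Hom.ext h

@[simp] lemma id_lin (M : LeftComod k C) : Hom.lin (𝟙 M) = LinearMap.id := rfl

@[simp] lemma comp_lin {M N P : LeftComod k C} (f : M ⟶ N) (g : N ⟶ P) :
    (f ≫ g).lin = g.lin ∘ₗ f.lin := rfl

/-- Morphisms of comodules are the elements of `homSubmodule`. -/
def homEquiv (M N : LeftComod k C) : (M ⟶ N) ≃ homSubmodule M N where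
  toFun f := ⟨f.lin, f.comm⟩
  invFun f := ⟨f.1, f.2⟩
  left_inv _ := rfl
  right_inv _ := rfl

instance (M N : LeftComod k C) : AddCommGroup (M ⟶ N) := (homEquiv M N).addCommGroup

lemma add_lin {M N : LeftComod k C} (f g : M ⟶ N) : (f + g).lin = f.lin + g.lin := rfl

instance : Preadditive (LeftComod k C) where
  add_comp _ _ _ _ _ _ := by ext1; simp [add_lin, LinearMap.comp_add]
  comp_add _ _ _ _ _ _ := by ext1; simp [add_lin, LinearMap.add_comp]

lemma contr_comul_coact (M : LeftComod k C) (f : DualAlgebra k C) (m : M.carrier) :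
    (coalgHit k C f).rTensor M.carrier (M.coact m) =
      M.coact (contr f.ofConv (M.coact m)) := by
  have h := congrArg (contr f.ofConv) (LinearMap.congr_fun M.coassoc m)
  simp only [LinearMap.comp_apply] at h
  rw [contr_lTensor] at h
  rw [← h]
  generalize M.coact m = t
  induction t using TensorProduct.induction_on with
  | zero => simp
  | add x y hx hy => simp only [map_add, hx, hy]
  | tmul c n =>
    simp only [LinearMap.rTensor_tmul, coalgHit, LinearMap.comp_apply]
    generalize (Coalgebra.comul c : C ⊗[k] C) = s
    induction s using TensorProduct.induction_on with
    | zero => simp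
    | add x y hx hy => simp only [map_add, TensorProduct.add_tmul, hx, hy]
    | tmul c' n' => simp [TensorProduct.smul_tmul']

/-- The right `C^*`-module structure `m · f = ∑ f m₍₋₁₎ • m₍₀₎` on a left `C`-comodule. -/
instance (M : LeftComod k C) : Module (DualAlgebra k C)ᵐᵒᵖ M.carrier where
  smul r m := contr r.unop.ofConv (M.coact m)
  one_smul m := by
    change contr (1 : DualAlgebra k C).ofConv (M.coact m) = m
    rw [dualAlgebra_one_ofConv]
    exact LinearMap.congr_fun M.counit m
  mul_smul r s m := by
    change contr (s.unop * r.unop).ofConv (M.coact m) =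
      contr r.unop.ofConv (M.coact (contr s.unop.ofConv (M.coact m)))
    rw [dualAlgebra_mul_ofConv, ← contr_rTensor, contr_comul_coact]
  smul_zero r := by
    change contr _ (M.coact 0) = 0
    simp
  smul_add r x y := by
    change contr _ (M.coact (x + y)) = contr _ (M.coact x) + contr _ (M.coact y)
    simp
  add_smul r s m := by
    change contr (r.unop + s.unop).ofConv _ = contr _ _ + contr _ _
    simp [contr, LinearMap.rTensor_add]
  zero_smul m := by
    change contr (0 : DualAlgebra k C).ofConv _ = 0
    simp [contr]

lemma op_smul_def (M : LeftComod k C) (f : DualAlgebra k C) (m : M.carrier) :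
    MulOpposite.op f • m = contr f.ofConv (M.coact m) := rfl

instance (M : LeftComod k C) : IsScalarTower k (DualAlgebra k C)ᵐᵒᵖ M.carrier where
  smul_assoc a r m := by
    change contr (a • r.unop).ofConv _ = a • contr r.unop.ofConv _
    simp [contr, LinearMap.rTensor_smul]

/-- A rational right `C^*`-module as a left `C`-comodule. -/
def ofRational (N : Type u) [AddCommGroup N] [Module k N]
    [Module (DualAlgebra k C)ᵐᵒᵖ N] [IsScalarTower k (DualAlgebra k C)ᵐᵒᵖ N]
    (h : ∀ m : N, IsRationalElement (k := k) (C := C) m) : LeftComod k C where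
  carrier := N
  coact :=
    { toFun := fun m => (h m).choose
      map_add' := fun x y => contr_ext fun f => by
        have hx := (h x).choose_spec ⟨f⟩
        have hy := (h y).choose_spec ⟨f⟩
        have hxy := (h (x + y)).choose_spec ⟨f⟩
        rw [map_add, ← hx, ← hy, ← hxy, smul_add]
      map_smul' := fun a x => contr_ext fun f => by
        have hx := (h x).choose_spec ⟨f⟩
        have hax := (h (a • x)).choose_spec ⟨f⟩
        have : SMulCommClass k (DualAlgebra k C)ᵐᵒᵖ N := IsScalarTower.to_smulCommClass
        rw [RingHom.id_apply, map_smul, ← hx, ← hax, smul_comm] }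
  coassoc := by
    ext m
    apply contr_ext
    intro f
    apply contr_ext
    intro g
    have H : ∀ m (f : C →ₗ[k] k), contr f (h m).choose =
        MulOpposite.op (⟨f⟩ : DualAlgebra k C) • m := fun m f => ((h m).choose_spec ⟨f⟩).symm
    simp only [LinearMap.comp_apply]
    rw [contr_lTensor]
    simp only [LinearMap.coe_mk, AddHom.coe_mk]
    rw [H, H, smul_smul, ← MulOpposite.op_mul, (h m).choose_spec, dualAlgebra_mul_ofConv,
      ← contr_rTensor]
    congr 1
    generalize (h m).choose = t
    induction t using TensorProduct.induction_on with
    | zero => simp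
    | add x y hx hy => simp only [map_add, hx, hy]
    | tmul c n =>
      simp only [LinearMap.rTensor_tmul, coalgHit, LinearMap.comp_apply]
      generalize (Coalgebra.comul c : C ⊗[k] C) = s
      induction s using TensorProduct.induction_on with
      | zero => simp
      | add x y hx hy => simp only [map_add, TensorProduct.add_tmul, hx, hy]
      | tmul c' n' => simp [TensorProduct.smul_tmul']
  counit := by
    ext m
    have := (h m).choose_spec 1
    rw [dualAlgebra_one_ofConv, MulOpposite.op_one, one_smul] at this
    exact this.symm

lemma contr_ofRational {N : Type u} [AddCommGroup N] [Module k N]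
    [Module (DualAlgebra k C)ᵐᵒᵖ N] [IsScalarTower k (DualAlgebra k C)ᵐᵒᵖ N]
    (h : ∀ m : N, IsRationalElement (k := k) (C := C) m) (f : DualAlgebra k C) (m : N) :
    contr f.ofConv ((ofRational N h).coact m) = MulOpposite.op f • m :=
  ((h m).choose_spec f).symm

/-- A linear map that respects the actions of `C^*` is a morphism of comodules. -/
lemma mem_homSubmodule_iff {M N : LeftComod k C} (f : M.carrier →ₗ[k] N.carrier) :
    f ∈ homSubmodule M N ↔
      ∀ (g : DualAlgebra k C) (m : M.carrier), f (MulOpposite.op g • m) = MulOpposite.op g • f m := by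
  constructor
  · intro hf g m
    have h := LinearMap.congr_fun (show N.coact ∘ₗ f = f.lTensor C ∘ₗ M.coact from hf) m
    simp only [LinearMap.comp_apply] at h
    rw [op_smul_def, op_smul_def, h, contr_lTensor]
  · intro hf
    change N.coact ∘ₗ f = f.lTensor C ∘ₗ M.coact
    ext m
    apply contr_ext
    intro g
    simp only [LinearMap.comp_apply]
    rw [contr_lTensor]
    exact (hf ⟨g⟩ m).symm

end LeftComod

end Comod

section RationalModules

variable (k C : Type u) [Field k] [AddCommGroup C] [Module k C] [Coalgebra k C]

lemma IsRationalElement.map {k C : Type u} [Field k] [AddCommGroup C] [Module k C] [Coalgebra k C]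
    {N P : Type u} [AddCommGroup N] [Module k N] [Module (DualAlgebra k C)ᵐᵒᵖ N]
    [IsScalarTower k (DualAlgebra k C)ᵐᵒᵖ N]
    [AddCommGroup P] [Module k P] [Module (DualAlgebra k C)ᵐᵒᵖ P]
    [IsScalarTower k (DualAlgebra k C)ᵐᵒᵖ P]
    (g : N →ₗ[(DualAlgebra k C)ᵐᵒᵖ] P) {m : N} (h : IsRationalElement (k := k) (C := C) m) :
    IsRationalElement (k := k) (C := C) (g m) := by
  obtain ⟨t, ht⟩ := h
  refine ⟨(g.restrictScalars k).lTensor C t, fun f => ?_⟩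
  rw [contr_lTensor, ← ht]
  simp

lemma IsRationalElement.of_map {k C : Type u} [Field k] [AddCommGroup C] [Module k C]
    [Coalgebra k C]
    {N P : Type u} [AddCommGroup N] [Module k N] [Module (DualAlgebra k C)ᵐᵒᵖ N]
    [IsScalarTower k (DualAlgebra k C)ᵐᵒᵖ N]
    [AddCommGroup P] [Module k P] [Module (DualAlgebra k C)ᵐᵒᵖ P]
    [IsScalarTower k (DualAlgebra k C)ᵐᵒᵖ P]
    (g : N →ₗ[(DualAlgebra k C)ᵐᵒᵖ] P) (hg : Function.Injective g) {m : N}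
    (h : IsRationalElement (k := k) (C := C) (g m)) :
    IsRationalElement (k := k) (C := C) m := by
  obtain ⟨t, ht⟩ := h
  obtain ⟨s, rfl⟩ := exists_lTensor_of_contr_mem (g.restrictScalars k) t (fun f => by
    rw [← ht ⟨f⟩]
    exact ⟨MulOpposite.op (WithConv.toConv f) • m, by simp⟩)
  refine ⟨s, fun f => hg ?_⟩
  rw [map_smul, ht, contr_lTensor]
  rfl

lemma isRationalElement_of_mem_rationalSubmodule {N : Type u} [AddCommGroup N] [Module k N]
    [Module (DualAlgebra k C)ᵐᵒᵖ N] [IsScalarTower k (DualAlgebra k C)ᵐᵒᵖ N]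
    (m : rationalSubmodule k C N) : IsRationalElement (k := k) (C := C) m :=
  IsRationalElement.of_map (rationalSubmodule k C N).subtype Subtype.val_injective
    (show IsRationalElement (k := k) (C := C) (m : N) from m.2)

/-- The property of being a rational right `C^*`-module. -/
def rationalModules : ObjectProperty (ModuleCat.{u} (DualAlgebra k C)ᵐᵒᵖ) :=
  fun N => ∀ m : N, IsRationalElement (k := k) (C := C) m

instance : (rationalModules k C).IsClosedUnderSubobjects where
  prop_of_mono f hf hY _ :=
    IsRationalElement.of_map f.hom ((ModuleCat.mono_iff_injective f).1 hf) (hY _)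

instance : (rationalModules k C).IsClosedUnderQuotients where
  prop_of_epi f hf hX m := by
    obtain ⟨x, rfl⟩ := (ModuleCat.epi_iff_surjective f).1 hf m
    exact IsRationalElement.map f.hom (hX x)

instance : (rationalModules k C).ContainsZero where
  exists_zero := ⟨ModuleCat.of _ PUnit, ModuleCat.isZero_of_subsingleton _,
    fun _ => ⟨0, fun _ => Subsingleton.elim _ _⟩⟩

lemma rationalModules_biproduct {J : Type} [Finite J]
    (f : J → ModuleCat.{u} (DualAlgebra k C)ᵐᵒᵖ) (hf : ∀ j, rationalModules k C (f j)) :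
    rationalModules k C (⨁ f) := by
  intro m
  have := Fintype.ofFinite J
  have h := congrArg (fun g => g.hom m) (biproduct.total (f := f))
  simp only [ModuleCat.hom_sum, LinearMap.sum_apply, ModuleCat.hom_id, LinearMap.id_apply] at h
  change m ∈ rationalSubmodule k C (⨁ f : ModuleCat.{u} (DualAlgebra k C)ᵐᵒᵖ)
  rw [← h]
  exact Submodule.sum_mem _ fun j _ => IsRationalElement.map (biproduct.ι f j).hom (hf j _)

instance : (rationalModules k C).IsClosedUnderFiniteProducts where
  isClosedUnderLimitsOfShape J _ :=
    { limitsOfShape_le := by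
        rintro X ⟨h⟩
        let φ : X ⟶ ⨁ fun j => h.diag.obj ⟨j⟩ := biproduct.lift fun j => h.π.app ⟨j⟩
        have : Mono φ := ⟨fun a b hab => h.isLimit.hom_ext fun ⟨j⟩ => by
          have := hab =≫ biproduct.π _ j
          simpa [φ] using this⟩
        exact (rationalModules k C).prop_of_mono φ
          (rationalModules_biproduct k C _ fun j => h.prop_diag_obj ⟨j⟩) }

end RationalModules

namespace LeftComod

variable (k C : Type u) [Field k] [AddCommGroup C] [Module k C] [Coalgebra k C]

/-- A left `C`-comodule regarded as a right `C^*`-module. -/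
def toMod : LeftComod k C ⥤ ModuleCat.{u} (DualAlgebra k C)ᵐᵒᵖ where
  obj M := ModuleCat.of _ M.carrier
  map {M N} f := ModuleCat.ofHom
    { toFun := f.lin
      map_add' := f.lin.map_add
      map_smul' := fun r m => (mem_homSubmodule_iff f.lin).1 f.comm r.unop m }

lemma moduleOfAlgebraModule_toMod (M : LeftComod k C) :
    (ModuleCat.moduleOfAlgebraModule ((toMod k C).obj M) : Module k M.carrier) = M.module :=
  Module.ext' _ _ fun a m => by
    exact algebraMap_smul (DualAlgebra k C)ᵐᵒᵖ a (show M.carrier from m)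

lemma toMod_rational (M : LeftComod k C) : rationalModules k C ((toMod k C).obj M) := by
  intro m
  rw [show ModuleCat.moduleOfAlgebraModule ((toMod k C).obj M) = M.module from
    moduleOfAlgebraModule_toMod k C M]
  exact ⟨M.coact m, fun f => rfl⟩

instance : (toMod k C).Faithful where
  map_injective {M N f g} h := by
    ext m
    exact congrArg (fun φ => φ.hom m) h

instance : (toMod k C).Full where
  map_surjective {M N} g := by
    let l : M.carrier →ₗ[(DualAlgebra k C)ᵐᵒᵖ] N.carrier := g.hom
    exact ⟨⟨l.restrictScalars k, (mem_homSubmodule_iff _).2 fun f m => l.map_smul _ _⟩, rfl⟩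

instance : (toMod k C).Additive where

/-- The functor from left `C`-comodules to rational right `C^*`-modules. -/
def toRational : LeftComod k C ⥤ (rationalModules k C).FullSubcategory :=
  (rationalModules k C).lift (toMod k C) (toMod_rational k C)

instance : (toRational k C).Faithful := by unfold toRational; infer_instance
instance : (toRational k C).Full := by unfold toRational; infer_instance
instance : (toRational k C).Additive where

variable {k C} in
lemma ofRational_smul {N : Type u} [AddCommGroup N] [Module k N]
    [inst : Module (DualAlgebra k C)ᵐᵒᵖ N] [IsScalarTower k (DualAlgebra k C)ᵐᵒᵖ N]
    (h : ∀ m : N, IsRationalElement (k := k) (C := C) m) (r : (DualAlgebra k C)ᵐᵒᵖ) (m : N) :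
    (show (ofRational N h).carrier from r • m) = r • (show (ofRational N h).carrier from m) :=
  (contr_ofRational h r.unop m).symm

instance : (toRational k C).EssSurj where
  mem_essImage N := by
    refine ⟨ofRational N.obj N.property, ⟨(rationalModules k C).isoMk ?_⟩⟩
    exact LinearEquiv.toModuleIso
      { toFun := fun m => m
        invFun := fun m => m
        left_inv := fun _ => rfl
        right_inv := fun _ => rfl
        map_add' := fun _ _ => rfl
        map_smul' := fun r m => (ofRational_smul N.property r m).symm }

instance : (toRational k C).IsEquivalence where

instance : HasFiniteProducts (LeftComod k C) :=
  ⟨fun _ => Adjunction.hasLimitsOfShape_of_equivalence (toRational k C)⟩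

/-- Left comodules over a coalgebra over a field form an abelian category. -/
instance : Abelian (LeftComod k C) := abelianOfEquivalence (toRational k C)

instance : (rationalModules k C).ι.PreservesHomology where
  preservesKernels _ _ f := (rationalModules k C).preservesKernels_ι f
  preservesCokernels _ _ f := (rationalModules k C).preservesCokernels_ι f

instance : PreservesFiniteLimits (toMod k C) :=
  have := (rationalModules k C).ι.preservesFiniteLimits_of_preservesHomology
  inferInstanceAs (PreservesFiniteLimits (toRational k C ⋙ (rationalModules k C).ι))

instance : PreservesFiniteColimits (toMod k C) :=
  have := (rationalModules k C).ι.preservesFiniteColimits_of_preservesHomology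
  inferInstanceAs (PreservesFiniteColimits (toRational k C ⋙ (rationalModules k C).ι))

/-- The rational functor from right `C^*`-modules to left `C`-comodules. -/
def rat : ModuleCat.{u} (DualAlgebra k C)ᵐᵒᵖ ⥤ LeftComod k C where
  obj N := ofRational (rationalSubmodule k C N)
    (isRationalElement_of_mem_rationalSubmodule k C)
  map {N P} f :=
    { lin := (f.hom.restrict (p := rationalSubmodule k C N) (q := rationalSubmodule k C P)
        fun _ hm => IsRationalElement.map f.hom hm).restrictScalars k
      comm := (mem_homSubmodule_iff _).2 fun g m => by
        have h₁ := ofRational_smul (isRationalElement_of_mem_rationalSubmodule k C (N := N))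
          (MulOpposite.op g) m
        have h₂ := ofRational_smul (isRationalElement_of_mem_rationalSubmodule k C (N := P))
          (MulOpposite.op g) (f.hom.restrict (p := rationalSubmodule k C N)
            (q := rationalSubmodule k C P) (fun _ hm => IsRationalElement.map f.hom hm) m)
        refine (congrArg _ h₁.symm).trans (Eq.trans ?_ h₂)
        exact map_smul (f.hom.restrict (p := rationalSubmodule k C N)
            (q := rationalSubmodule k C P) (fun _ hm => IsRationalElement.map f.hom hm))
            (MulOpposite.op g) (show rationalSubmodule k C N from m) }
  map_id _ := rfl
  map_comp _ _ := rfl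

instance : (rat k C).Additive where

end LeftComod


section LinearDual

variable {k : Type u} [Field k] {A : Type u} [Ring A] [Algebra k A]

/-- The `k`-linear dual of a left `A`-module is a right `A`-module: `(φ · a) m = φ (a • m)`. -/
abbrev dualModuleOfLeft (M : ModuleCat.{u} A) : Module Aᵐᵒᵖ (Module.Dual k M) where
  smul a φ := φ ∘ₗ Module.toModuleEnd k (S := A) M a.unop
  one_smul φ := by ext m; exact congrArg φ (one_smul A m)
  mul_smul a b φ := by ext m; exact congrArg φ (mul_smul b.unop a.unop m)
  smul_zero _ := rfl
  smul_add _ _ _ := rfl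
  add_smul a b φ := by
    ext m; exact (congrArg φ (add_smul a.unop b.unop m)).trans (φ.map_add _ _)
  zero_smul φ := by ext m; exact (congrArg φ (zero_smul A m)).trans φ.map_zero

/-- The `k`-linear dual of a right `A`-module is a left `A`-module: `(a φ) m = φ (m a)`. -/
abbrev dualModuleOfRight (M : ModuleCat.{u} Aᵐᵒᵖ) : Module A (Module.Dual k M) where
  smul a φ := φ ∘ₗ Module.toModuleEnd k (S := Aᵐᵒᵖ) M (MulOpposite.op a)
  one_smul φ := by ext m; exact congrArg φ (one_smul Aᵐᵒᵖ m)
  mul_smul a b φ := by ext m; exact congrArg φ (mul_smul (MulOpposite.op b) (MulOpposite.op a) m)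
  smul_zero _ := rfl
  smul_add _ _ _ := rfl
  add_smul a b φ := by
    ext m
    exact (congrArg φ (add_smul (MulOpposite.op a) (MulOpposite.op b) m)).trans (φ.map_add _ _)
  zero_smul φ := by ext m; exact (congrArg φ (zero_smul Aᵐᵒᵖ m)).trans φ.map_zero

variable (k A)

/-- The contravariant functor `(-)^* = Hom_k(-, k)` from left to right `A`-modules. -/
def dualLeft : (ModuleCat.{u} A)ᵒᵖ ⥤ ModuleCat.{u} Aᵐᵒᵖ where
  obj M := letI := dualModuleOfLeft (k := k) M.unop; ModuleCat.of Aᵐᵒᵖ (Module.Dual k M.unop)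
  map {M N} f :=
    letI := dualModuleOfLeft (k := k) M.unop
    letI := dualModuleOfLeft (k := k) N.unop
    ModuleCat.ofHom
      { toFun := fun φ => φ ∘ₗ f.unop.hom.restrictScalars k
        map_add' := fun _ _ => rfl
        map_smul' := fun a φ => LinearMap.ext fun m =>
          congrArg φ (f.unop.hom.map_smul a.unop m).symm }

/-- The contravariant functor `(-)^* = Hom_k(-, k)` from right to left `A`-modules. -/
def dualRight : (ModuleCat.{u} Aᵐᵒᵖ)ᵒᵖ ⥤ ModuleCat.{u} A where
  obj M := letI := dualModuleOfRight (k := k) M.unop; ModuleCat.of A (Module.Dual k M.unop)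
  map {M N} f :=
    letI := dualModuleOfRight (k := k) M.unop
    letI := dualModuleOfRight (k := k) N.unop
    ModuleCat.ofHom
      { toFun := fun φ => φ ∘ₗ f.unop.hom.restrictScalars k
        map_add' := fun _ _ => rfl
        map_smul' := fun a φ => LinearMap.ext fun m =>
          congrArg φ (f.unop.hom.map_smul (MulOpposite.op a) m).symm }

instance : (dualLeft k A).Additive where
  map_add {_ _ f g} := by
    apply ModuleCat.hom_ext
    apply LinearMap.ext
    intro φ
    apply LinearMap.ext
    intro m
    exact φ.map_add (f.unop.hom m) (g.unop.hom m)

instance : (dualRight k A).Additive where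
  map_add {_ _ f g} := by
    apply ModuleCat.hom_ext
    apply LinearMap.ext
    intro φ
    apply LinearMap.ext
    intro m
    exact φ.map_add (f.unop.hom m) (g.unop.hom m)

/-- Over a field, a functional that vanishes on `ker g` factors through `g`. -/
lemma exists_comp_eq_of_ker_le {X Y : Type u} [AddCommGroup X] [Module k X] [AddCommGroup Y]
    [Module k Y] (g : X →ₗ[k] Y) (φ : Module.Dual k X) (h : ∀ x, g x = 0 → φ x = 0) :
    ∃ ψ : Module.Dual k Y, ψ ∘ₗ g = φ := by
  have : φ ∈ LinearMap.range g.dualMap := by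
    rw [LinearMap.range_dualMap_eq_dualAnnihilator_ker, Submodule.mem_dualAnnihilator]
    exact fun x hx => h x hx
  exact this

lemma dualLeft_exact (S : ShortComplex (ModuleCat.{u} A)ᵒᵖ) (hS : S.Exact) :
    (S.map (dualLeft k A)).Exact := by
  rw [ShortComplex.moduleCat_exact_iff]
  have hS' := hS.unop
  rw [ShortComplex.moduleCat_exact_iff] at hS'
  intro (φ : Module.Dual k S.X₂.unop) hφ
  have hφ' : φ ∘ₗ S.g.unop.hom.restrictScalars k = 0 := hφ
  obtain ⟨ψ, hψ⟩ := exists_comp_eq_of_ker_le k (S.f.unop.hom.restrictScalars k) φ (by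
    intro x hx
    obtain ⟨y, rfl⟩ := hS' x hx
    exact LinearMap.congr_fun hφ' y)
  exact ⟨ψ, hψ⟩

lemma dualRight_exact (S : ShortComplex (ModuleCat.{u} Aᵐᵒᵖ)ᵒᵖ) (hS : S.Exact) :
    (S.map (dualRight k A)).Exact := by
  rw [ShortComplex.moduleCat_exact_iff]
  have hS' := hS.unop
  rw [ShortComplex.moduleCat_exact_iff] at hS'
  intro (φ : Module.Dual k S.X₂.unop) hφ
  have hφ' : φ ∘ₗ S.g.unop.hom.restrictScalars k = 0 := hφ
  obtain ⟨ψ, hψ⟩ := exists_comp_eq_of_ker_le k (S.f.unop.hom.restrictScalars k) φ (by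
    intro x hx
    obtain ⟨y, rfl⟩ := hS' x hx
    exact LinearMap.congr_fun hφ' y)
  exact ⟨ψ, hψ⟩

instance : PreservesFiniteLimits (dualLeft k A) :=
  have h : PreservesFiniteLimits (dualLeft k A) ∧ PreservesFiniteColimits (dualLeft k A) :=
    ((Functor.exact_tfae (dualLeft k A)).out 1 3).mp (dualLeft_exact k A)
  h.1

instance : PreservesFiniteColimits (dualLeft k A) :=
  have h : PreservesFiniteLimits (dualLeft k A) ∧ PreservesFiniteColimits (dualLeft k A) :=
    ((Functor.exact_tfae (dualLeft k A)).out 1 3).mp (dualLeft_exact k A)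
  h.2

instance : PreservesFiniteLimits (dualRight k A) :=
  have h : PreservesFiniteLimits (dualRight k A) ∧ PreservesFiniteColimits (dualRight k A) :=
    ((Functor.exact_tfae (dualRight k A)).out 1 3).mp (dualRight_exact k A)
  h.1

instance : PreservesFiniteColimits (dualRight k A) :=
  have h : PreservesFiniteLimits (dualRight k A) ∧ PreservesFiniteColimits (dualRight k A) :=
    ((Functor.exact_tfae (dualRight k A)).out 1 3).mp (dualRight_exact k A)
  h.2

end LinearDual

section ComodDual

variable (k C : Type u) [Field k] [AddCommGroup C] [Module k C] [Coalgebra k C]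

/-- The contravariant functor `(-)^*` from left `C`-comodules to left `C^*`-modules. -/
def comodDual : (LeftComod k C)ᵒᵖ ⥤ ModuleCat.{u} (DualAlgebra k C) :=
  (LeftComod.toMod k C).op ⋙ dualRight k (DualAlgebra k C)

instance : (comodDual k C).Additive := by unfold comodDual; infer_instance

instance : PreservesFiniteLimits (comodDual k C) := by
  have := preservesFiniteLimits_op (LeftComod.toMod k C)
  unfold comodDual; infer_instance

instance : PreservesFiniteColimits (comodDual k C) := by
  have := preservesFiniteColimits_op (LeftComod.toMod k C)
  unfold comodDual; infer_instance

end ComodDual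

section ContravariantDerived

variable {𝒜 : Type*} [Category* 𝒜] [Abelian 𝒜] {ℬ : Type*} [Category* ℬ] [Abelian ℬ]
  (G : 𝒜ᵒᵖ ⥤ ℬ) [G.Additive]

/-- The functor `(CochainComplex 𝒜 ℤ)ᵒᵖ ⥤ CochainComplex ℬ ℤ` induced by a contravariant functor
`G`; in degree `n`, the complex `G(K)` is `G(K^{-n})`. -/
def mapComplexOp : (CochainComplex 𝒜 ℤ)ᵒᵖ ⥤ CochainComplex ℬ ℤ :=
  (CochainComplex.opEquivalence 𝒜).functor ⋙ G.mapHomologicalComplex (ComplexShape.up ℤ)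

lemma quasiIso_opEquivalence_map {K L : CochainComplex 𝒜 ℤ} (f : K ⟶ L) [QuasiIso f] :
    QuasiIso ((CochainComplex.opEquivalence 𝒜).functor.map f.op) := by
  have h : QuasiIso ((HomologicalComplex.opFunctor 𝒜 (ComplexShape.up ℤ)).map f.op) :=
    inferInstance
  constructor
  intro n
  rw [quasiIsoAt_iff' _ (n - 1) n (n + 1) (by simp) (by simp)]
  have h' := h.quasiIsoAt (-n)
  rw [quasiIsoAt_iff' _ (-(n - 1)) (-n) (-(n + 1)) 
    (ComplexShape.prev_eq' _ (by simp; lia)) (ComplexShape.next_eq' _ (by simp))] at h'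
  exact h'

variable [PreservesFiniteLimits G] [PreservesFiniteColimits G]

lemma quasiIso_mapComplexOp_map {K L : CochainComplex 𝒜 ℤ} (f : K ⟶ L) [QuasiIso f] :
    QuasiIso ((mapComplexOp G).map f.op) := by
  have := quasiIso_opEquivalence_map f
  exact HomologicalComplex.quasiIso_map_of_preservesHomology
    ((CochainComplex.opEquivalence 𝒜).functor.map f.op) G

variable [HasDerivedCategory 𝒜] [HasDerivedCategory ℬ]

/-- The functor `D(𝒜)ᵒᵖ ⥤ D(ℬ)` induced by an exact contravariant functor. -/
def mapDerivedOp : (DerivedCategory 𝒜)ᵒᵖ ⥤ DerivedCategory ℬ :=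
  Localization.lift (mapComplexOp G ⋙ DerivedCategory.Q)
    (W := (HomologicalComplex.quasiIso 𝒜 (ComplexShape.up ℤ)).op)
    (fun _ _ f hf => by
      have : QuasiIso f.unop := hf
      have := quasiIso_mapComplexOp_map G f.unop
      dsimp
      exact inferInstanceAs (IsIso (DerivedCategory.Q.map ((mapComplexOp G).map f.unop.op))))
    DerivedCategory.Q.op

/-- On (images of) complexes, `mapDerivedOp G` is given by applying `G` termwise. -/
def mapDerivedOpFactors :
    DerivedCategory.Q.op ⋙ mapDerivedOp G ≅ mapComplexOp G ⋙ DerivedCategory.Q :=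
  Localization.fac _ _ _

lemma mapDerivedOp_plus (X : DerivedCategory 𝒜) (h : DerivedCategory.TStructure.t.minus X) :
    DerivedCategory.TStructure.t.plus ((mapDerivedOp G).obj (Opposite.op X)) := by
  obtain ⟨n, ⟨K, e, hK⟩⟩ := h
  refine ⟨-n, ⟨(mapComplexOp G).obj (Opposite.op K),
    (mapDerivedOp G).mapIso e.symm.op ≪≫ (mapDerivedOpFactors G).app (Opposite.op K), ?_⟩⟩
  rw [CochainComplex.isStrictlyGE_iff]
  intro i hi
  exact G.map_isZero (IsZero.op (K.isZero_of_isStrictlyLE n (-i) (by lia)))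

lemma mapDerivedOp_minus (X : DerivedCategory 𝒜) (h : DerivedCategory.TStructure.t.plus X) :
    DerivedCategory.TStructure.t.minus ((mapDerivedOp G).obj (Opposite.op X)) := by
  obtain ⟨n, ⟨K, e, hK⟩⟩ := h
  refine ⟨-n, ⟨(mapComplexOp G).obj (Opposite.op K),
    (mapDerivedOp G).mapIso e.symm.op ≪≫ (mapDerivedOpFactors G).app (Opposite.op K), ?_⟩⟩
  rw [CochainComplex.isStrictlyLE_iff]
  intro i hi
  exact G.map_isZero (IsZero.op (K.isZero_of_isStrictlyGE n (-i) (by lia)))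

/-- The functor `D⁻(𝒜)ᵒᵖ ⥤ D⁺(ℬ)` induced by an exact contravariant functor. -/
def mapMinusOp : (DerivedCategory.Minus 𝒜)ᵒᵖ ⥤ DerivedCategory.Plus ℬ :=
  ObjectProperty.lift _ (DerivedCategory.Minus.ι.op ⋙ mapDerivedOp G)
    fun X => mapDerivedOp_plus G _ X.unop.property

/-- The functor `D⁺(𝒜)ᵒᵖ ⥤ D⁻(ℬ)` induced by an exact contravariant functor. -/
def mapPlusOp : (DerivedCategory.Plus 𝒜)ᵒᵖ ⥤ DerivedCategory.Minus ℬ :=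
  ObjectProperty.lift _ (DerivedCategory.Plus.ι.op ⋙ mapDerivedOp G)
    fun X => mapDerivedOp_minus G _ X.unop.property

end ContravariantDerived


section Artinian

variable (k C : Type u) [Field k] [AddCommGroup C] [Module k C] [Coalgebra k C]

/-- A left coideal: a subspace `V` of `C` with `Δ(V) ⊆ C ⊗ V`, i.e. a subcomodule of `C` regarded
as a left `C`-comodule, or equivalently a right `C^*`-submodule of `C`. -/
def IsLeftCoideal (V : Submodule k C) : Prop :=
  ∀ c ∈ V, (Coalgebra.comul c : C ⊗[k] C) ∈ LinearMap.range (V.subtype.lTensor C)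

/-- A right coideal: a subspace `V` of `C` with `Δ(V) ⊆ V ⊗ C`, i.e. a subcomodule of `C` regarded
as a right `C`-comodule, or equivalently a left `C^*`-submodule of `C`. -/
def IsRightCoideal (V : Submodule k C) : Prop :=
  ∀ c ∈ V, (Coalgebra.comul c : C ⊗[k] C) ∈ LinearMap.range (V.subtype.rTensor C)

/-- A coalgebra is artinian if it satisfies the descending chain condition on left coideals and
on right coideals. -/
structure IsArtinianCoalgebra : Prop where
  left : WellFoundedLT {V : Submodule k C // IsLeftCoideal k C V}
  right : WellFoundedLT {V : Submodule k C // IsRightCoideal k C V}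

end Artinian

section Subcategories

variable {k C : Type u} [Field k] [AddCommGroup C] [Module k C] [Coalgebra k C]

/-- A left comodule `M` is quasi-finite if `Hom_C(N, M)` is finite dimensional for every finite
dimensional left comodule `N`. -/
def IsQuasiFinite (M : LeftComod k C) : Prop :=
  ∀ N : LeftComod k C, Module.Finite k N.carrier → Module.Finite k (LeftComod.homSubmodule N M)

variable (k C) [HasDerivedCategory.{w₁} (ModuleCat.{u} (DualAlgebra k C))]
  [HasDerivedCategory.{w₃} (LeftComod k C)]

/-- `D⁻_fg(C^*-Mod)` as a full subcategory of `D⁻(C^*-Mod)`: all cohomology modules are finitely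
generated. -/
def fgMinus : ObjectProperty (DerivedCategory.Minus (ModuleCat.{u} (DualAlgebra k C))) :=
  fun X => ∀ n : ℤ,
    Module.Finite (DualAlgebra k C)
      ((DerivedCategory.homologyFunctor (ModuleCat.{u} (DualAlgebra k C)) n).obj X.obj)

/-- `D^b_fg(C^*-Mod)` as a full subcategory of `D⁻(C^*-Mod)`. -/
def fgBounded : ObjectProperty (DerivedCategory.Minus (ModuleCat.{u} (DualAlgebra k C))) :=
  fun X => fgMinus k C X ∧ DerivedCategory.TStructure.t.bounded X.obj

/-- `D⁺_qf(C-comod)` as a full subcategory of `D⁺(C-comod)`: all cohomology comodules are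
quasi-finite. -/
def qfPlus : ObjectProperty (DerivedCategory.Plus (LeftComod k C)) :=
  fun X => ∀ n : ℤ, IsQuasiFinite ((DerivedCategory.homologyFunctor (LeftComod k C) n).obj X.obj)

/-- `D^b_qf(C-comod)` as a full subcategory of `D⁺(C-comod)`. -/
def qfBounded : ObjectProperty (DerivedCategory.Plus (LeftComod k C)) :=
  fun X => qfPlus k C X ∧ DerivedCategory.TStructure.t.bounded X.obj

/-- The functor `(-)^* : D⁺(C-comod)ᵒᵖ ⥤ D⁻(C^*-Mod)`. -/
def derivedDual : (DerivedCategory.Plus (LeftComod k C))ᵒᵖ ⥤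
    DerivedCategory.Minus (ModuleCat.{u} (DualAlgebra k C)) :=
  mapPlusOp (comodDual k C)

variable [HasDerivedCategory.{w₂} (ModuleCat.{u} (DualAlgebra k C)ᵐᵒᵖ)]

/-- The functor `RΓ° ∘ (-)^* : D⁻(C^*-Mod)ᵒᵖ ⥤ D⁺(C-comod)`: the `k`-linear dual, from complexes of
left to complexes of right `C^*`-modules, followed by the right derived functor of the rational
(= torsion) functor from right `C^*`-modules to left `C`-comodules. -/
def derivedTorsionDual : (DerivedCategory.Minus (ModuleCat.{u} (DualAlgebra k C)))ᵒᵖ ⥤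
    DerivedCategory.Plus (LeftComod k C) :=
  mapMinusOp (dualLeft k (DualAlgebra k C)) ⋙ (LeftComod.rat k C).rightDerivedFunctorPlus

end Subcategories

section Torsion

variable {k C : Type u} [Field k] [AddCommGroup C] [Module k C] [Coalgebra k C]

/-- The elements `m` of `Γ°(N)`, for a right `C^*`-module `N`: those with `m Jⁿ = 0` for some `n`,
where `J` is the Jacobson radical of `C^*`. -/
def IsTorsionElement {N : ModuleCat.{u} (DualAlgebra k C)ᵐᵒᵖ} (m : N) : Prop :=
  ∃ n : ℕ, ∀ a ∈ ((Ring.jacobson (DualAlgebra k C)).restrictScalars k) ^ n,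
    MulOpposite.op a • m = 0

end Torsion

section TriangulatedDuality

open scoped Pretriangulated.Opposite

/-- Contravariant functors `F : Tᵒᵖ ⥤ S` and `G : Sᵒᵖ ⥤ T` restrict to quasi-inverse dualities of
triangulated categories between the full subcategories of `T` and `S` given by `P` and `Q`: these
are triangulated subcategories, and there is an equivalence `e : Pᵒᵖ ≌ Q` of triangulated
categories such that `e` is the restriction of `F` and its quasi-inverse is the
restriction of `G`. -/
def IsTriangulatedDuality {T S : Type*} [Category* T] [Category* S]
    [HasZeroObject T] [Preadditive T] [HasShift T ℤ] [∀ n : ℤ, (shiftFunctor T n).Additive]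
    [Pretriangulated T]
    [HasZeroObject S] [Preadditive S] [HasShift S ℤ] [∀ n : ℤ, (shiftFunctor S n).Additive]
    [Pretriangulated S]
    (P : ObjectProperty T) (Q : ObjectProperty S) (F : Tᵒᵖ ⥤ S) (G : Sᵒᵖ ⥤ T) : Prop :=
  ∃ (_ : P.IsTriangulated) (_ : Q.IsTriangulated)
    (e : P.FullSubcategoryᵒᵖ ≌ Q.FullSubcategory) (_ : e.functor.CommShift ℤ),
    e.functor.IsTriangulated ∧
      Nonempty (e.functor ⋙ Q.ι ≅ P.ι.op ⋙ F) ∧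
      Nonempty (e.inverse ⋙ P.ι.op ≅ Q.ι ⋙ G.rightOp)

end TriangulatedDuality

end

end CoalgDuality

open CoalgDuality
open scoped ModuleCat

/-! Write R(X) = Γ°(X^*) for a left C^*-module X. Since Γ° is right adjoint to the inclusion of
comodules into right modules, Hom(X, M^*) ≅ Hom(M, R(X)): the functors (-)^* and R form a
contravariant adjunction (`comodDualAdjunction`). The rational functionals on C^* are the
evaluations at elements of C, so X ≅ R(X)^* for X free of finite rank (`isIso_counit_of_free`).

The input from coalgebra theory is as follows. A finitely generated left ideal of C^* consists of
all functionals that vanish on its annihilator in C (`mem_of_forall_mem_perp`), so the chain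
condition on left coideals makes C^* left noetherian. The socle of C is finite dimensional, so the
powers of J have finite codimension; this identifies rational with torsion elements
(`isRationalElement_iff_exists_radPow`) and shows that M is quasi-finite exactly when M^* is
finitely generated (`isQuasiFinite_iff_finite_comodDual`).

As (-)^* is exact, a complex Y has quasi-finite cohomology if and only if Y^* has finitely generated
cohomology. Over the noetherian ring C^* such a Y^* is represented by a bounded above complex P of
free modules of finite rank (`exists_free_complex`). Termwise, R(P)^* ≅ P, which gives essential
surjectivity. As P is K-projective, a morphism P → K^* in the derived category is a chain map, and
by adjunction it is the dual of a chain map K → R(P); this gives fullness. As (-)^* reflects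
quasi-isomorphisms, Y^* ≅ P implies Y ≅ R(P).

Finally, P^* is a complex of injectives, so RΓ°(Y^{**}) is computed by Γ°(P^*) = R(P), and the
biduality morphism Y → RΓ°(Y^{**}) is invertible. Its naturality yields faithfulness of (-)^* and
identifies RΓ° ∘ (-)^* with the quasi-inverse, so only (-)^* has to be shown to be triangulated
(`isTriangulatedDuality_of_full`). -/

namespace CoalgDuality
noncomputable section
open scoped ModuleCat

/-! ### Exact contravariant functors: shifts and distinguished triangles -/

section ContravariantShift

open Pretriangulated Pretriangulated.Opposite Opposite HomologicalComplex

variable {𝒜 : Type*} [Category* 𝒜] [Abelian 𝒜] {ℬ : Type*} [Category* ℬ] [Abelian ℬ]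
  (G : 𝒜ᵒᵖ ⥤ ℬ) [G.Additive]

lemma mapComplexOp_map_f {K L : CochainComplex 𝒜 ℤ} (f : K ⟶ L) (i : ℤ) :
    ((mapComplexOp G).map f.op).f i = G.map (f.f (-i)).op := rfl

lemma map_units_smul_op {X Y : 𝒜} (a : ℤˣ) (f : X ⟶ Y) :
    G.map (a • f).op = a • G.map f.op := by
  obtain rfl | rfl := Int.units_eq_one_or a
  · simp
  · simp [Functor.map_neg]

/-- The comparison `G(K⟦m⟧) ≅ G(K)⟦n⟧`, for `n + m = 0`. -/
def mapComplexOpShiftIso (K : CochainComplex 𝒜 ℤ) (n m : ℤ) (h : n + m = 0) :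
    (mapComplexOp G).obj (op (K⟦m⟧)) ≅ ((mapComplexOp G).obj (op K))⟦n⟧ :=
  Hom.isoOfComponents
    (fun i => G.mapIso (K.XIsoOfEq (show -(i + n) = -i + m by lia)).op) (by
      rintro i j -
      change G.map (K.XIsoOfEq _).hom.op ≫ (n.negOnePow • G.map (K.d (-(j + n)) (-(i + n))).op) =
        G.map ((m.negOnePow • K.d (-j + m) (-i + m))).op ≫ G.map (K.XIsoOfEq _).hom.op
      -- The two differentials carry the signs (-1)^m and (-1)^n, which agree for m = -n; the
      -- comparison therefore needs no sign of its own.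
      obtain rfl : m = -n := by lia
      rw [map_units_smul_op, Linear.comp_units_smul, Linear.units_smul_comp, Int.negOnePow_neg,
        ← G.map_comp, ← G.map_comp, ← op_comp, ← op_comp, XIsoOfEq_hom_comp_d,
        d_comp_XIsoOfEq_hom])

lemma mapComplexOpShiftIso_naturality {K L : CochainComplex 𝒜 ℤ} (f : K ⟶ L)
    (n m : ℤ) (h : n + m = 0) :
    (mapComplexOp G).map (f⟦m⟧').op ≫ (mapComplexOpShiftIso G K n m h).hom =
      (mapComplexOpShiftIso G L n m h).hom ≫ ((mapComplexOp G).map f.op)⟦n⟧' := by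
  ext i
  change G.map (f.f (-i + m)).op ≫ G.map (K.XIsoOfEq _).hom.op =
    G.map (L.XIsoOfEq _).hom.op ≫ G.map (f.f (-(i + n))).op
  rw [← G.map_comp, ← G.map_comp, ← op_comp, ← op_comp, XIsoOfEq_hom_naturality]

/-- The commutation of `mapComplexOp G` with the shift by `n`. -/
def mapComplexOpCommShiftIso (n : ℤ) :
    shiftFunctor (CochainComplex 𝒜 ℤ)ᵒᵖ n ⋙ mapComplexOp G ≅
      mapComplexOp G ⋙ shiftFunctor (CochainComplex ℬ ℤ) n :=
  NatIso.ofComponents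
    (fun K => (mapComplexOp G).mapIso
      ((shiftFunctorOpIso (CochainComplex 𝒜 ℤ) n (-n) (by lia)).app K) ≪≫
        mapComplexOpShiftIso G K.unop n (-n) (by lia)) (by
    intro K L f
    have h := mapComplexOpShiftIso_naturality G f.unop n (-n) (by lia)
    have h' := congrArg (mapComplexOp G).map
      ((shiftFunctorOpIso (CochainComplex 𝒜 ℤ) n (-n) (by lia)).hom.naturality f)
    rw [Functor.map_comp, Functor.map_comp] at h'
    simp only [Functor.comp_map, Iso.trans_hom, Functor.mapIso_hom, Iso.app_hom, Category.assoc]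
    rw [reassoc_of% h']
    erw [h]
    rfl)

/-- The definition fixes m = -n; the coherence proofs also need forms such as m = -a + -b with n = a
+ b. -/
lemma mapComplexOpCommShiftIso_hom_app (n m : ℤ) (h : n + m = 0) (K : (CochainComplex 𝒜 ℤ)ᵒᵖ) :
    (mapComplexOpCommShiftIso G n).hom.app K =
      (mapComplexOp G).map ((shiftFunctorOpIso (CochainComplex 𝒜 ℤ) n m h).hom.app K) ≫
        (mapComplexOpShiftIso G K.unop n m h).hom := by
  obtain rfl : m = -n := by lia
  rfl

/-- All shift isomorphisms involved are reindexings in each degree, so with this lemma and the next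
their coherences become composites of transports along equalities of integers. -/
lemma mapComplexOp_XIsoOfEq_hom (K : CochainComplex 𝒜 ℤ) {i j : ℤ} (h : i = j) :
    (((mapComplexOp G).obj (op K)).XIsoOfEq h).hom =
      G.map (K.XIsoOfEq (show -j = -i by rw [h])).hom.op := by
  subst h
  exact (G.map_id _).symm

set_option linter.unusedSectionVars false in
lemma map_XIsoOfEq_op_comp (K : CochainComplex 𝒜 ℤ) {p q r : ℤ} (h₁ : q = p) (h₂ : r = q) :
    G.map (K.XIsoOfEq h₁).hom.op ≫ G.map (K.XIsoOfEq h₂).hom.op =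
      G.map (K.XIsoOfEq (h₂.trans h₁)).hom.op := by
  rw [← G.map_comp, ← op_comp, XIsoOfEq_hom_comp_XIsoOfEq_hom]

lemma mapComplexOpShiftIso_zero (K : CochainComplex 𝒜 ℤ) :
    (mapComplexOpShiftIso G K 0 0 (zero_add 0)).hom =
      (mapComplexOp G).map ((shiftFunctorZero (CochainComplex 𝒜 ℤ) ℤ).inv.app K).op ≫
        (shiftFunctorZero (CochainComplex ℬ ℤ) ℤ).inv.app ((mapComplexOp G).obj (op K)) := by
  ext i
  exact ((congrArg _ (mapComplexOp_XIsoOfEq_hom G K (show i = i + 0 by simp))).trans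
    (map_XIsoOfEq_op_comp G K (show -i = -i + 0 by simp) (show -(i + 0) = -i by simp))).symm

lemma mapComplexOpShiftIso_add (K : CochainComplex 𝒜 ℤ) (a b : ℤ) :
    (mapComplexOpShiftIso G K (a + b) (-a + -b) (by lia)).hom =
      (mapComplexOp G).map
        ((shiftFunctorAdd' (CochainComplex 𝒜 ℤ) (-a) (-b) (-a + -b) rfl).inv.app K).op ≫
      (mapComplexOpShiftIso G (K⟦-a⟧) b (-b) (by lia)).hom ≫
      (mapComplexOpShiftIso G K a (-a) (by lia)).hom⟦b⟧' ≫
        (shiftFunctorAdd' (CochainComplex ℬ ℤ) a b (a + b) rfl).inv.app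
          ((mapComplexOp G).obj (op K)) := by
  ext i
  rw [shiftFunctorAdd'_eq_shiftFunctorAdd, shiftFunctorAdd'_eq_shiftFunctorAdd]
  refine Eq.symm ?_
  have e₁ := mapComplexOp_XIsoOfEq_hom G K (show i + b + a = i + (a + b) by lia)
  have e₂ := map_XIsoOfEq_op_comp G K (show -(i + b + a) = -(i + b) + -a by lia)
    (show -(i + (a + b)) = -(i + b + a) by lia)
  have e₃ := map_XIsoOfEq_op_comp G K (show -(i + b) + -a = -i + -b + -a by lia)
    (show -(i + (a + b)) = -(i + b) + -a by lia)
  have e₄ := map_XIsoOfEq_op_comp G K (show -i + -b + -a = -i + (-a + -b) by lia)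
    (show -(i + (a + b)) = -i + -b + -a by lia)
  refine Eq.trans ?_ e₄
  refine congrArg (G.map (K.XIsoOfEq (show -i + -b + -a = -i + (-a + -b) by lia)).hom.op ≫ ·) ?_
  refine Eq.trans ?_ e₃
  refine congrArg (G.map (K.XIsoOfEq (show -(i + b) + -a = -i + -b + -a by lia)).hom.op ≫ ·) ?_
  exact (congrArg (G.map (K.XIsoOfEq (show -(i + b + a) = -(i + b) + -a by lia)).hom.op ≫ ·)
    e₁).trans e₂

instance : (mapComplexOp G).CommShift ℤ where
  commShiftIso := mapComplexOpCommShiftIso G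
  commShiftIso_zero := by
    apply Iso.ext; apply NatTrans.ext; funext K
    rw [mapComplexOpCommShiftIso_hom_app G 0 0 (by lia), Functor.CommShift.isoZero_hom_app,
      shiftFunctorZero_op_hom_app, Functor.map_comp, Category.assoc, mapComplexOpShiftIso_zero]
  commShiftIso_add a b := by
    apply Iso.ext; apply NatTrans.ext; funext K
    have nat := (mapComplexOpCommShiftIso G b).hom.naturality
      ((shiftFunctorOpIso (CochainComplex 𝒜 ℤ) a (-a) (by lia)).inv.app K)
    rw [mapComplexOpCommShiftIso_hom_app G b (-b) (by lia)
      ((shiftFunctor (CochainComplex 𝒜 ℤ) (-a)).op.obj K), Category.assoc] at nat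
    rw [mapComplexOpCommShiftIso_hom_app G (a + b) (-a + -b) (by lia),
      Functor.CommShift.isoAdd_hom_app, ← shiftFunctorAdd'_eq_shiftFunctorAdd,
      ← shiftFunctorAdd'_eq_shiftFunctorAdd,
      shiftFunctorAdd'_op_hom_app K a b (a + b) rfl (-a) (-b) (-a + -b) (by lia) (by lia) (by lia),
      mapComplexOpCommShiftIso_hom_app G a (-a) (by lia),
      mapComplexOpShiftIso_add]
    simp only [Functor.map_comp, Category.assoc]
    congr 2
    dsimp only [Functor.comp_map] at nat
    rw [reassoc_of% nat]
    have c₁ : (mapComplexOp G).map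
          ((shiftFunctorOpIso (CochainComplex 𝒜 ℤ) b (-b) (by lia)).inv.app (op (K.unop⟦-a⟧))) ≫
        (mapComplexOp G).map
          ((shiftFunctorOpIso (CochainComplex 𝒜 ℤ) b (-b) (by lia)).hom.app (op (K.unop⟦-a⟧))) =
        𝟙 _ := by
      rw [← Functor.map_comp, Iso.inv_hom_id_app, CategoryTheory.Functor.map_id]
    erw [reassoc_of% c₁]
    rw [← Functor.map_comp_assoc (shiftFunctor _ b), ← Functor.map_comp (mapComplexOp G),
      Iso.inv_hom_id_app, CategoryTheory.Functor.map_id, CategoryTheory.Functor.map_id,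
      Category.id_comp]
    rfl

section Splitting

variable (S : ShortComplex (CochainComplex 𝒜 ℤ))
  (σ : ∀ n, (S.map (HomologicalComplex.eval 𝒜 _ n)).Splitting)

instance : (mapComplexOp G).Additive where
  map_add {K L f g} := by
    ext i
    exact G.map_add (f := (f.unop.f (-i)).op) (g := (g.unop.f (-i)).op)

/-- The image of a short complex of complexes under a contravariant functor. -/
def dualShortComplex : ShortComplex (CochainComplex ℬ ℤ) := S.op.map (mapComplexOp G)

/-- A contravariant additive functor preserves degreewise splittings. -/
def dualSplitting (n : ℤ) :
    ((dualShortComplex G S).map (HomologicalComplex.eval ℬ _ n)).Splitting :=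
  (σ (-n)).op.map G

-- A connecting morphism is section, differential, retraction. A contravariant functor reverses the
-- order and exchanges section and retraction, so the shape is self-dual, without sign. The equality
-- q = p is kept as a variable because -(i + 1) + 1 and -i are different expressions.
set_option linter.unusedSectionVars false in
lemma map_splitting_connecting_op (n p q : ℤ) (h : q = p) :
    G.map (S.X₁.XIsoOfEq h).hom.op ≫ G.map (show S.X₃.X n ⟶ S.X₁.X q from
        (show S.X₃.X n ⟶ S.X₂.X n from (σ n).s) ≫ S.X₂.d n q ≫ (σ q).r).op =
      G.map (show S.X₂.X p ⟶ S.X₁.X p from (σ p).r).op ≫ G.map (S.X₂.d n p).op ≫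
        G.map (show S.X₃.X n ⟶ S.X₂.X n from (σ n).s).op := by
  subst h
  rw [HomologicalComplex.XIsoOfEq_rfl, Iso.refl_hom, op_id, CategoryTheory.Functor.map_id,
    Category.id_comp, ← G.map_comp, ← G.map_comp, ← op_comp, ← op_comp, Category.assoc]

/-- The left side is the third morphism of the image of an opposite triangle; naturality of the
shift comparison separates it into an isomorphism independent of h and the shift of G(h). -/
lemma mapComplexOp_connecting {K L : CochainComplex 𝒜 ℤ} (h : L ⟶ K⟦(1 : ℤ)⟧) :
    (mapComplexOp G).map
      ((opShiftFunctorEquivalence (CochainComplex 𝒜 ℤ) 1).counitIso.inv.app (op K) ≫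
        h.op⟦(1 : ℤ)⟧') ≫ ((mapComplexOp G).commShiftIso (1 : ℤ)).hom.app (op L) =
    ((mapComplexOp G).map
      ((opShiftFunctorEquivalence (CochainComplex 𝒜 ℤ) 1).counitIso.inv.app (op K)) ≫
      ((mapComplexOp G).commShiftIso (1 : ℤ)).hom.app (op (K⟦(1 : ℤ)⟧))) ≫
        ((mapComplexOp G).map h.op)⟦(1 : ℤ)⟧' := by
  have nat := ((mapComplexOp G).commShiftIso (1 : ℤ)).hom.naturality h.op
  dsimp only [Functor.comp_map] at nat
  rw [Functor.map_comp, Category.assoc, Category.assoc]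
  exact congrArg _ nat

lemma mapComplexOp_counitIso_inv_app (K : CochainComplex 𝒜 ℤ) (i : ℤ) :
    ((mapComplexOp G).map
      ((opShiftFunctorEquivalence (CochainComplex 𝒜 ℤ) 1).counitIso.inv.app (op K)) ≫
      ((mapComplexOp G).commShiftIso (1 : ℤ)).hom.app (op (K⟦(1 : ℤ)⟧))).f i =
    G.map (K.XIsoOfEq (show -(i + 1) + 1 = -i by lia)).hom.op := by
  have h := mapComplexOpCommShiftIso_hom_app G 1 (-1) (by lia) (op (K⟦(1 : ℤ)⟧))
  have h₁ : (mapComplexOp G).map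
      ((opShiftFunctorEquivalence (CochainComplex 𝒜 ℤ) 1).counitIso.inv.app (op K)) ≫
      ((mapComplexOp G).commShiftIso (1 : ℤ)).hom.app (op (K⟦(1 : ℤ)⟧)) =
      (mapComplexOp G).map
        ((shiftFunctorCompIsoId (CochainComplex 𝒜 ℤ) 1 (-1) (by lia)).hom.app K).op ≫
        (mapComplexOpShiftIso G (K⟦(1 : ℤ)⟧) 1 (-1) (by lia)).hom := by
    change _ ≫ (mapComplexOpCommShiftIso G 1).hom.app _ = _
    have c₁ : (mapComplexOp G).map
          ((shiftFunctorOpIso (CochainComplex 𝒜 ℤ) 1 (-1) (by lia)).inv.app (op (K⟦(1 : ℤ)⟧))) ≫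
        (mapComplexOp G).map
          ((shiftFunctorOpIso (CochainComplex 𝒜 ℤ) 1 (-1) (by lia)).hom.app (op (K⟦(1 : ℤ)⟧))) =
        𝟙 _ := by
      rw [← Functor.map_comp, Iso.inv_hom_id_app, CategoryTheory.Functor.map_id]
    rw [opShiftFunctorEquivalence_counitIso_inv_app _ 1 (-1) (by lia), Functor.map_comp,
      Category.assoc]
    erw [h, reassoc_of% c₁]
  have h₂ : ((shiftFunctorCompIsoId (CochainComplex 𝒜 ℤ) 1 (-1) (by lia)).hom.app K).f (-i) =
      (by
        change K.X (-i + -1 + 1) ⟶ K.X (-i)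
        exact (K.XIsoOfEq (by lia)).hom) := by
    simp only [shiftFunctorCompIsoId, Iso.trans_hom, Iso.symm_hom, NatTrans.comp_app,
      HomologicalComplex.comp_f]
    rw [CochainComplex.shiftFunctorAdd'_inv_app_f', CochainComplex.shiftFunctorZero_hom_app_f]
    exact XIsoOfEq_hom_comp_XIsoOfEq_hom _ _ _
  rw [h₁, HomologicalComplex.comp_f, mapComplexOp_map_f, h₂]
  exact map_XIsoOfEq_op_comp G K (show -i + -1 + 1 = -i by lia)
    (show -(i + 1) + 1 = -i + -1 + 1 by lia)

/-- The triangle attached to the dual of a degreewise split sequence is the dual of the triangle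
attached to the sequence. -/
def mapTriangleDegreewiseSplitIso :
    (mapComplexOp G).mapTriangle.obj ((triangleOpEquivalence _).functor.obj
      (op (CochainComplex.triangleOfDegreewiseSplit S σ))) ≅
    CochainComplex.triangleOfDegreewiseSplit (dualShortComplex G S) (dualSplitting G S σ) :=
  Triangle.isoMk _ _ (Iso.refl _) (Iso.refl _) (Iso.refl _)
    ((Category.comp_id _).trans (Category.id_comp _).symm)
    ((Category.comp_id _).trans (Category.id_comp _).symm) (by
      -- Only the square of the third morphisms has content.
      refine Eq.trans ?_ (Category.id_comp _).symm
      refine Eq.trans (b := ((mapComplexOp G).map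
        ((opShiftFunctorEquivalence (CochainComplex 𝒜 ℤ) 1).counitIso.inv.app (op S.X₁)) ≫
        ((mapComplexOp G).commShiftIso (1 : ℤ)).hom.app (op (S.X₁⟦(1 : ℤ)⟧))) ≫
          ((mapComplexOp G).map (CochainComplex.homOfDegreewiseSplit S σ).op)⟦(1 : ℤ)⟧') ?_ ?_
      · refine Eq.trans (congrArg _ (CategoryTheory.Functor.map_id _ _)) ?_
        exact (Category.comp_id _).trans
          (mapComplexOp_connecting G (CochainComplex.homOfDegreewiseSplit S σ))
      · ext i
        rw [HomologicalComplex.comp_f, mapComplexOp_counitIso_inv_app]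
        change _ = (CochainComplex.homOfDegreewiseSplit (dualShortComplex G S)
          (dualSplitting G S σ)).f i
        rw [CochainComplex.homOfDegreewiseSplit_f]
        refine Eq.trans (congrArg _ ?_)
          (map_splitting_connecting_op G S σ (-(i + 1)) (-i) (-(i + 1) + 1) (by lia))
        exact congrArg (fun φ => G.map φ.op)
          (CochainComplex.homOfDegreewiseSplit_f S σ (-(i + 1))))

end Splitting

section Derived

variable [PreservesFiniteLimits G] [PreservesFiniteColimits G]
variable [HasDerivedCategory 𝒜] [HasDerivedCategory ℬ]

instance : Localization.Lifting DerivedCategory.Q.op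
    (HomologicalComplex.quasiIso 𝒜 (ComplexShape.up ℤ)).op
    (mapComplexOp G ⋙ DerivedCategory.Q) (mapDerivedOp G) :=
  ⟨mapDerivedOpFactors G⟩

instance : (mapDerivedOp G).CommShift ℤ :=
  Functor.commShiftOfLocalization DerivedCategory.Q.op
    (HomologicalComplex.quasiIso 𝒜 (ComplexShape.up ℤ)).op ℤ
    (mapComplexOp G ⋙ DerivedCategory.Q) (mapDerivedOp G)

instance : NatTrans.CommShift (mapDerivedOpFactors G).hom ℤ :=
  NatTrans.commShift_iso_hom_of_localization DerivedCategory.Q.op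
    (HomologicalComplex.quasiIso 𝒜 (ComplexShape.up ℤ)).op ℤ
    (mapComplexOp G ⋙ DerivedCategory.Q) (mapDerivedOp G)

/-- Two rotations turn this triangle into the mapping cone triangle of the connecting morphism. -/
lemma distinguished_triangleOfDegreewiseSplit (S : ShortComplex (CochainComplex ℬ ℤ))
    (σ : ∀ n, (S.map (HomologicalComplex.eval ℬ _ n)).Splitting) :
    DerivedCategory.Q.mapTriangle.obj (CochainComplex.triangleOfDegreewiseSplit S σ) ∈
      distTriang (DerivedCategory ℬ) := by
  rw [Pretriangulated.rotate_distinguished_triangle, Pretriangulated.rotate_distinguished_triangle,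
    DerivedCategory.mem_distTriang_iff]
  exact ⟨_, _, CochainComplex.homOfDegreewiseSplit S σ,
    ⟨(rotate _).mapIso (DerivedCategory.Q.mapTriangleRotateIso.app _) ≪≫
      DerivedCategory.Q.mapTriangleRotateIso.app _ ≪≫ DerivedCategory.Q.mapTriangle.mapIso
        (CochainComplex.triangleOfDegreewiseSplitRotateRotateIso S σ)⟩⟩

/-- Degreewise split sequences, unlike mapping cone triangles, are visibly stable under
contravariant functors, so distinguished triangles are put in this form before dualising. -/
lemma exists_iso_triangleOfDegreewiseSplit (T : Triangle (DerivedCategory 𝒜))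
    (hT : T ∈ distTriang (DerivedCategory 𝒜)) :
    ∃ (S : ShortComplex (CochainComplex 𝒜 ℤ))
      (σ : ∀ n, (S.map (HomologicalComplex.eval 𝒜 _ n)).Splitting),
      Nonempty (T ≅
        DerivedCategory.Q.mapTriangle.obj (CochainComplex.triangleOfDegreewiseSplit S σ)) := by
  obtain ⟨K, L, φ, ⟨e⟩⟩ := (DerivedCategory.mem_distTriang_iff _).1 (inv_rot_of_distTriang _ hT)
  exact ⟨_, _, ⟨(triangleRotation _).counitIso.symm.app _ ≪≫ (rotate _).mapIso e ≪≫
    DerivedCategory.Q.mapTriangleRotateIso.app _ ≪≫ DerivedCategory.Q.mapTriangle.mapIso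
      (CochainComplex.mappingCone.triangleRotateIsoTriangleOfDegreewiseSplit φ)⟩⟩

instance : (mapDerivedOp G).IsTriangulated where
  map_distinguished T hT := by
    rw [mem_distTriang_op_iff] at hT
    obtain ⟨S, σ, ⟨e⟩⟩ := exists_iso_triangleOfDegreewiseSplit _ hT
    refine Pretriangulated.isomorphic_distinguished _
      (distinguished_triangleOfDegreewiseSplit (dualShortComplex G S) (dualSplitting G S σ)) _ ?_
    exact (mapDerivedOp G).mapTriangle.mapIso
        ((triangleOpEquivalence _).counitIso.symm.app T ≪≫
          (triangleOpEquivalence _).functor.mapIso e.symm.op ≪≫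
          DerivedCategory.Q.mapTriangleOpCompTriangleOpEquivalenceFunctorApp _) ≪≫
      (Functor.mapTriangleCompIso _ _).symm.app _ ≪≫
      (Functor.mapTriangleIso (mapDerivedOpFactors G)).app _ ≪≫
      (Functor.mapTriangleCompIso _ _).app _ ≪≫
      DerivedCategory.Q.mapTriangle.mapIso (mapTriangleDegreewiseSplitIso G S σ)

end Derived

end ContravariantShift

/-! ### Homology of the dual complex -/

section ContravariantHomology

open Pretriangulated Pretriangulated.Opposite Opposite HomologicalComplex

variable {𝒜 : Type*} [Category* 𝒜] [Abelian 𝒜] {ℬ : Type*} [Category* ℬ] [Abelian ℬ]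
  (G : 𝒜ᵒᵖ ⥤ ℬ) [G.Additive] [PreservesFiniteLimits G] [PreservesFiniteColimits G]

/-- The homology of `G(K)` in degree `n` is `G` of the homology of `K` in degree `-n`. -/
def mapComplexOpHomologyIso (K : CochainComplex 𝒜 ℤ) (n : ℤ) :
    ((mapComplexOp G).obj (op K)).homology n ≅ G.obj (op (K.homology (-n))) :=
  (ShortComplex.homologyMapIso
    (((mapComplexOp G).obj (op K)).isoSc' (n - 1) n (n + 1) (by simp) (by simp))) ≪≫
  (((K.sc' (-(n + 1)) (-n) (-(n - 1))).op.mapHomologyIso G) ≪≫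
    G.mapIso ((K.sc' (-(n + 1)) (-n) (-(n - 1))).homologyOpIso ≪≫
      (ShortComplex.homologyMapIso
    (K.isoSc' (-(n + 1)) (-n) (-(n - 1)) (by simp; lia) (by simp; lia))).op))

/-- An exact functor that reflects isomorphisms detects quasi-isomorphisms; the rest is the
reindexing n ↦ -n. -/
lemma quasiIso_of_quasiIso_mapComplexOp_map [G.ReflectsIsomorphisms] {K L : CochainComplex 𝒜 ℤ}
    (f : K ⟶ L) [QuasiIso ((mapComplexOp G).map f.op)] : QuasiIso f := by
  have h₁ : QuasiIso ((CochainComplex.opEquivalence 𝒜).functor.map f.op) :=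
    (quasiIso_map_iff_of_preservesHomology _ G).1
      (inferInstanceAs (QuasiIso ((mapComplexOp G).map f.op)))
  have h₂ : QuasiIso ((HomologicalComplex.opFunctor 𝒜 (ComplexShape.up ℤ)).map f.op) := by
    constructor
    intro n
    obtain ⟨m, rfl⟩ : ∃ m, n = -m := ⟨-n, by simp⟩
    have h' := h₁.quasiIsoAt m
    rw [quasiIsoAt_iff' _ (m - 1) m (m + 1) (by simp) (by simp)] at h'
    rw [quasiIsoAt_iff' _ (-(m - 1)) (-m) (-(m + 1))
      (ComplexShape.prev_eq' _ (by simp; lia)) (ComplexShape.next_eq' _ (by simp))]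
    exact h'
  exact (quasiIso_opFunctor_map_iff f).1 h₂

variable [HasDerivedCategory 𝒜] [HasDerivedCategory ℬ]

lemma nonempty_mapDerivedOp_homology_iso (X : DerivedCategory 𝒜) (n : ℤ) :
    Nonempty ((DerivedCategory.homologyFunctor ℬ n).obj ((mapDerivedOp G).obj (op X)) ≅
      G.obj (op ((DerivedCategory.homologyFunctor 𝒜 (-n)).obj X))) := by
  let K := DerivedCategory.Q.objPreimage X
  let e : DerivedCategory.Q.obj K ≅ X := DerivedCategory.Q.objObjPreimageIso X
  exact ⟨(DerivedCategory.homologyFunctor ℬ n).mapIso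
      ((mapDerivedOp G).mapIso e.op ≪≫ (mapDerivedOpFactors G).app (op K)) ≪≫
    (DerivedCategory.homologyFunctorFactors ℬ n).app _ ≪≫ mapComplexOpHomologyIso G K n ≪≫
    G.mapIso (((DerivedCategory.homologyFunctor 𝒜 (-n)).mapIso e.symm ≪≫
      (DerivedCategory.homologyFunctorFactors 𝒜 (-n)).app K)).op⟩

instance : (mapPlusOp G).CommShift ℤ := by
  dsimp only [mapPlusOp]
  infer_instance

instance : (mapPlusOp G).IsTriangulated := by
  dsimp only [mapPlusOp]
  infer_instance

end ContravariantHomology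

/-! ### Formal criteria for a triangulated duality -/

section AbstractDuality

open Pretriangulated Pretriangulated.Opposite Opposite

variable {T S : Type*} [Category* T] [Category* S]
    [HasZeroObject T] [Preadditive T] [HasShift T ℤ] [∀ n : ℤ, (shiftFunctor T n).Additive]
    [Pretriangulated T]
    [HasZeroObject S] [Preadditive S] [HasShift S ℤ] [∀ n : ℤ, (shiftFunctor S n).Additive]
    [Pretriangulated S]

/-- An equivalence of triangulated categories `Qᵒᵖ ≌ P` that is the restriction of `G`, together
with a natural transformation from the identity to `F ∘ G` that is invertible on `Q`, yields a
duality of triangulated categories. -/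
theorem isTriangulatedDuality_of_equivalence {P : ObjectProperty T} {Q : ObjectProperty S}
    {F : Tᵒᵖ ⥤ S} {G : Sᵒᵖ ⥤ T} [P.IsTriangulated] [Q.IsTriangulated]
    (E : Q.FullSubcategoryᵒᵖ ≌ P.FullSubcategory) [E.functor.CommShift ℤ]
    [E.functor.IsTriangulated] (i : E.functor ⋙ P.ι ≅ Q.ι.op ⋙ G)
    (η : 𝟭 S ⟶ G.rightOp ⋙ F) (hη : ∀ Y, Q Y → IsIso (η.app Y)) :
    IsTriangulatedDuality P Q F G := by
  -- The triangulated structure of the duality is that of the inverse of the restricted functor G.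
  let := E.commShiftInverse ℤ
  have : E.CommShift ℤ := E.commShift_of_functor ℤ
  have : E.IsTriangulated := .mk' _ inferInstance
  have i₂ : (E.op.symm.trans (opOpEquivalence _)).inverse ⋙ P.ι.op ≅ Q.ι ⋙ G.rightOp :=
    NatIso.ofComponents (fun Y => (i.app (op Y)).symm.op) fun {Y Y'} f =>
      Quiver.Hom.unop_inj (i.inv.naturality f.op).symm
  -- For Y = e(X), the transformation η gives Y ≅ F(G(Y)), and G(e(X)) ≅ X; hence e(X) ≅ F(X),
  -- without any property of F itself.
  have i₁ : (E.op.symm.trans (opOpEquivalence _)).functor ⋙ Q.ι ≅ P.ι.op ⋙ F := by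
    have : IsIso (Functor.whiskerLeft Q.ι η) :=
      NatTrans.isIso_iff_isIso_app _ |>.2 fun Y => hη _ Y.property
    exact Functor.isoWhiskerLeft _ (asIso (Functor.whiskerLeft Q.ι η) ≪≫
        Functor.isoWhiskerRight i₂.symm F) ≪≫
      Functor.isoWhiskerRight (E.op.symm.trans (opOpEquivalence _)).unitIso.symm (P.ι.op ⋙ F) ≪≫
        Functor.leftUnitor _
  exact ⟨inferInstance, inferInstance, E.op.symm.trans (opOpEquivalence _),
    (inferInstance : (E.inverse.op ⋙ unopUnop _).CommShift ℤ),
    (inferInstance : (E.inverse.op ⋙ unopUnop _).IsTriangulated), ⟨i₁⟩, ⟨i₂⟩⟩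

/-- A contravariant triangulated functor `G` that restricts to an equivalence between the full
subcategories `Q` and `P`, together with a natural transformation from the identity to `F ∘ G` that
is invertible on `Q`, yields a duality of triangulated categories. -/
theorem isTriangulatedDuality_of_full {P : ObjectProperty T} {Q : ObjectProperty S}
    {F : Tᵒᵖ ⥤ S} {G : Sᵒᵖ ⥤ T} [P.IsTriangulated] [P.IsClosedUnderIsomorphisms]
    [G.CommShift ℤ] [G.IsTriangulated]
    (hQ : ∀ Y, Q Y ↔ P (G.obj (op Y)))
    (hfull : ∀ ⦃Y Y' : S⦄, Q Y → Q Y' →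
      Function.Surjective (fun f : Y ⟶ Y' => G.map f.op))
    (hess : ∀ X, P X → ∃ Y, Nonempty (G.obj (op Y) ≅ X))
    (η : 𝟭 S ⟶ G.rightOp ⋙ F) (hη : ∀ Y, Q Y → IsIso (η.app Y)) :
    IsTriangulatedDuality P Q F G := by
  -- Being the preimage of P under the triangulated functor G, the subcategory Q is triangulated.
  have hPQ : Q = (P.inverseImage G).unop := by
    ext Y
    exact hQ Y
  have hQt : Q.IsTriangulated := by
    rw [hPQ]
    infer_instance
  let G' : Q.FullSubcategoryᵒᵖ ⥤ P.FullSubcategory :=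
    P.lift (Q.ι.op ⋙ G) fun Y => (hQ _).1 Y.unop.property
  have : G'.Full := ⟨fun {Y Y'} f => by
    obtain ⟨g, hg⟩ := hfull Y'.unop.property Y.unop.property f.hom
    exact ⟨(ObjectProperty.homMk g).op, by ext; exact hg⟩⟩
  -- By naturality f ≫ η = η ≫ F(G(f)), and η is invertible at the target, so G(f) determines f.
  have : G'.Faithful := ⟨fun {Y Y'} f g hfg => by
    have h : G.map f.unop.hom.op = G.map g.unop.hom.op :=
      congrArg (fun φ => P.ι.map φ) hfg
    have := hη _ Y.unop.property
    apply Quiver.Hom.unop_inj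
    apply ObjectProperty.hom_ext
    have hf := η.naturality f.unop.hom
    have hg := η.naturality g.unop.hom
    rw [← cancel_mono (η.app _)]
    refine hf.trans (Eq.trans ?_ hg.symm)
    change _ ≫ F.map (G.map f.unop.hom.op).op = _ ≫ F.map (G.map g.unop.hom.op).op
    rw [h]⟩
  have : G'.EssSurj := ⟨fun X => by
    obtain ⟨Y, ⟨e⟩⟩ := hess X.obj X.property
    exact ⟨op ⟨Y, (hQ Y).2 (P.prop_of_iso e.symm X.property)⟩, ⟨P.isoMk e⟩⟩⟩
  have : G'.IsEquivalence := {}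
  let : G'.asEquivalence.functor.CommShift ℤ :=
    (inferInstance : (P.lift (Q.ι.op ⋙ G) fun Y => (hQ _).1 Y.unop.property).CommShift ℤ)
  have : G'.asEquivalence.functor.IsTriangulated :=
    (inferInstance : (P.lift (Q.ι.op ⋙ G) fun Y => (hQ _).1 Y.unop.property).IsTriangulated)
  exact isTriangulatedDuality_of_equivalence G'.asEquivalence (Iso.refl _) η hη

end AbstractDuality

/-! ### Socles of locally finite modules, and functionals on finite codimension -/

section LocallyFinite

variable {k : Type*} [Field k] {R : Type*} [Ring R] [Algebra k R] {M : Type*} [AddCommGroup M]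
  [Module k M] [Module R M] [IsScalarTower k R M]

/-- A finitely generated submodule all of whose cyclic submodules are finite dimensional is finite
dimensional. -/
lemma finite_of_fg_of_finite_span {S : Submodule R M} (hS : S.FG)
    (h : ∀ m ∈ S, Module.Finite k ((Submodule.span R {m}).restrictScalars k)) :
    Module.Finite k (S.restrictScalars k) := by
  obtain ⟨s, rfl⟩ := hS
  have hle : (Submodule.span R (s : Set M)).restrictScalars k ≤
      ⨆ m : s, (Submodule.span R {(m : M)}).restrictScalars k := by
    intro x hx
    rw [Submodule.restrictScalars_mem] at hx
    induction hx using Submodule.span_induction with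
    | mem x hx =>
      exact Submodule.mem_iSup_of_mem (⟨x, hx⟩ : s) (Submodule.mem_span_singleton_self x)
    | zero => exact Submodule.zero_mem _
    | add x y _ _ hx hy => exact Submodule.add_mem _ hx hy
    | smul a x _ hx =>
      clear * - hx
      induction hx using Submodule.iSup_induction' with
      | mem i y hy => exact Submodule.mem_iSup_of_mem i (Submodule.smul_mem _ a hy)
      | zero => rw [smul_zero]; exact Submodule.zero_mem _
      | add y z _ _ hy hz => rw [smul_add]; exact Submodule.add_mem _ hy hz
  have : ∀ m : s, Module.Finite k ((Submodule.span R {(m : M)}).restrictScalars k) :=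
    fun m => h m (Submodule.subset_span m.2)
  exact Submodule.finiteDimensional_of_le hle

/-- A locally finite artinian module has a finite dimensional essential submodule. -/
lemma exists_finite_essential_of_isArtinian [IsArtinian R M]
    (h : ∀ m : M, Module.Finite k ((Submodule.span R {m}).restrictScalars k)) :
    ∃ S : Submodule R M, Module.Finite k (S.restrictScalars k) ∧
      ∀ V : Submodule R M, V ≠ ⊥ → ∃ c ∈ V, c ∈ S ∧ c ≠ 0 := by
  -- S is the socle. It is semisimple and artinian, hence finitely generated, hence finite
  -- dimensional; it meets every nonzero submodule because an artinian module has a simple submodule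
  -- inside each of these.
  let S : Submodule R M := ⨆ T ∈ {T : Submodule R M | IsSimpleModule R T}, T
  have hS : IsSemisimpleModule R S :=
    isSemisimpleModule_biSup_of_isSemisimpleModule_submodule
      fun T (hT : IsSimpleModule R T) => inferInstance
  have htfae : Module.Finite R S ↔ IsArtinian R S :=
    IsSemisimpleModule.finite_tfae.out 0 2
  have hfin : Module.Finite R S := htfae.2 inferInstance
  refine ⟨S, finite_of_fg_of_finite_span (Module.Finite.iff_fg.1 hfin) fun m _ => h m,
    fun V hV => ?_⟩
  obtain h | ⟨T, hT, hTV⟩ := IsAtomic.eq_bot_or_exists_atom_le V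
  · exact absurd h hV
  · obtain ⟨c, hc, hc0⟩ := Submodule.exists_mem_ne_zero_of_ne_bot hT.1
    exact ⟨c, hTV hc, Submodule.mem_iSup_of_mem T
      (Submodule.mem_iSup_of_mem (isSimpleModule_iff_isAtom.2 hT) hc), hc0⟩

end LocallyFinite

/-- A functional on a finite dimensional space that vanishes on the common kernel of a linear family
of functionals belongs to the family. -/
lemma mem_range_of_forall_eq_zero {k : Type*} [Field k] {L V : Type*} [AddCommGroup L] [Module k L]
    [AddCommGroup V] [Module k V] [Module.Finite k V] (ev : L →ₗ[k] Module.Dual k V)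
    (φ : Module.Dual k V) (h : ∀ w, (∀ l, ev l w = 0) → φ w = 0) : φ ∈ LinearMap.range ev := by
  rw [← Subspace.dualCoannihilator_dualAnnihilator_eq (W := LinearMap.range ev),
    Submodule.mem_dualAnnihilator]
  intro w hw
  rw [Submodule.mem_dualCoannihilator] at hw
  exact h w fun l => hw _ ⟨l, rfl⟩

/-- A functional on `D` that vanishes on a subspace `I` of finite codimension, closed with respect
to a pairing `D × C → k`, is the pairing with an element of `C`. -/
lemma exists_eq_pairing_of_closed {k : Type*} [Field k] {D C : Type*} [AddCommGroup D] [Module k D]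
    [AddCommGroup C] [Module k C] (p : D →ₗ[k] C →ₗ[k] k) {I V : Submodule k D} [Module.Finite k V]
    (hV : V ⊔ I = ⊤) (hI : ∀ a, (∀ c, (∀ f ∈ I, p f c = 0) → p a c = 0) → a ∈ I) (φ : D →ₗ[k] k)
    (hφ : ∀ a ∈ I, φ a = 0) : ∃ c : C, ∀ a, φ a = p a c := by
  -- L is the annihilator of I in C. A vector of V killed by L lies in I by closedness, so φ kills
  -- it; thus φ agrees on V with the pairing with some c in L, and both vanish on I.
  let L : Submodule k C := ⨅ f ∈ I, LinearMap.ker (p f)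
  have hL : ∀ c, c ∈ L ↔ ∀ f ∈ I, p f c = 0 := fun c => by simp [L, Submodule.mem_iInf]
  let ev : L →ₗ[k] Module.Dual k V := ((p.domRestrict V).flip).domRestrict L
  have hmem : φ ∘ₗ V.subtype ∈ LinearMap.range ev :=
    mem_range_of_forall_eq_zero ev (φ ∘ₗ V.subtype) fun w hw =>
      hφ _ (hI _ fun c hc => hw ⟨c, (hL c).2 hc⟩)
  obtain ⟨c, hc⟩ := hmem
  refine ⟨c, fun a => ?_⟩
  obtain ⟨v, hv, i, hi, rfl⟩ := Submodule.mem_sup.1 (hV ▸ Submodule.mem_top : a ∈ V ⊔ _)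
  rw [map_add, map_add, LinearMap.add_apply, hφ i hi, (hL c).1 c.2 i hi, add_zero, add_zero]
  exact (LinearMap.congr_fun hc ⟨v, hv⟩).symm

/-! ### Powers of the Jacobson radical -/

section Radical

variable (k : Type*) [Field k] (R : Type*) [Ring R] [Algebra k R]

/-- The powers of the Jacobson radical, as subspaces. -/
abbrev radPow (n : ℕ) : Submodule k R := ((Ring.jacobson R).restrictScalars k) ^ n

variable {k R}

/-- The exponent is positive because the zeroth power of a subspace is k·1, in general not a left
ideal. For the same reason `radIdeal` is indexed with a shift by one. -/
lemma mul_mem_radPow_succ {n : ℕ} (a : R) {x : R}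
    (hx : x ∈ radPow k R (n + 1)) : a * x ∈ radPow k R (n + 1) := by
  rw [radPow, pow_succ'] at hx ⊢
  induction hx using Submodule.mul_induction_on' with
  | mem_mul_mem m hm n hn =>
    rw [← mul_assoc]
    exact Submodule.mul_mem_mul (Ideal.mul_mem_left _ a hm) hn
  | add x _ y _ hx hy => rw [mul_add]; exact Submodule.add_mem _ hx hy

variable (k R) in
/-- The positive powers of the Jacobson radical, as left ideals. -/
def radIdeal (n : ℕ) : Ideal R where
  __ := (radPow k R (n + 1)).toAddSubmonoid
  smul_mem' a _ hx := mul_mem_radPow_succ a hx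

lemma mem_radIdeal {n : ℕ} {x : R} :
    x ∈ radIdeal k R n ↔ x ∈ radPow k R (n + 1) := Iff.rfl

/-- In a left noetherian algebra, the positive powers of the Jacobson radical have finite
codimension if the Jacobson radical has. -/
lemma exists_finite_sup_radPow [IsNoetherianRing R] {V : Submodule k R} [Module.Finite k V]
    (hV : V ⊔ (Ring.jacobson R).restrictScalars k = ⊤) (n : ℕ) :
    ∃ W : Submodule k R, Module.Finite k W ∧ W ⊔ radPow k R (n + 1) = ⊤ := by
  induction n with
  | zero => exact ⟨V, inferInstance, by rwa [radPow, zero_add, pow_one]⟩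
  | succ n ih =>
    obtain ⟨W, hWfin, hW⟩ := ih
    obtain ⟨s, hs⟩ := IsNoetherian.noetherian (radIdeal k R n)
    -- With R = V + J and J^(n+1) = R·s one gets J^(n+1) ⊆ V·s + J^(n+2).
    let W' := V * Submodule.span k (s : Set R)
    have hfin : Module.Finite k W' := Module.Finite.iff_fg.2 <|
      (Module.Finite.iff_fg.1 inferInstance).mul (Submodule.fg_span s.finite_toSet)
    refine ⟨W ⊔ W', inferInstance, ?_⟩
    rw [eq_top_iff, ← hW, sup_assoc]
    refine sup_le_sup_left ?_ _
    intro x hx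
    rw [← mem_radIdeal, ← hs] at hx
    have hx' : x ∈ (⊤ : Submodule k R) * Submodule.span k (s : Set R) := by
      induction hx using Submodule.span_induction with
      | mem x hx =>
        rw [← one_mul x]
        exact Submodule.mul_mem_mul Submodule.mem_top (Submodule.subset_span hx)
      | zero => exact Submodule.zero_mem _
      | add x y _ _ hx hy => exact Submodule.add_mem _ hx hy
      | smul a x _ hx =>
        clear * - hx
        induction hx using Submodule.mul_induction_on' with
        | mem_mul_mem m _ n hn =>
          rw [smul_eq_mul, ← mul_assoc]
          exact Submodule.mul_mem_mul Submodule.mem_top hn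
        | add x _ y _ hx hy => rw [smul_add]; exact Submodule.add_mem _ hx hy
    rw [← hV, Submodule.sup_mul] at hx'
    refine (sup_le_sup_left ?_ _ : _ ≤ W' ⊔ radPow k R (n + 1 + 1)) hx'
    rw [radPow, pow_succ']
    refine mul_le_mul_right ?_ _
    rw [Submodule.span_le]
    intro y hy
    exact mem_radIdeal.1 (hs ▸ Submodule.subset_span hy)

lemma map_mem_jacobson_pow {B : Type*} [Ring B] (f : R →+* B) (hf : Function.Surjective f)
    {n : ℕ} {a : R} (ha : a ∈ radPow k R n) : f a ∈ (Ring.jacobson B) ^ n := by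
  have := RingHomSurjective.mk hf
  induction n generalizing a with
  | zero => rw [Submodule.pow_zero, Ideal.one_eq_top]; exact Submodule.mem_top
  | succ n ih =>
    rw [radPow, pow_succ] at ha
    rw [Submodule.pow_succ]
    induction ha using Submodule.mul_induction_on' with
    | mem_mul_mem x hx y hy =>
      rw [map_mul]
      exact Ideal.mul_mem_mul (ih hx) (Ring.le_comap_jacobson f hy)
    | add x _ y _ hx hy => rw [map_add]; exact Ideal.add_mem _ hx hy

/-- A power of the Jacobson radical kills a given finite dimensional right module. -/
lemma exists_radPow_smul_eq_zero {N : Type*} [AddCommGroup N] [Module k N] [Module Rᵐᵒᵖ N]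
    [IsScalarTower k Rᵐᵒᵖ N] [Module.Finite k N] :
    ∃ n, ∀ a ∈ radPow k R n, ∀ m : N, MulOpposite.op a • m = 0 := by
  -- The image of R in the endomorphisms of N is finite dimensional, so its radical is nilpotent,
  -- and a surjection of rings maps J into this radical.
  let φ : R →ₐ[k] (Module.End k N)ᵐᵒᵖ := AlgHom.opComm.symm (Algebra.lsmul k k N)
  have : IsArtinianRing φ.range := IsArtinianRing.of_finite k φ.range
  obtain ⟨n, hn⟩ := IsSemiprimaryRing.isNilpotent (R := φ.range)
  refine ⟨n, fun a ha m => ?_⟩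
  have h := map_mem_jacobson_pow (φ.rangeRestrict : R →+* φ.range) φ.rangeRestrict_surjective ha
  rw [hn] at h
  have h' : φ a = 0 := congrArg Subtype.val (show φ.rangeRestrict a = 0 from h)
  exact LinearMap.congr_fun (congrArg MulOpposite.unop h') m

lemma exists_radPow_smul_eq_zero_of_finite_span {N : Type*} [AddCommGroup N] [Module k N]
    [Module Rᵐᵒᵖ N] [IsScalarTower k Rᵐᵒᵖ N] {m : N}
    (h : Module.Finite k ((Submodule.span Rᵐᵒᵖ {m}).restrictScalars k)) :
    ∃ n, ∀ a ∈ radPow k R n, MulOpposite.op a • m = 0 := by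
  have : Module.Finite k (Submodule.span Rᵐᵒᵖ {m}) := h
  obtain ⟨n, hn⟩ := exists_radPow_smul_eq_zero (k := k) (R := R) (N := Submodule.span Rᵐᵒᵖ {m})
  exact ⟨n, fun a ha => congrArg Subtype.val (hn a ha ⟨m, Submodule.mem_span_singleton_self m⟩)⟩

/-- The Jacobson radical as a right ideal. -/
def radRight (R : Type*) [Ring R] : Submodule Rᵐᵒᵖ R where
  __ := (Ring.jacobson R).toAddSubmonoid
  smul_mem' a _ hx := Ideal.mul_mem_right a.unop (Ring.jacobson R) hx

lemma finite_quotient_radRight {V : Submodule k R} [Module.Finite k V]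
    (hV : V ⊔ (Ring.jacobson R).restrictScalars k = ⊤) : Module.Finite k (R ⧸ radRight R) := by
  refine Module.Finite.of_surjective (((radRight R).mkQ.restrictScalars k) ∘ₗ V.subtype) ?_
  intro x
  obtain ⟨r, rfl⟩ := Submodule.mkQ_surjective _ x
  obtain ⟨v, hv, i, hi, rfl⟩ := Submodule.mem_sup.1 (hV ▸ Submodule.mem_top : r ∈ V ⊔ _)
  refine ⟨⟨v, hv⟩, ?_⟩
  rw [map_add, show (radRight R).mkQ i = 0 from (Submodule.Quotient.mk_eq_zero _).2 hi, add_zero]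
  rfl

lemma op_smul_quotient_radRight {a : R} (ha : a ∈ Ring.jacobson R) (x : R ⧸ radRight R) :
    MulOpposite.op a • x = 0 := by
  obtain ⟨r, rfl⟩ := Submodule.mkQ_surjective _ x
  rw [← map_smul]
  exact (Submodule.Quotient.mk_eq_zero _).2 (Ideal.mul_mem_left (Ring.jacobson R) r ha)

/-- Elements of M killed by J come from homomorphisms R/J → M, so a bound on the latter space bounds
the former. -/
lemma exists_linearMap_quotient_radRight {M : Type*} [AddCommGroup M] [Module Rᵐᵒᵖ M] {m : M}
    (hm : ∀ a ∈ Ring.jacobson R, MulOpposite.op a • m = 0) :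
    ∃ g : (R ⧸ radRight R) →ₗ[Rᵐᵒᵖ] M, g (Submodule.Quotient.mk 1) = m := by
  let l : R →ₗ[Rᵐᵒᵖ] M :=
    { toFun := fun a => MulOpposite.op a • m
      map_add' := fun a b => by rw [MulOpposite.op_add, add_smul]
      map_smul' := fun r a => by
        rw [RingHom.id_apply, smul_smul]; rfl }
  exact ⟨(radRight R).liftQ l fun a ha => hm a ha, one_smul _ m⟩

end Radical

/-! ### The dual algebra: closed ideals, noetherianity, radical, rational elements -/

section DualAlgebra

variable {k C : Type u} [Field k] [AddCommGroup C] [Module k C] [Coalgebra k C]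

/-- The left action `c ↦ ∑ f c₍₂₎ • c₍₁₎` of `f : C^*` on `C`. -/
def coalgHitLeft (f : DualAlgebra k C) : C →ₗ[k] C :=
  (TensorProduct.rid k C).toLinearMap ∘ₗ f.ofConv.lTensor C ∘ₗ Coalgebra.comul

lemma mul_ofConv_eq_comp_coalgHitLeft (f g : DualAlgebra k C) :
    (f * g).ofConv = f.ofConv ∘ₗ coalgHitLeft g := by
  ext c
  have : ∀ t : C ⊗[k] C, LinearMap.mul' k k (TensorProduct.map f.ofConv g.ofConv t) =
      f.ofConv (TensorProduct.rid k C (g.ofConv.lTensor C t)) := by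
    intro t
    induction t using TensorProduct.induction_on with
    | zero => simp
    | tmul c n => simp [mul_comm]
    | add x y hx hy => simp [hx, hy]
  exact this _

lemma mul_ofConv_apply (f g : DualAlgebra k C) (c : C) :
    (f * g).ofConv c = g.ofConv (coalgHit k C f c) := by
  rw [dualAlgebra_mul_ofConv]; rfl

lemma mul_ofConv_apply' (f g : DualAlgebra k C) (c : C) :
    (f * g).ofConv c = f.ofConv (coalgHitLeft g c) := by
  rw [mul_ofConv_eq_comp_coalgHitLeft]; rfl

lemma counit_coalgHitLeft (f : DualAlgebra k C) (c : C) :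
    Coalgebra.counit (R := k) (coalgHitLeft f c) = f.ofConv c := by
  rw [← dualAlgebra_one_ofConv, ← mul_ofConv_apply', one_mul]

lemma counit_coalgHit (f : DualAlgebra k C) (c : C) :
    Coalgebra.counit (R := k) (coalgHit k C f c) = f.ofConv c := by
  rw [← dualAlgebra_one_ofConv, ← mul_ofConv_apply, mul_one]

lemma eq_zero_of_forall_ofConv {c : C} (h : ∀ f : DualAlgebra k C, f.ofConv c = 0) : c = 0 :=
  (Module.forall_dual_apply_eq_zero_iff k c).1 fun φ => h (WithConv.toConv φ)

/-- C is a C^*-bimodule: tested against functionals, this is associativity of the convolution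
product. -/
lemma coalgHitLeft_coalgHit (f g : DualAlgebra k C) (c : C) :
    coalgHitLeft f (coalgHit k C g c) = coalgHit k C g (coalgHitLeft f c) := by
  rw [← sub_eq_zero]
  refine eq_zero_of_forall_ofConv (k := k) fun h => ?_
  rw [map_sub, ← mul_ofConv_apply', ← mul_ofConv_apply, ← mul_ofConv_apply, ← mul_ofConv_apply',
    mul_assoc, sub_self]

/-- The elements of `C` on which all elements of a left ideal of `C^*` vanish. -/
def perp (I : Ideal (DualAlgebra k C)) : Submodule k C where
  carrier := {c | ∀ f ∈ I, f.ofConv c = 0}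
  zero_mem' := by simp
  add_mem' := fun ha hb f hf => by rw [map_add, ha f hf, hb f hf, add_zero]
  smul_mem' := fun r c hc f hf => by rw [map_smul, hc f hf, smul_zero]

lemma perp_antitone {I I' : Ideal (DualAlgebra k C)} (h : I ≤ I') : perp I' ≤ perp I :=
  fun _ hc f hf => hc f (h hf)

lemma isLeftCoideal_perp (I : Ideal (DualAlgebra k C)) : IsLeftCoideal k C (perp I) := by
  intro c hc
  refine exists_lTensor_of_contr_mem (perp I).subtype _ fun f => ?_
  rw [Submodule.range_subtype]
  intro g hg
  exact (mul_ofConv_apply (WithConv.toConv f) g c).symm.trans (hc _ (I.mul_mem_left _ hg))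

/-- Finitely generated left ideals of `C^*` are closed. -/
lemma mem_of_forall_mem_perp {I : Ideal (DualAlgebra k C)} (hI : I.FG) {a : DualAlgebra k C}
    (ha : ∀ c ∈ perp I, a.ofConv c = 0) : a ∈ I := by
  obtain ⟨n, b, hb⟩ := Submodule.fg_iff_exists_fin_generating_family.1 hI
  have hbI : ∀ i, b i ∈ I := fun i => hb ▸ Submodule.subset_span ⟨i, rfl⟩
  -- The left actions of the generators on C form β. An element of ker β is annihilated by all of I,
  -- so a vanishes on ker β and factors as ψ ∘ β, which means a = ∑ ψᵢ * bᵢ.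
  let β : C →ₗ[k] (Fin n → C) := LinearMap.pi fun i => coalgHitLeft (b i)
  have hβ : ∀ c, β c = 0 → a.ofConv c = 0 := by
    intro c hc
    refine ha c fun f hf => ?_
    rw [← hb] at hf
    induction hf using Submodule.span_induction with
    | mem x hx =>
      obtain ⟨i, rfl⟩ := hx
      rw [← counit_coalgHitLeft]
      have : coalgHitLeft (b i) c = 0 := congrFun hc i
      rw [this, map_zero]
    | zero => simp
    | add x y _ _ hx hy => simp [hx, hy]
    | smul r x hx' hx =>
      have : coalgHitLeft x c = 0 := by
        clear hx
        refine eq_zero_of_forall_ofConv (k := k) fun g => ?_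
        rw [← mul_ofConv_apply']
        induction hx' using Submodule.span_induction generalizing g with
        | mem x hx =>
          obtain ⟨i, rfl⟩ := hx
          rw [mul_ofConv_apply']
          have : coalgHitLeft (b i) c = 0 := congrFun hc i
          rw [this, map_zero]
        | zero => simp
        | add x y _ _ hx hy => simp [mul_add, hx, hy]
        | smul r x _ hx => rw [smul_eq_mul, ← mul_assoc]; exact hx _
      rw [smul_eq_mul, mul_ofConv_apply', this, map_zero]
  obtain ⟨ψ, hψ⟩ := exists_comp_eq_of_ker_le k β a.ofConv hβ
  have : a = ∑ i, (WithConv.toConv (ψ ∘ₗ LinearMap.single k (fun _ => C) i)) * b i := by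
    apply WithConv.ofConv_injective
    rw [WithConv.ofConv_sum, ← hψ]
    ext c
    rw [LinearMap.sum_apply, LinearMap.comp_apply]
    conv_lhs => rw [← Finset.univ_sum_single (β c), map_sum]
    refine Finset.sum_congr rfl fun i _ => ?_
    rw [mul_ofConv_apply']
    rfl
  rw [this]
  exact I.sum_mem fun i _ => I.mul_mem_left _ (hbI i)

/-- The dual algebra of an artinian coalgebra is left noetherian. -/
theorem isNoetherianRing_dualAlgebra
    (hC : WellFoundedLT {V : Submodule k C // IsLeftCoideal k C V}) :
    IsNoetherianRing (DualAlgebra k C) := by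
  refine ⟨fun I => ?_⟩
  let s : Set {V : Submodule k C // IsLeftCoideal k C V} :=
    {V | ∃ I' : Ideal (DualAlgebra k C), I'.FG ∧ I' ≤ I ∧ perp I' = V.1}
  -- Take a finitely generated I' ≤ I with minimal annihilator in C. Adjoining x ∈ I cannot shrink
  -- the annihilator, so x vanishes on it, and x ∈ I' since I' is closed.
  obtain ⟨V, ⟨I', hfg, hle, hV⟩, hmin⟩ := hC.wf.has_min s
    ⟨⟨perp ⊥, isLeftCoideal_perp _⟩, ⊥, Submodule.fg_bot, bot_le, rfl⟩
  have : I ≤ I' := by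
    intro x hx
    have hle' : I' ⊔ Ideal.span {x} ≤ I := sup_le hle (by simpa [Ideal.span_le] using hx)
    have hfg' : (I' ⊔ Ideal.span {x}).FG := Submodule.FG.sup hfg (Submodule.fg_span_singleton x)
    have h := hmin ⟨perp (I' ⊔ Ideal.span {x}), isLeftCoideal_perp _⟩ ⟨_, hfg', hle', rfl⟩
    have hp : perp I' ≤ perp (I' ⊔ Ideal.span {x}) := by
      by_contra hcon
      refine h (lt_of_le_not_ge ?_ ?_)
      · change perp _ ≤ V.1
        rw [← hV]; exact perp_antitone le_sup_left
      · change ¬ V.1 ≤ perp _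
        rwa [← hV]
    refine mem_of_forall_mem_perp hfg fun c hc => ?_
    exact hp hc x (Ideal.mem_sup_right (Ideal.mem_span_singleton_self x))
  rwa [le_antisymm this hle]

/-- The coalgebra `C` as a left comodule over itself. -/
def LeftComod.self (k C : Type u) [Field k] [AddCommGroup C] [Module k C] [Coalgebra k C] :
    LeftComod k C where
  carrier := C
  coact := Coalgebra.comul
  coassoc := Coalgebra.coassoc
  counit := by
    ext c
    simp [Coalgebra.rTensor_counit_comul]

/-- The right action `c · f = ∑ f c₍₁₎ • c₍₂₎` of `C^*` on `C`. -/
instance moduleCoalgebra : Module (DualAlgebra k C)ᵐᵒᵖ C :=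
  LeftComod.instModuleMulOppositeDualAlgebraCarrier (LeftComod.self k C)

instance isScalarTower_coalgebra : IsScalarTower k (DualAlgebra k C)ᵐᵒᵖ C :=
  LeftComod.instIsScalarTowerMulOppositeDualAlgebraCarrier (LeftComod.self k C)

lemma op_smul_coalgebra (r : (DualAlgebra k C)ᵐᵒᵖ) (c : C) :
    r • c = coalgHit k C r.unop c := rfl

lemma isRationalElement_coalgebra (c : C) : IsRationalElement (k := k) (C := C) c :=
  ⟨Coalgebra.comul c, fun _ => rfl⟩

section FiniteDimensional

variable {N : Type u} [AddCommGroup N] [Module k N] [Module (DualAlgebra k C)ᵐᵒᵖ N]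
  [IsScalarTower k (DualAlgebra k C)ᵐᵒᵖ N]

variable (k C N) in
/-- The action map `f ↦ m · f` of a right `C^*`-module. -/
def orbitMap (m : N) : DualAlgebra k C →ₗ[k] N where
  toFun f := MulOpposite.op f • m
  map_add' f g := by rw [MulOpposite.op_add, add_smul]
  map_smul' a f := by rw [MulOpposite.op_smul, smul_assoc, RingHom.id_apply]

lemma orbitMap_apply (m : N) (f : DualAlgebra k C) :
    orbitMap k C N m f = MulOpposite.op f • m := rfl

lemma span_singleton_restrictScalars_eq_range (m : N) :
    (Submodule.span (DualAlgebra k C)ᵐᵒᵖ {m}).restrictScalars k =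
      LinearMap.range (orbitMap k C N m) := by
  ext x
  rw [Submodule.restrictScalars_mem, Submodule.mem_span_singleton]
  exact ⟨fun ⟨a, ha⟩ => ⟨a.unop, ha⟩, fun ⟨a, ha⟩ => ⟨MulOpposite.op a, ha⟩⟩

/-- If m · f = ∑ f(cᵢ) nᵢ for all f, the orbit of m lies in the span of the finitely many nᵢ. -/
lemma IsRationalElement.finite_span {m : N} (h : IsRationalElement (k := k) (C := C) m) :
    Module.Finite k ((Submodule.span (DualAlgebra k C)ᵐᵒᵖ {m}).restrictScalars k) := by
  obtain ⟨t, ht⟩ := h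
  obtain ⟨s, rfl⟩ := TensorProduct.exists_finset t
  have hfin : Module.Finite k (Submodule.span k ((fun p : C × N => p.2) '' (s : Set (C × N)))) :=
    FiniteDimensional.span_of_finite k (s.finite_toSet.image _)
  have hle : (Submodule.span (DualAlgebra k C)ᵐᵒᵖ {m}).restrictScalars k ≤
      Submodule.span k ((fun p : C × N => p.2) '' (s : Set (C × N))) := by
    rw [span_singleton_restrictScalars_eq_range]
    rintro _ ⟨f, rfl⟩
    rw [orbitMap_apply, ht, map_sum]
    refine Submodule.sum_mem _ fun p hp => ?_
    rw [contr_tmul]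
    exact Submodule.smul_mem _ _ (Submodule.subset_span ⟨p, hp, rfl⟩)
  exact Submodule.finiteDimensional_of_le hle

end FiniteDimensional

lemma isRationalElement_comod (M : LeftComod k C) (m : M.carrier) :
    IsRationalElement (k := k) (C := C) m := ⟨M.coact m, fun _ => rfl⟩

lemma isLeftCoideal_restrictScalars
    (V : Submodule (DualAlgebra k C)ᵐᵒᵖ C) :
    IsLeftCoideal k C (V.restrictScalars k) := by
  intro c hc
  refine exists_lTensor_of_contr_mem (V.restrictScalars k).subtype _ fun f => ?_
  rw [Submodule.range_subtype]
  exact V.smul_mem (MulOpposite.op (WithConv.toConv f)) hc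

lemma isArtinian_self (hC : WellFoundedLT {V : Submodule k C // IsLeftCoideal k C V}) :
    IsArtinian (DualAlgebra k C)ᵐᵒᵖ C := by
  let φ : Submodule (DualAlgebra k C)ᵐᵒᵖ C →
      {V : Submodule k C // IsLeftCoideal k C V} :=
    fun V => ⟨V.restrictScalars k, isLeftCoideal_restrictScalars V⟩
  have hφ : StrictMono φ := fun V W h => by
    change V.restrictScalars k < W.restrictScalars k
    exact h
  exact hφ.wellFoundedLT

/-- A finite dimensional left coideal that meets every nonzero left coideal. -/
lemma exists_finite_essential (hC : WellFoundedLT {V : Submodule k C // IsLeftCoideal k C V}) :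
    ∃ S : Submodule (DualAlgebra k C)ᵐᵒᵖ C, Module.Finite k (S.restrictScalars k) ∧
      ∀ V : Submodule (DualAlgebra k C)ᵐᵒᵖ C, V ≠ ⊥ → ∃ c ∈ V, c ∈ S ∧ c ≠ 0 := by
  have := isArtinian_self hC
  exact exists_finite_essential_of_isArtinian fun m => (isRationalElement_coalgebra m).finite_span

/-- The elements of `C^*` vanishing on an essential left coideal lie in the Jacobson radical. -/
lemma mem_jacobson_of_essential
    {S : Submodule (DualAlgebra k C)ᵐᵒᵖ C}
    (hS : ∀ V : Submodule (DualAlgebra k C)ᵐᵒᵖ C,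
        V ≠ ⊥ → ∃ c ∈ V, c ∈ S ∧ c ≠ 0)
    {a : DualAlgebra k C} (ha : ∀ c ∈ S, a.ofConv c = 0) :
    a ∈ Ring.jacobson (DualAlgebra k C) := by
  -- The left action of 1 - b on C is injective: its kernel V is a left coideal, and for c ∈ V ∩ S
  -- and every f one has f(c) = ε(c·f) = (1 - b)(c·f) = 0, because b vanishes on S. Extending ε
  -- along this injection gives a left inverse of 1 - b.
  have hinv : ∀ b : DualAlgebra k C, (∀ c ∈ S, b.ofConv c = 0) → ∃ g, g * (1 - b) = 1 := by
    intro b hb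
    let V : Submodule (DualAlgebra k C)ᵐᵒᵖ C :=
      { carrier := {c | coalgHitLeft (1 - b) c = 0}
        zero_mem' := map_zero _
        add_mem' := fun {x y} hx hy => by
          rw [Set.mem_ofPred_eq] at hx hy ⊢
          rw [map_add, hx, hy, add_zero]
        smul_mem' := fun r c hc => by
          rw [Set.mem_ofPred_eq] at hc ⊢
          rw [op_smul_coalgebra, coalgHitLeft_coalgHit, hc, map_zero] }
    have hV : V = ⊥ := by
      by_contra hne
      obtain ⟨c, hcV, hcS, hc0⟩ := hS V hne
      apply hc0
      refine eq_zero_of_forall_ofConv (k := k) fun f => ?_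
      have h₁ : MulOpposite.op f • c ∈ V := V.smul_mem _ hcV
      have h₂ : MulOpposite.op f • c ∈ S := S.smul_mem _ hcS
      have h₃ : (1 - b).ofConv (coalgHit k C f c) = 0 := by
        rw [← counit_coalgHitLeft, show coalgHitLeft (1 - b) (coalgHit k C f c) = 0 from h₁,
          map_zero]
      have h₄ : b.ofConv (coalgHit k C f c) = 0 := hb _ h₂
      rw [WithConv.ofConv_sub, LinearMap.sub_apply, h₄, sub_zero, dualAlgebra_one_ofConv,
        counit_coalgHit] at h₃
      exact h₃
    obtain ⟨ψ, hψ⟩ := exists_comp_eq_of_ker_le k (coalgHitLeft (1 - b))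
      (1 : DualAlgebra k C).ofConv (by
        intro c hc
        have : c ∈ V := hc
        rw [hV, Submodule.mem_bot] at this
        rw [show c = 0 from this, map_zero])
    refine ⟨WithConv.toConv ψ, WithConv.ofConv_injective ?_⟩
    rw [mul_ofConv_eq_comp_coalgHitLeft, ← hψ]
  rw [Ring.jacobson_eq_sInf_isMaximal, Submodule.mem_sInf]
  intro I hI
  by_contra haI
  obtain ⟨y, i, hi, hy⟩ := hI.exists_inv haI
  -- The product y * a again vanishes on S, as (y * a)(c) = a(c·y) and S is stable under the action.
  obtain ⟨g, hg⟩ := hinv (y * a) fun c hc => by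
    rw [mul_ofConv_apply]
    exact ha _ (S.smul_mem (MulOpposite.op y) hc)
  refine hI.ne_top ((Ideal.eq_top_iff_one I).2 ?_)
  rw [← hg, ← hy, add_sub_cancel_left]
  exact I.smul_mem _ hi

/-- The Jacobson radical of the dual algebra has finite codimension. -/
lemma exists_finite_sup_jacobson
    (hC : WellFoundedLT {V : Submodule k C // IsLeftCoideal k C V}) :
    ∃ V : Submodule k (DualAlgebra k C), Module.Finite k V ∧
      V ⊔ (Ring.jacobson (DualAlgebra k C)).restrictScalars k = ⊤ := by
  obtain ⟨S, hS, hess⟩ := exists_finite_essential hC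
  let S' : Submodule k C := S.restrictScalars k
  have : Module.Finite k S' := hS
  -- Restriction to the finite dimensional essential coideal S has its kernel inside J, and a
  -- complement of this kernel embeds into the dual of S.
  let ρ : DualAlgebra k C →ₗ[k] Module.Dual k S' :=
    { toFun := fun a => a.ofConv ∘ₗ S'.subtype
      map_add' := fun _ _ => rfl
      map_smul' := fun _ _ => rfl }
  obtain ⟨V, hV⟩ := (LinearMap.ker ρ).exists_isCompl
  refine ⟨V, ?_, ?_⟩
  · refine Module.Finite.of_injective (ρ ∘ₗ V.subtype) fun x y hxy => ?_
    have hmem : (x - y : DualAlgebra k C) ∈ LinearMap.ker ρ := by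
      rw [LinearMap.mem_ker, map_sub, sub_eq_zero]
      exact hxy
    exact Subtype.ext (sub_eq_zero.1 (Submodule.disjoint_def.1 hV.disjoint _ hmem
      (V.sub_mem x.2 y.2)))
  · rw [eq_top_iff, ← hV.symm.sup_eq_top]
    refine sup_le_sup_left ?_ _
    intro a ha
    exact mem_jacobson_of_essential hess fun c hc => LinearMap.congr_fun ha (⟨c, hc⟩ : S')

lemma exists_finite_sup_radPow_dualAlgebra
    (hC : WellFoundedLT {V : Submodule k C // IsLeftCoideal k C V}) (n : ℕ) :
    ∃ V : Submodule k (DualAlgebra k C), Module.Finite k V ∧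
      V ⊔ radPow k (DualAlgebra k C) (n + 1) = ⊤ := by
  obtain ⟨V, hV, h⟩ := exists_finite_sup_jacobson hC
  have := isNoetherianRing_dualAlgebra hC
  exact exists_finite_sup_radPow h n

/-- A functional on `C^*` that vanishes on a closed left ideal of finite codimension is the
evaluation at an element of `C`. -/
lemma exists_eval_eq {I : Ideal (DualAlgebra k C)} (hI : I.FG)
    {V : Submodule k (DualAlgebra k C)} [Module.Finite k V]
    (hV : V ⊔ I.restrictScalars k = ⊤) (φ : DualAlgebra k C →ₗ[k] k) (hφ : ∀ a ∈ I, φ a = 0) :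
    ∃ c : C, ∀ a : DualAlgebra k C, φ a = a.ofConv c := by
  let p : DualAlgebra k C →ₗ[k] C →ₗ[k] k :=
    { toFun := WithConv.ofConv
      map_add' := fun _ _ => rfl
      map_smul' := fun _ _ => rfl }
  exact exists_eq_pairing_of_closed p hV (fun a ha => mem_of_forall_mem_perp hI ha) φ hφ

section Torsion

variable {N : Type u} [AddCommGroup N] [Module k N] [Module (DualAlgebra k C)ᵐᵒᵖ N]
  [IsScalarTower k (DualAlgebra k C)ᵐᵒᵖ N]

lemma isRationalElement_of_radPow (hC : WellFoundedLT {V : Submodule k C // IsLeftCoideal k C V})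
    {m : N} {n : ℕ} (h : ∀ a ∈ radPow k (DualAlgebra k C) (n + 1), MulOpposite.op a • m = 0) :
    IsRationalElement (k := k) (C := C) m := by
  obtain ⟨V, hVfin, hV⟩ := exists_finite_sup_radPow_dualAlgebra hC n
  have := isNoetherianRing_dualAlgebra hC
  have hI : (radIdeal k (DualAlgebra k C) n).FG := IsNoetherian.noetherian _
  -- As m J^(n+1) = 0, the orbit of m is contained in the finite dimensional space W. The
  -- coordinates of the orbit map vanish on J^(n+1), a finitely generated left ideal of finite
  -- codimension, so they are evaluations at elements cᵢ of C.
  let W := V.map (orbitMap k C N m)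
  have hW : ∀ a, orbitMap k C N m a ∈ W := by
    intro a
    obtain ⟨v, hv, i, hi, rfl⟩ := Submodule.mem_sup.1 (hV ▸ Submodule.mem_top : a ∈ V ⊔ _)
    rw [map_add, orbitMap_apply m i, h i hi, add_zero]
    exact Submodule.mem_map_of_mem hv
  let b := Module.finBasis k W
  let μ : DualAlgebra k C →ₗ[k] W := (orbitMap k C N m).codRestrict W hW
  have hc : ∀ i, ∃ c : C, ∀ a : DualAlgebra k C, b.coord i (μ a) = a.ofConv c := fun i =>
    exists_eval_eq hI hV (b.coord i ∘ₗ μ) fun a ha => by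
      have : μ a = 0 := Subtype.ext (h a ha)
      rw [LinearMap.comp_apply, this, map_zero]
  choose c hc using hc
  refine ⟨∑ i, c i ⊗ₜ[k] (b i : N), fun f => ?_⟩
  rw [map_sum]
  simp only [contr_tmul, ← hc]
  have := congrArg Subtype.val (b.sum_repr (μ f))
  rw [Submodule.coe_sum] at this
  exact this.symm

lemma IsRationalElement.exists_radPow {m : N} (h : IsRationalElement (k := k) (C := C) m) :
    ∃ n, ∀ a ∈ radPow k (DualAlgebra k C) n, MulOpposite.op a • m = 0 :=
  exists_radPow_smul_eq_zero_of_finite_span h.finite_span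

lemma isRationalElement_iff_exists_radPow
    (hC : WellFoundedLT {V : Submodule k C // IsLeftCoideal k C V}) {m : N} :
    IsRationalElement (k := k) (C := C) m ↔
      ∃ n, ∀ a ∈ radPow k (DualAlgebra k C) n, MulOpposite.op a • m = 0 := by
  refine ⟨fun h => h.exists_radPow, fun ⟨n, hn⟩ => ?_⟩
  cases n with
  | zero =>
    -- The zeroth power is k·1 and contains 1.
    have : m = 0 := by
      rw [← one_smul (DualAlgebra k C)ᵐᵒᵖ m]
      exact hn 1 (Submodule.one_le.1 (Submodule.pow_zero _).ge)
    exact this ▸ (rationalSubmodule k C N).zero_mem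
  | succ n => exact isRationalElement_of_radPow hC hn

end Torsion

end DualAlgebra

/-! ### Quasi-finite comodules and finitely generated duals -/

section QuasiFinite

/-- The `k`-linear dual of a right `A`-module is finitely generated, in elementary terms. -/
def IsDualFinite (k A : Type*) [Field k] [Ring A] (M : Type*) [AddCommGroup M] [Module k M]
    [Module Aᵐᵒᵖ M] : Prop :=
  ∃ (n : ℕ) (φ : Fin n → Module.Dual k M), ∀ ψ : Module.Dual k M, ∃ a : Fin n → A,
    ∀ m, ψ m = ∑ i, φ i (MulOpposite.op (a i) • m)

lemma finite_dualRight_iff {k A : Type u} [Field k] [Ring A] [Algebra k A]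
    (M : ModuleCat.{u} Aᵐᵒᵖ) :
    Module.Finite A ((dualRight k A).obj (Opposite.op M)) ↔ IsDualFinite k A M := by
  rw [Module.finite_def, Submodule.fg_iff_exists_fin_generating_family]
  refine exists_congr fun n => exists_congr fun (φ : Fin n → Module.Dual k M) => ?_
  rw [eq_top_iff]
  have key : ∀ ψ : (dualRight k A).obj (Opposite.op M),
      ψ ∈ Submodule.span A (Set.range (show Fin n → (dualRight k A).obj (Opposite.op M) from φ)) ↔
      ∃ a : Fin n → A, ∀ m : M, (show Module.Dual k M from ψ) m =
        ∑ i, φ i (MulOpposite.op (a i) • m) := by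
    intro ψ
    rw [Submodule.mem_span_range_iff_exists_fun]
    refine exists_congr fun a => ?_
    have hsum : ∀ m : M, (show Module.Dual k M from
        ∑ i, a i • (show Fin n → (dualRight k A).obj (Opposite.op M) from φ) i) m =
        ∑ i, φ i (MulOpposite.op (a i) • m) := by
      intro m
      exact LinearMap.sum_apply _ _ _
    constructor
    · rintro rfl m
      exact hsum m
    · intro h
      apply LinearMap.ext
      intro m
      exact (hsum m).trans (h m).symm
  exact ⟨fun h ψ => (key ψ).1 (h Submodule.mem_top), fun h ψ _ => (key ψ).2 (h ψ)⟩

variable {k C : Type u} [Field k] [AddCommGroup C] [Module k C] [Coalgebra k C]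

lemma finite_comodDual_iff (M : LeftComod k C) :
    Module.Finite (DualAlgebra k C) ((comodDual k C).obj (Opposite.op M)) ↔
      IsDualFinite k (DualAlgebra k C) M.carrier := by
  refine (finite_dualRight_iff ((LeftComod.toMod k C).obj M)).trans ?_
  -- The k-action that M receives through C^* has to be replaced by the given one, to which it is
  -- propositionally equal.
  rw [show ModuleCat.moduleOfAlgebraModule ((LeftComod.toMod k C).obj M) = M.module from
    LeftComod.moduleOfAlgebraModule_toMod k C M]
  rfl

/-- A comodule map f into M is determined by the functionals φᵢ ∘ f, since every ψ ∘ f is a sum of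
translates of these. -/
lemma isQuasiFinite_of_isDualFinite {M : LeftComod k C}
    (h : IsDualFinite k (DualAlgebra k C) M.carrier) : IsQuasiFinite M := by
  intro N hN
  obtain ⟨n, φ, hφ⟩ := h
  let L : LeftComod.homSubmodule N M →ₗ[k] (Fin n → Module.Dual k N.carrier) :=
    { toFun := fun f i => φ i ∘ₗ f.1
      map_add' := fun f g => by ext; simp
      map_smul' := fun a f => by ext; simp }
  refine Module.Finite.of_injective L ((injective_iff_map_eq_zero L).2 fun f hf => ?_)
  apply Subtype.ext
  ext x
  refine (Module.forall_dual_apply_eq_zero_iff k _).1 fun ψ => ?_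
  obtain ⟨a, ha⟩ := hφ ψ
  rw [ha]
  refine Finset.sum_eq_zero fun i _ => ?_
  rw [← (LeftComod.mem_homSubmodule_iff f.1).1 f.2]
  exact LinearMap.congr_fun (congrFun hf i) _

/-- The elements of M killed by J are images of 1 under homomorphisms C^*/J → M, hence form a finite
dimensional space. Functionals φᵢ that extend its coordinates give an embedding γ of M into Cⁿ.
Every functional on M extends to Cⁿ, and the components of the extension are the required
coefficients. -/
lemma isDualFinite_of_isQuasiFinite
    (hC : WellFoundedLT {V : Submodule k C // IsLeftCoideal k C V})
    {M : LeftComod k C} (h : IsQuasiFinite M) : IsDualFinite k (DualAlgebra k C) M.carrier := by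
  let M₀ : Submodule k M.carrier :=
    { carrier := {m | ∀ a ∈ Ring.jacobson (DualAlgebra k C), MulOpposite.op a • m = 0}
      zero_mem' := fun a _ => smul_zero _
      add_mem' := fun hx hy a ha => by rw [smul_add, hx a ha, hy a ha, add_zero]
      smul_mem' := fun r x hx a ha => by
        rw [LeftComod.op_smul_def, map_smul, map_smul, ← LeftComod.op_smul_def, hx a ha,
          smul_zero] }
  have hM₀ : Module.Finite k M₀ := by
    obtain ⟨V, hVfin, hV⟩ := exists_finite_sup_jacobson hC
    have hfin := finite_quotient_radRight hV
    have hrat : ∀ x : DualAlgebra k C ⧸ radRight (DualAlgebra k C),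
        IsRationalElement (k := k) (C := C) x := fun x =>
      isRationalElement_of_radPow (n := 0) hC fun a ha =>
        op_smul_quotient_radRight (by rwa [zero_add, radPow, Submodule.pow_one] at ha) x
    let N := LeftComod.ofRational _ hrat
    have : Module.Finite k (LeftComod.homSubmodule N M) := h N hfin
    let ev : LeftComod.homSubmodule N M →ₗ[k] M.carrier :=
      { toFun := fun f => f.1 (Submodule.Quotient.mk 1)
        map_add' := fun _ _ => rfl
        map_smul' := fun _ _ => rfl }
    have hle : M₀ ≤ LinearMap.range ev := by
      intro m hm
      obtain ⟨g, hg⟩ := exists_linearMap_quotient_radRight hm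
      refine ⟨⟨g.restrictScalars k, (LeftComod.mem_homSubmodule_iff _).2 fun a x => ?_⟩, hg⟩
      exact (congrArg g (LeftComod.ofRational_smul hrat (MulOpposite.op a) x).symm).trans
        (g.map_smul (MulOpposite.op a) x)
    exact Submodule.finiteDimensional_of_le hle
  let b := Module.finBasis k M₀
  choose φ hφ using fun i => (b.coord i).exists_extend
  have hφ₀ : ∀ m ∈ M₀, (∀ i, φ i m = 0) → m = 0 := by
    intro m hm h0
    have : (⟨m, hm⟩ : M₀) = 0 := b.ext_elem fun i => by
      rw [map_zero]
      exact (LinearMap.congr_fun (hφ i) ⟨m, hm⟩).symm.trans (h0 i)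
    exact congrArg Subtype.val this
  refine ⟨_, φ, fun ψ => ?_⟩
  let γ : M.carrier →ₗ[k] (Fin (Module.finrank k M₀) → C) :=
    LinearMap.pi fun i => (TensorProduct.rid k C).toLinearMap ∘ₗ (φ i).lTensor C ∘ₗ M.coact
  have hγ : ∀ (a : C →ₗ[k] k) (i) (m : M.carrier),
      a (γ m i) = φ i (MulOpposite.op (WithConv.toConv a : DualAlgebra k C) • m) := by
    intro a i m
    rw [LeftComod.op_smul_def]
    change a (TensorProduct.rid k C ((φ i).lTensor C (M.coact m))) = φ i (contr a (M.coact m))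
    generalize M.coact m = t
    induction t using TensorProduct.induction_on with
    | zero => simp
    | tmul c n => simp [mul_comm]
    | add x y hx hy => simp [hx, hy]
  -- For m ≠ 0 let n + 1 be the least exponent with m J^(n+1) = 0. Some m·x with x ∈ J^n is nonzero
  -- and killed by J, yet all φᵢ vanish on it if γ m = 0.
  have hker : ∀ m, γ m = 0 → m = 0 := by
    intro m hm
    have hm' : ∀ (a : DualAlgebra k C) i, φ i (MulOpposite.op a • m) = 0 := by
      intro a i
      rw [← hγ a.ofConv i m, hm]
      exact map_zero _
    by_contra hm0
    have hex := (isRationalElement_comod M m).exists_radPow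
    classical
    have hspec := Nat.find_spec hex
    have hmin := fun i => Nat.find_min hex (m := i)
    cases hn : Nat.find hex with
    | zero =>
      rw [hn] at hspec
      apply hm0
      rw [← one_smul (DualAlgebra k C)ᵐᵒᵖ m]
      exact hspec 1 (Submodule.one_le.1 (Submodule.pow_zero _).ge)
    | succ n =>
      rw [hn] at hspec
      have := hmin n (by lia)
      push Not at this
      obtain ⟨x, hx, hxm⟩ := this
      apply hxm
      refine hφ₀ _ (fun a ha => ?_) fun i => hm' x i
      rw [smul_smul, ← MulOpposite.op_mul]
      refine hspec _ ?_
      exact (Submodule.pow_succ _).ge (Submodule.mul_mem_mul hx ha)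
  obtain ⟨χ, hχ⟩ := exists_comp_eq_of_ker_le k γ ψ fun m hm => by rw [hker m hm, map_zero]
  refine ⟨fun i => WithConv.toConv (χ ∘ₗ LinearMap.single k (fun _ => C) i), fun m => ?_⟩
  rw [← hχ, LinearMap.comp_apply]
  conv_lhs => rw [← Finset.univ_sum_single (γ m), map_sum]
  exact Finset.sum_congr rfl fun i _ => hγ (χ ∘ₗ LinearMap.single k (fun _ => C) i) i m

/-- Over an artinian coalgebra, a comodule is quasi-finite if and only if its dual is finitely
generated. -/
theorem isQuasiFinite_iff_finite_comodDual
    (hC : WellFoundedLT {V : Submodule k C // IsLeftCoideal k C V}) (M : LeftComod k C) :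
    IsQuasiFinite M ↔
      Module.Finite (DualAlgebra k C) ((comodDual k C).obj (Opposite.op M)) := by
  rw [finite_comodDual_iff]
  exact ⟨isDualFinite_of_isQuasiFinite hC, isQuasiFinite_of_isDualFinite⟩

end QuasiFinite

/-! ### Linear biduality -/

section Biduality

open Opposite

variable (k : Type u) [Field k] (A : Type u) [Ring A] [Algebra k A]

/-- Evaluation, from a right module to its double dual. -/
def evalRight (N : ModuleCat.{u} Aᵐᵒᵖ) :
    N ⟶ (dualLeft k A).obj (op ((dualRight k A).obj (op N))) :=
  ModuleCat.ofHom (Y := (dualLeft k A).obj (op ((dualRight k A).obj (op N))))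
    { toFun := fun n =>
        ({ toFun := fun φ : Module.Dual k N => φ n
           map_add' := fun _ _ => rfl
           map_smul' := fun a φ => (φ : Module.Dual k N).map_smul a n } :
          Module.Dual k ((dualRight k A).obj (op N)))
      map_add' := fun x y => LinearMap.ext fun φ => (φ : Module.Dual k N).map_add x y
      map_smul' := fun _ _ => rfl }

/-- Evaluation, from a left module to its double dual. -/
def evalLeft (X : ModuleCat.{u} A) :
    X ⟶ (dualRight k A).obj (op ((dualLeft k A).obj (op X))) :=
  ModuleCat.ofHom (Y := (dualRight k A).obj (op ((dualLeft k A).obj (op X))))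
    { toFun := fun n =>
        ({ toFun := fun φ : Module.Dual k X => φ n
           map_add' := fun _ _ => rfl
           map_smul' := fun a φ => (φ : Module.Dual k X).map_smul a n } :
          Module.Dual k ((dualLeft k A).obj (op X)))
      map_add' := fun x y => LinearMap.ext fun φ => (φ : Module.Dual k X).map_add x y
      map_smul' := fun _ _ => rfl }

/-- The linear duals from right to left and from left to right modules are adjoint. -/
def dualAdjunction : (dualRight k A).rightOp ⊣ dualLeft k A :=
  Adjunction.mkOfUnitCounit
    { unit := { app := fun N => evalRight k A N
                naturality := fun _ _ _ => rfl }
      counit := { app := fun X => (evalLeft k A X.unop).op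
                  naturality := fun _ _ _ => rfl }
      left_triangle := rfl
      right_triangle := rfl }

end Biduality

/-! ### The adjunction between comodules and left modules -/

section RationalAdjunction

open Opposite

variable (k C : Type u) [Field k] [AddCommGroup C] [Module k C] [Coalgebra k C]

/-- The inclusion of the rational part. -/
def ratCounit (N : ModuleCat.{u} (DualAlgebra k C)ᵐᵒᵖ) :
    (LeftComod.toMod k C).obj ((LeftComod.rat k C).obj N) ⟶ N :=
  ModuleCat.ofHom (X := ((LeftComod.rat k C).obj N).carrier)
    { toFun := fun m => (show rationalSubmodule k C N from m).1
      map_add' := fun _ _ => rfl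
      map_smul' := fun r m => (congrArg Subtype.val (LeftComod.ofRational_smul
        (isRationalElement_of_mem_rationalSubmodule k C (N := N)) r m)).symm }

/-- A comodule is rational as a module. -/
def ratUnit (M : LeftComod k C) :
    M ⟶ (LeftComod.rat k C).obj ((LeftComod.toMod k C).obj M) where
  lin :=
    { toFun := fun m => (⟨m, LeftComod.toMod_rational k C M m⟩ :
        rationalSubmodule k C ((LeftComod.toMod k C).obj M))
      map_add' := fun _ _ => rfl
      map_smul' := fun a m => Subtype.ext
        (algebraMap_smul (DualAlgebra k C)ᵐᵒᵖ a (show M.carrier from m)).symm }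
  comm := (LeftComod.mem_homSubmodule_iff _).2 fun g m =>
    LeftComod.ofRational_smul (isRationalElement_of_mem_rationalSubmodule k C
      (N := (LeftComod.toMod k C).obj M)) (MulOpposite.op g)
      ⟨m, LeftComod.toMod_rational k C M m⟩

/-- The rational functor is right adjoint to the inclusion of comodules in right modules. -/
def ratAdjunction : LeftComod.toMod k C ⊣ LeftComod.rat k C :=
  Adjunction.mkOfUnitCounit
    { unit := { app := ratUnit k C
                naturality := fun _ _ _ => rfl }
      counit := { app := ratCounit k C
                  naturality := fun _ _ _ => rfl }
      left_triangle := rfl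
      right_triangle := rfl }

/-- The functor `X ↦ Γ(X^*)` from left modules to comodules. -/
abbrev ratDual : (ModuleCat.{u} (DualAlgebra k C))ᵒᵖ ⥤ LeftComod k C :=
  dualLeft k (DualAlgebra k C) ⋙ LeftComod.rat k C

/-- The contravariant adjunction `Hom(X, M^*) ≃ Hom(M, Γ(X^*))`. -/
def comodDualAdjunction : (comodDual k C).rightOp ⊣ ratDual k C :=
  (ratAdjunction k C).comp (dualAdjunction k (DualAlgebra k C))

instance (A : Type u) [Ring A] [Algebra k A] : (dualRight k A).rightOp.PreservesMonomorphisms where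
  preserves {M N} f hf := by
    have : Epi f.op := inferInstance
    have : Epi ((dualRight k A).map f.op) := inferInstance
    exact op_mono_of_epi _

/-- A right adjoint of a functor preserving monomorphisms preserves injectives, and the injectives
of the opposite category are the projective modules. -/
lemma injective_dualLeft {A : Type u} [Ring A] [Algebra k A] (X : ModuleCat.{u} A) [Projective X] :
    Injective ((dualLeft k A).obj (op X)) :=
  Injective.injective_of_adjoint (dualAdjunction k A) (op X)

end RationalAdjunction

/-! ### Free modules of finite rank as duals of comodules -/

section FreeModules

open Opposite

variable {k C : Type u} [Field k] [AddCommGroup C] [Module k C] [Coalgebra k C]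
  {X : ModuleCat.{u} (DualAlgebra k C)} {ι : Type*} (b : Module.Basis ι (DualAlgebra k C) X)

/-- For `c : C`, the functional `x ↦ xᵢ c` on a free module over `C^*`. -/
def evalCoord (i : ι) : C →ₗ[k] (dualLeft k (DualAlgebra k C)).obj (op X) where
  toFun c := ({ toFun := fun x => (b.coord i x).ofConv c
                map_add' := fun x y => by rw [map_add]; rfl
                map_smul' := fun a x => by
                  change (b.coord i (algebraMap k (DualAlgebra k C) a • x)).ofConv c = _
                  rw [map_smul, smul_eq_mul, ← Algebra.smul_def]
                  rfl } : Module.Dual k X)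
  map_add' c c' := LinearMap.ext fun x => (b.coord i x).ofConv.map_add c c'
  map_smul' a c := LinearMap.ext fun x => by
    change (b.coord i x).ofConv (a • c) =
      (b.coord i (algebraMap k (DualAlgebra k C) a • x)).ofConv c
    rw [map_smul (b.coord i), smul_eq_mul, ← Algebra.smul_def, map_smul]
    rfl

lemma evalCoord_mem (i : ι) (c : C) :
    evalCoord b i c ∈ rationalSubmodule k C ((dualLeft k (DualAlgebra k C)).obj (op X)) := by
  refine ⟨(evalCoord b i).lTensor C (Coalgebra.comul c), fun f => ?_⟩
  rw [contr_lTensor]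
  refine LinearMap.ext fun x => ?_
  change (b.coord i (f • x)).ofConv c = _
  rw [map_smul]
  exact mul_ofConv_apply f (b.coord i x) c

variable [Fintype ι]

/-- The rational functionals on a free module of finite rank over `C^*` are given by elements
of `C`. -/
lemma exists_eq_sum_evalCoord (φ : (dualLeft k (DualAlgebra k C)).obj (op X))
    (hφ : φ ∈ rationalSubmodule k C _) :
    ∃ c : ι → C, φ = ∑ i, evalCoord b i (c i) := by
  obtain ⟨t, ht⟩ := hφ
  let coord (i : ι) : (dualLeft k (DualAlgebra k C)).obj (op X) →ₗ[k] k :=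
    { toFun := fun ψ => (show Module.Dual k X from ψ) (b i)
      map_add' := fun _ _ => rfl
      map_smul' := fun a ψ => (show Module.Dual k X from ψ).map_smul a _ }
  -- Evaluating the second factor of t at bᵢ yields cᵢ: φ(x) = ∑ (φ · xᵢ)(bᵢ) = ∑ xᵢ(cᵢ).
  refine ⟨fun i => TensorProduct.rid k C ((coord i).lTensor C t), LinearMap.ext fun x => ?_⟩
  have h₁ : (show Module.Dual k X from φ) x =
      ∑ i, coord i (MulOpposite.op (b.coord i x) • φ) := by
    refine (congrArg (show Module.Dual k X from φ) (b.sum_repr x).symm).trans ?_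
    exact map_sum (show Module.Dual k X from φ) _ _
  refine h₁.trans (Eq.trans ?_ (LinearMap.sum_apply _ _ _).symm)
  refine Finset.sum_congr rfl fun i _ => ?_
  rw [ht]
  change _ = (b.coord i x).ofConv (TensorProduct.rid k C ((coord i).lTensor C t))
  generalize b.coord i x = f
  clear ht h₁
  induction t using TensorProduct.induction_on with
  | zero => simp
  | tmul c n => simp [mul_comm]
  | add x y hx hy => simp only [map_add, hx, hy]

/-- By means of `evalCoord`, the rational part of X^* consists of one copy of C for each basis
vector, so its dual is a product of copies of C^*. Restricting a functional Ψ to these copies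
recovers the coordinates of its preimage. -/
lemma isIso_counit_of_basis {ι : Type*} [Fintype ι] (b : Module.Basis ι (DualAlgebra k C) X) :
    IsIso ((comodDualAdjunction k C).counit.app (op X)) := by
  let N := (dualLeft k (DualAlgebra k C)).obj (op X)
  suffices IsIso ((comodDualAdjunction k C).counit.app (op X)).unop from
    (isIso_unop_iff _).1 this
  rw [ConcreteCategory.isIso_iff_bijective]
  constructor
  · intro x y hxy
    apply b.ext_elem
    intro i
    apply WithConv.ofConv_injective
    ext c
    exact LinearMap.congr_fun (f := (show Module.Dual k ((LeftComod.toMod k C).obj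
        ((ratDual k C).obj (op X))) from
          ((comodDualAdjunction k C).counit.app (op X)).unop.hom x)) hxy
      (⟨evalCoord b i c, evalCoord_mem b i c⟩ : rationalSubmodule k C N)
  · intro (Ψ : Module.Dual k ((LeftComod.toMod k C).obj ((ratDual k C).obj (op X))))
    let ev (i : ι) : C →ₗ[k] rationalSubmodule k C N :=
      (evalCoord b i).codRestrict ((rationalSubmodule k C N).restrictScalars k)
        (evalCoord_mem b i)
    have hΨ : ∀ (a : k) (m : rationalSubmodule k C N), Ψ (a • m) = a * Ψ m := by
      intro a m
      refine (congrArg Ψ ?_).trans (Ψ.map_smul a m)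
      exact (algebraMap_smul (DualAlgebra k C)ᵐᵒᵖ a
        (show ((ratDual k C).obj (op X)).carrier from m)).symm
    let x : ι → DualAlgebra k C := fun i => WithConv.toConv
      { toFun := fun c => Ψ (ev i c)
        map_add' := fun c c' => by rw [map_add]; exact Ψ.map_add _ _
        map_smul' := fun a c => by rw [map_smul]; exact hΨ _ _ }
    refine ⟨∑ i, x i • b i, LinearMap.ext fun (φ : rationalSubmodule k C N) => ?_⟩
    obtain ⟨c, hc⟩ := exists_eq_sum_evalCoord b φ.1 φ.2
    have hφ : φ = ∑ i, ev i (c i) := Subtype.ext (hc.trans (by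
      rw [Submodule.coe_sum]; rfl))
    have h₂ : Ψ φ = ∑ i, Ψ (ev i (c i)) := by
      rw [hφ]
      exact map_sum Ψ _ _
    have h₁ : (show Module.Dual k X from φ.1) (∑ i, x i • b i) =
        ∑ i, Ψ (ev i (c i)) := by
      rw [hc]
      refine (LinearMap.sum_apply _ _ _).trans ?_
      refine Finset.sum_congr rfl fun i _ => ?_
      change (b.coord i (∑ i, x i • b i)).ofConv (c i) = _
      rw [Module.Basis.coord_apply, b.repr_sum_self]
      rfl
    exact h₁.trans h₂.symm

variable (X) in
/-- A finitely generated free module `X` over `C^*` is the dual of the comodule `Γ(X^*)`. -/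
lemma isIso_counit_of_free [Module.Free (DualAlgebra k C) X] [Module.Finite (DualAlgebra k C) X] :
    IsIso ((comodDualAdjunction k C).counit.app (op X)) :=
  isIso_counit_of_basis (Module.Free.chooseBasis (DualAlgebra k C) X)

variable (X) in
/-- The comodules `Γ(X^*)`, for `X` free of finite rank, are reflexive. -/
lemma isIso_unit_ratDual_of_free [Module.Free (DualAlgebra k C) X]
    [Module.Finite (DualAlgebra k C) X] :
    IsIso ((comodDualAdjunction k C).unit.app ((ratDual k C).obj (op X))) := by
  have := isIso_counit_of_free X
  exact IsIso.of_isIso_fac_right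
    ((comodDualAdjunction k C).right_triangle_components (op X))

instance (A : Type u) [Ring A] [Algebra k A] : (dualRight k A).Faithful where
  map_injective {M N f g} h := by
    apply Quiver.Hom.unop_inj
    ext x
    have hx : ∀ φ : Module.Dual k M.unop, φ (f.unop.hom x) = φ (g.unop.hom x) := fun φ =>
      LinearMap.congr_fun (f := φ ∘ₗ f.unop.hom.restrictScalars k)
        (g := φ ∘ₗ g.unop.hom.restrictScalars k) (ConcreteCategory.congr_hom h φ) x
    rw [← sub_eq_zero, ← Module.forall_dual_apply_eq_zero_iff k]
    intro φ
    rw [map_sub, hx, sub_self]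

instance : (comodDual k C).Faithful := by unfold comodDual; infer_instance

/-- A faithful functor reflects monomorphisms and epimorphisms, which suffices in a balanced
category. -/
instance : (comodDual k C).ReflectsIsomorphisms :=
  reflectsIsomorphisms_of_reflectsMonomorphisms_of_reflectsEpimorphisms _

end FreeModules

/-! ### Free resolutions over a left noetherian ring -/

section FreeResolution

variable {A : Type u} [Ring A]

/-- An elementwise criterion for a morphism of short complexes of modules to be a
quasi-isomorphism. -/
lemma quasiIso_shortComplex_of_forall {S₁ S₂ : ShortComplex (ModuleCat.{u} A)} (φ : S₁ ⟶ S₂)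
    (hinj : ∀ z : S₁.X₂, S₁.g.hom z = 0 → (∃ w, S₂.f.hom w = φ.τ₂.hom z) → ∃ y, S₁.f.hom y = z)
    (hsurj : ∀ y : S₂.X₂, S₂.g.hom y = 0 →
      ∃ z w, S₁.g.hom z = 0 ∧ y = φ.τ₂.hom z + S₂.f.hom w) : ShortComplex.QuasiIso φ := by
  let γ : ShortComplex.LeftHomologyMapData φ S₁.moduleCatLeftHomologyData
    S₂.moduleCatLeftHomologyData := default
  rw [γ.quasiIso_iff, ConcreteCategory.isIso_iff_bijective]
  have hi : ∀ x : LinearMap.ker S₁.g.hom,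
      (show LinearMap.ker S₂.g.hom from γ.φK.hom x).1 = φ.τ₂.hom x.1 := fun x =>
    ConcreteCategory.congr_hom γ.commi (show S₁.moduleCatLeftHomologyData.K from x)
  have hπ : ∀ x : LinearMap.ker S₁.g.hom,
      γ.φH.hom ((LinearMap.range S₁.moduleCatToCycles).mkQ x) =
        (LinearMap.range S₂.moduleCatToCycles).mkQ (γ.φK.hom x) := fun x =>
    ConcreteCategory.congr_hom γ.commπ (show S₁.moduleCatLeftHomologyData.K from x)
  constructor
  · refine (injective_iff_map_eq_zero γ.φH.hom).2 fun x hx => ?_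
    obtain ⟨z, rfl⟩ := Submodule.mkQ_surjective (LinearMap.range S₁.moduleCatToCycles) x
    have h₁ := (hπ z).symm.trans hx
    obtain ⟨w, hw⟩ := (Submodule.Quotient.mk_eq_zero _).1 h₁
    obtain ⟨y, hy⟩ := hinj z.1 z.2 ⟨w, (congrArg Subtype.val hw).trans (hi z)⟩
    exact (Submodule.Quotient.mk_eq_zero _).2 ⟨y, Subtype.ext hy⟩
  · intro y
    obtain ⟨y, rfl⟩ := Submodule.mkQ_surjective (LinearMap.range S₂.moduleCatToCycles) y
    obtain ⟨z, w, hz, hy⟩ := hsurj y.1 y.2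
    refine ⟨(LinearMap.range S₁.moduleCatToCycles).mkQ ⟨z, hz⟩, (hπ _).trans ?_⟩
    have hw : y - (show LinearMap.ker S₂.g.hom from γ.φK.hom (⟨z, hz⟩ : LinearMap.ker S₁.g.hom)) ∈
        LinearMap.range S₂.moduleCatToCycles := by
      refine ⟨w, Subtype.ext ?_⟩
      change S₂.f.hom w = y.1 - (show LinearMap.ker S₂.g.hom from γ.φK.hom _).1
      rw [hy, hi]
      exact (add_sub_cancel_left _ _).symm
    exact ((Submodule.Quotient.eq _).2 hw).symm

lemma exists_generators_of_finite_homology (S : ShortComplex (ModuleCat.{u} A))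
    [hS : Module.Finite A S.homology] :
    ∃ (n : ℕ) (h : Fin n → S.X₂), (∀ i, S.g.hom (h i) = 0) ∧
      ∀ y, S.g.hom y = 0 → ∃ (a : Fin n → A) (w : S.X₁), y = ∑ i, a i • h i + S.f.hom w := by
  have hfin : Module.Finite A (LinearMap.ker S.g.hom ⧸ LinearMap.range S.moduleCatToCycles) :=
    Module.Finite.equiv S.moduleCatHomologyIso.toLinearEquiv
  obtain ⟨n, s, hs⟩ := Module.Finite.exists_fin (R := A)
    (M := LinearMap.ker S.g.hom ⧸ LinearMap.range S.moduleCatToCycles)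
  choose h hh using fun i => Submodule.mkQ_surjective (LinearMap.range S.moduleCatToCycles) (s i)
  refine ⟨n, fun i => (h i).1, fun i => (h i).2, fun y hy => ?_⟩
  have hmem : (LinearMap.range S.moduleCatToCycles).mkQ ⟨y, hy⟩ ∈ Submodule.span A (Set.range s) :=
    hs ▸ Submodule.mem_top
  obtain ⟨a, ha⟩ := Submodule.mem_span_range_iff_exists_fun A |>.1 hmem
  have h₁ : (LinearMap.range S.moduleCatToCycles).mkQ ⟨y, hy⟩ =
      (LinearMap.range S.moduleCatToCycles).mkQ (∑ i, a i • h i) := by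
    rw [← ha, map_sum]
    simp only [map_smul, hh]
  obtain ⟨w, hw⟩ := (Submodule.Quotient.eq _).1 h₁
  refine ⟨a, w, ?_⟩
  have h₂ : S.f.hom w = y - (∑ i, a i • h i : LinearMap.ker S.g.hom).1 := congrArg Subtype.val hw
  rw [h₂, Submodule.coe_sum]
  simp

variable (L : ChainComplex (ModuleCat.{u} A) ℕ)

/-- A stage in the construction of a resolution of `L` by free modules: a free module `P` in degree
`j` with a map to `L`, and a module `Z` of cycles, which maps onto the homology of `L`. -/
structure ResolutionStage (j : ℕ) where
  P : ModuleCat.{u} A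
  free : Module.Free A P
  finite : Module.Finite A P
  f : P ⟶ L.X j
  Z : Submodule A P
  -- For j = 0 the truncated subtraction gives `L.d 0 0`, which is zero, so every element is a
  -- cycle.
  surj : ∀ y, (L.d j (j - 1)).hom y = 0 →
    ∃ z ∈ Z, ∃ w, y = f.hom z + (L.d (j + 1) j).hom w

variable {L}

/-- A continuation of a stage of a resolution in the next degree. -/
structure ResolutionStage.Next {j : ℕ} (S : ResolutionStage L j) where
  next : ResolutionStage L (j + 1)
  d : next.P ⟶ S.P
  comm : next.f ≫ L.d (j + 1) j = d ≫ S.f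
  ker : ∀ z, z ∈ next.Z ↔ d.hom z = 0
  -- This makes the map on homology injective in degree j; `surj` of the next stage gives
  -- surjectivity in degree j + 1.
  range : ∀ z, (∃ y, d.hom y = z) ↔ z ∈ S.Z ∧ ∃ w, (L.d (j + 1) j).hom w = S.f.hom z

lemma exists_generators (j : ℕ) (hL : Module.Finite A (L.homology j)) :
    ∃ (n : ℕ) (h : Fin n → L.X j), (∀ i, (L.d j (j - 1)).hom (h i) = 0) ∧
      ∀ y, (L.d j (j - 1)).hom y = 0 →
        ∃ (a : Fin n → A) (w : L.X (j + 1)), y = ∑ i, a i • h i + (L.d (j + 1) j).hom w := by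
  have h₁ : (ComplexShape.down ℕ).prev j = j + 1 := by simp
  have h₂ : (ComplexShape.down ℕ).next j = j - 1 := by
    cases j <;> simp
  have e := ShortComplex.homologyMapIso (L.isoSc' (j + 1) j (j - 1) h₁ h₂)
  have : Module.Finite A (L.sc' (j + 1) j (j - 1)).homology :=
    have : Module.Finite A (L.sc j).homology := hL
    Module.Finite.equiv e.toLinearEquiv
  exact exists_generators_of_finite_homology (L.sc' (j + 1) j (j - 1))

lemma exists_resolutionStage_zero (hL : Module.Finite A (L.homology 0)) :
    ∃ S : ResolutionStage L 0, S.Z = ⊤ := by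
  obtain ⟨n, h, h₀, hgen⟩ := exists_generators 0 hL
  refine ⟨{ P := ModuleCat.of A (Fin n → A)
            free := inferInstance
            finite := inferInstance
            f := ModuleCat.ofHom (Fintype.linearCombination A h)
            Z := ⊤
            surj := fun y hy => ?_ }, rfl⟩
  obtain ⟨a, w, hw⟩ := hgen y hy
  exact ⟨a, Submodule.mem_top, w, hw⟩

lemma ResolutionStage.nonempty_next [IsNoetherianRing A] {j : ℕ} (S : ResolutionStage L j)
    (hL : Module.Finite A (L.homology (j + 1))) : Nonempty S.Next := by
  obtain ⟨n, h, h₀, hgen⟩ := exists_generators (j + 1) hL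
  have := S.finite
  -- B consists of the cycles whose image in L is a boundary, and is finitely generated by
  -- noetherianity. The next free module has a generator for each l i, sent by d to l i and by f to
  -- a preimage of its image in L, and a generator for each homology generator h i, sent by d to 0
  -- and by f to h i.
  let B : Submodule A S.P := S.Z ⊓ (LinearMap.range (L.d (j + 1) j).hom).comap S.f.hom
  obtain ⟨r, l, hl⟩ := Submodule.fg_iff_exists_fin_generating_family.1
    (IsNoetherian.noetherian B)
  have hlB : ∀ i, l i ∈ B := fun i => hl ▸ Submodule.subset_span ⟨i, rfl⟩
  choose y hy using fun i => (hlB i).2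
  let d : (Fin r ⊕ Fin n → A) →ₗ[A] S.P := Fintype.linearCombination A (Sum.elim l 0)
  let f : (Fin r ⊕ Fin n → A) →ₗ[A] L.X (j + 1) := Fintype.linearCombination A (Sum.elim y h)
  have hd : ∀ x, d x = ∑ i, x (Sum.inl i) • l i := fun x => by
    simp [d, Fintype.linearCombination_apply, Fintype.sum_sum_type]
  have hf : ∀ x, f x = ∑ i, x (Sum.inl i) • y i + ∑ i, x (Sum.inr i) • h i := fun x => by
    simp [f, Fintype.linearCombination_apply, Fintype.sum_sum_type]
  have hcomm : ∀ x, (L.d (j + 1) j).hom (f x) = S.f.hom (d x) := by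
    intro x
    rw [hd, hf, map_add, map_sum, map_sum, map_sum]
    simp only [map_smul, hy]
    rw [Finset.sum_eq_zero (s := Finset.univ) (f := fun i => x (Sum.inr i) • _), add_zero]
    intro i _
    rw [show (L.d (j + 1) j).hom (h i) = 0 from h₀ i, smul_zero]
  have hrange : LinearMap.range d = B := by
    rw [← hl]
    ext z
    rw [Submodule.mem_span_range_iff_exists_fun]
    constructor
    · rintro ⟨x, rfl⟩
      exact ⟨fun i => x (Sum.inl i), (hd x).symm⟩
    · rintro ⟨a, rfl⟩
      exact ⟨Sum.elim a 0, hd _⟩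
  refine ⟨{ next :=
              { P := ModuleCat.of A (Fin r ⊕ Fin n → A)
                free := inferInstance
                finite := inferInstance
                f := ModuleCat.ofHom f
                Z := LinearMap.ker d
                surj := fun y hy => ?_ }
            d := ModuleCat.ofHom d
            comm := ?_
            ker := fun z => Iff.rfl
            range := fun z => ?_ }⟩
  · obtain ⟨a, w, hw⟩ := hgen y hy
    refine ⟨Sum.elim 0 a, ?_, w, hw.trans ?_⟩
    · rw [LinearMap.mem_ker, hd]
      simp
    · congr 1
      refine Eq.trans ?_ (hf _).symm
      simp
  · ext x
    exact hcomm _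
  · have := SetLike.ext_iff.1 hrange z
    exact this

variable (L) in
/-- A complex of modules over a left noetherian ring with finitely generated homology has a
resolution by free modules of finite rank. -/
theorem exists_free_resolution [IsNoetherianRing A] (hL : ∀ j, Module.Finite A (L.homology j)) :
    ∃ (P : ChainComplex (ModuleCat.{u} A) ℕ) (f : P ⟶ L), QuasiIso f ∧
      ∀ j, Module.Free A (P.X j) ∧ Module.Finite A (P.X j) := by
  obtain ⟨S₀, hS₀⟩ := exists_resolutionStage_zero (hL 0)
  let nx (j : ℕ) (S : ResolutionStage L j) : S.Next :=
    Classical.choice (S.nonempty_next (hL (j + 1)))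
  let S (j : ℕ) : ResolutionStage L j := Nat.rec S₀ (fun j S => (nx j S).next) j
  let d (j : ℕ) : (S (j + 1)).P ⟶ (S j).P := (nx j (S j)).d
  have hker : ∀ j z, z ∈ (S (j + 1)).Z ↔ (d j).hom z = 0 := fun j => (nx j (S j)).ker
  have hrange : ∀ j z, (∃ y, (d j).hom y = z) ↔
      z ∈ (S j).Z ∧ ∃ w, (L.d (j + 1) j).hom w = (S j).f.hom z := fun j => (nx j (S j)).range
  have hcomm : ∀ j, (S (j + 1)).f ≫ L.d (j + 1) j = d j ≫ (S j).f := fun j => (nx j (S j)).comm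
  let P : ChainComplex (ModuleCat.{u} A) ℕ := ChainComplex.of (fun j => (S j).P) d fun j => by
    ext x
    exact (hker j _).1 ((hrange (j + 1) _).1 ⟨x, rfl⟩).1
  have hPd : ∀ j, P.d (j + 1) j = d j := fun j => ChainComplex.of_d (fun j => (S j).P) d j
  let f : P ⟶ L :=
    { f := fun j => (S j).f
      comm' := by
        rintro _ j rfl
        exact (hcomm j).trans (by rw [hPd]) }
  refine ⟨P, f, ⟨fun j => ?_⟩, fun j => ⟨(S j).free, (S j).finite⟩⟩
  have hZ : ∀ z : P.X j, (P.d j (j - 1)).hom z = 0 ↔ z ∈ (S j).Z := by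
    cases j with
    | zero =>
      intro z
      have : P.d 0 (0 - 1) = 0 := P.shape _ _ (by simp)
      rw [this, show (S 0).Z = ⊤ from hS₀]
      exact ⟨fun _ => Submodule.mem_top, fun _ => rfl⟩
    | succ j =>
      intro z
      rw [show P.d (j + 1) (j + 1 - 1) = d j from hPd j]
      exact (hker j z).symm
  rw [quasiIsoAt_iff' _ (j + 1) j (j - 1) (by simp) (by cases j <;> simp)]
  refine quasiIso_shortComplex_of_forall _ (fun z hz hw => ?_) fun y hy => ?_
  · obtain ⟨x, hx⟩ := (hrange j z).2 ⟨(hZ z).1 hz, hw⟩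
    refine ⟨x, ?_⟩
    change (P.d (j + 1) j).hom x = z
    rw [hPd]
    exact hx
  · obtain ⟨z, hz, w, h⟩ := (S j).surj y hy
    exact ⟨z, w, (hZ z).2 hz, h⟩

end FreeResolution

/-! ### Bounded above complexes of free modules -/

section FreeComplex

open ComplexShape HomologicalComplex

/-- The condition only concerns degrees whose predecessor lies outside the image of the embedding;
the predecessor of N - j is N - (j + 1), so there are none. -/
lemma hasLift_embeddingUpIntLE {V : Type*} [Category* V] [HasZeroMorphisms V]
    [HasZeroObject V] {K : CochainComplex V ℤ} {N : ℤ} {L : ChainComplex V ℕ}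
    (φ : K.restriction (embeddingUpIntLE N) ⟶ L) : (embeddingUpIntLE N).HasLift φ := by
  intro j hj
  exfalso
  refine hj.2 (j + 1) ?_
  exact (embeddingUpIntLE N).rel (show (ComplexShape.down ℕ).Rel (j + 1) j by simp)

/-- A complex in degrees `≤ N` is the extension by zero of its restriction to these degrees. -/
lemma isIso_liftExtend_id {V : Type*} [Category* V] [HasZeroMorphisms V]
    [HasZeroObject V] (K : CochainComplex V ℤ) (N : ℤ) [K.IsStrictlyLE N] :
    IsIso ((embeddingUpIntLE N).liftExtend (𝟙 (K.restriction (embeddingUpIntLE N)))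
      (hasLift_embeddingUpIntLE _)) := by
  have : ∀ n, IsIso (((embeddingUpIntLE N).liftExtend (𝟙 (K.restriction (embeddingUpIntLE N)))
      (hasLift_embeddingUpIntLE _)).f n) := by
    intro n
    by_cases hn : ∃ j, (embeddingUpIntLE N).f j = n
    · obtain ⟨j, hj⟩ := hn
      rw [ComplexShape.Embedding.isIso_liftExtend_f_iff _ _ _ hj]
      infer_instance
    · push Not at hn
      exact ⟨0, (K.isZero_X_of_isStrictlySupported _ n hn).eq_of_src _ _,
        (isZero_extend_X _ _ _ hn).eq_of_src _ _⟩
  exact HomologicalComplex.Hom.isIso_of_components _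

variable {A : Type u} [Ring A]

lemma free_and_finite_of_iso {X Y : ModuleCat.{u} A} (e : X ≅ Y)
    (h : Module.Free A X ∧ Module.Finite A X) : Module.Free A Y ∧ Module.Finite A Y := by
  have := h.1
  have := h.2
  exact ⟨Module.Free.of_equiv e.toLinearEquiv, Module.Finite.equiv e.toLinearEquiv⟩

lemma free_and_finite_of_isZero {X : ModuleCat.{u} A} (h : IsZero X) :
    Module.Free A X ∧ Module.Finite A X :=
  have := ModuleCat.subsingleton_of_isZero h
  ⟨inferInstance, inferInstance⟩

variable [IsNoetherianRing A] [HasDerivedCategory.{w₁} (ModuleCat.{u} A)]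

/-- Over a left noetherian ring, an object of the bounded above derived category with finitely
generated cohomology is isomorphic to a bounded above complex of free modules of finite rank. -/
theorem exists_free_complex (X : DerivedCategory (ModuleCat.{u} A))
    (hX : DerivedCategory.TStructure.t.minus X)
    (hfin : ∀ n, Module.Finite A ((DerivedCategory.homologyFunctor (ModuleCat.{u} A) n).obj X)) :
    ∃ (P : CochainComplex (ModuleCat.{u} A) ℤ) (N : ℤ), P.IsStrictlyLE N ∧
      (∀ n, Module.Free A (P.X n) ∧ Module.Finite A (P.X n)) ∧
      Nonempty (DerivedCategory.Q.obj P ≅ X) := by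
  obtain ⟨N, ⟨K, e, hK⟩⟩ := hX
  let L := K.restriction (embeddingUpIntLE N)
  let φ := (embeddingUpIntLE N).liftExtend (𝟙 L) (hasLift_embeddingUpIntLE _)
  have : IsIso φ := isIso_liftExtend_id K N
  have hL : ∀ j, Module.Finite A (L.homology j) := by
    intro j
    have := hfin ((embeddingUpIntLE N).f j)
    exact Module.Finite.equiv
      (((DerivedCategory.homologyFunctor _ _).mapIso e ≪≫
        (DerivedCategory.homologyFunctorFactors _ _).app K ≪≫
        (HomologicalComplex.homologyFunctor _ _ _).mapIso (asIso φ) ≪≫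
        L.extendHomologyIso (embeddingUpIntLE N) rfl).toLinearEquiv)
  obtain ⟨P, f, hf, hP⟩ := exists_free_resolution L hL
  have : QuasiIso (extendMap f (embeddingUpIntLE N)) := (quasiIso_extendMap_iff f _).2 hf
  refine ⟨P.extend (embeddingUpIntLE N), N, inferInstance, fun n => ?_,
    ⟨asIso (DerivedCategory.Q.map (extendMap f (embeddingUpIntLE N))) ≪≫
      DerivedCategory.Q.mapIso (asIso φ).symm ≪≫ e.symm⟩⟩
  by_cases hn : ∃ j, (embeddingUpIntLE N).f j = n
  · obtain ⟨j, hj⟩ := hn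
    exact free_and_finite_of_iso (P.extendXIso (embeddingUpIntLE N) hj).symm (hP j)
  · push Not at hn
    exact free_and_finite_of_isZero (isZero_extend_X _ _ _ hn)

end FreeComplex

/-! ### Complexes with finitely generated cohomology -/

section FiniteHomology

open Pretriangulated Opposite ZeroObject

lemma finite_of_iso {A : Type u} [Ring A] {X Y : ModuleCat.{u} A} (e : X ≅ Y)
    (h : Module.Finite A X) :
    Module.Finite A Y := Module.Finite.equiv e.toLinearEquiv

lemma finite_of_exact {A : Type u} [Ring A] [IsNoetherianRing A]
    {S : ShortComplex (ModuleCat.{u} A)} (hS : S.Exact)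
    (h₁ : Module.Finite A S.X₁) (h₃ : Module.Finite A S.X₃) : Module.Finite A S.X₂ := by
  have hN₁ : IsNoetherian A S.X₁ := isNoetherian_of_isNoetherianRing_of_finite A _
  have hN₃ : IsNoetherian A S.X₃ := isNoetherian_of_isNoetherianRing_of_finite A _
  have : IsNoetherian A S.X₂ := isNoetherian_of_range_eq_ker S.f.hom S.g.hom
    hS.moduleCat_range_eq_ker
  infer_instance

variable (A : Type u) [Ring A] [HasDerivedCategory.{w₁} (ModuleCat.{u} A)]

/-- The complexes with finitely generated cohomology modules. -/
def finiteHomology : ObjectProperty (DerivedCategory (ModuleCat.{u} A)) :=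
  fun X => ∀ n : ℤ, Module.Finite A
    ((DerivedCategory.homologyFunctor (ModuleCat.{u} A) n).obj X)

instance : (finiteHomology A).IsClosedUnderIsomorphisms where
  of_iso e h n := finite_of_iso ((DerivedCategory.homologyFunctor _ n).mapIso e) (h n)

instance [IsNoetherianRing A] : (finiteHomology A).IsTriangulated where
  exists_zero := ⟨_, isZero_zero _, fun n => by
    have : Subsingleton ((DerivedCategory.homologyFunctor (ModuleCat.{u} A) n).obj
        0) :=
      ModuleCat.subsingleton_of_isZero
        ((DerivedCategory.homologyFunctor (ModuleCat.{u} A) n).map_isZero (isZero_zero _))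
    infer_instance⟩
  isStableUnderShiftBy a :=
    { le_shift := fun X hX n => finite_of_iso
        (((DerivedCategory.homologyFunctor (ModuleCat.{u} A) 0).shiftIso
          a n (a + n) rfl).app X).symm (hX (a + n)) }
  toIsTriangulatedClosed₂ := .mk' fun T hT h₁ h₃ n =>
    finite_of_exact (DerivedCategory.HomologySequence.exact₂ T hT n) (h₁ n) (h₃ n)

end FiniteHomology

/-! ### Quasi-finite cohomology corresponds to finitely generated cohomology -/

section Subcategories

open Pretriangulated Opposite ZeroObject

lemma isZero_of_isZero_comodDual {k C : Type u} [Field k] [AddCommGroup C] [Module k C]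
    [Coalgebra k C] {M : LeftComod k C}
    (h : IsZero ((comodDual k C).obj (op M))) : IsZero M := by
  rw [IsZero.iff_id_eq_zero] at h ⊢
  apply Quiver.Hom.op_inj
  apply (comodDual k C).map_injective
  rw [op_id, CategoryTheory.Functor.map_id, h, op_zero, Functor.map_zero]

variable (k C : Type u) [Field k] [AddCommGroup C] [Module k C] [Coalgebra k C]
  [HasDerivedCategory.{w₁} (ModuleCat.{u} (DualAlgebra k C))]

lemma fgMinus_eq : fgMinus k C =
    (finiteHomology (DualAlgebra k C)).inverseImage DerivedCategory.Minus.ι := rfl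

lemma fgBounded_eq : fgBounded k C = (finiteHomology (DualAlgebra k C) ⊓
    DerivedCategory.TStructure.t.bounded).inverseImage DerivedCategory.Minus.ι := rfl

instance : (fgMinus k C).IsClosedUnderIsomorphisms := by
  rw [fgMinus_eq]; infer_instance

instance : (fgBounded k C).IsClosedUnderIsomorphisms := by
  rw [fgBounded_eq]; infer_instance

lemma isTriangulated_fgMinus [IsNoetherianRing (DualAlgebra k C)] :
    (fgMinus k C).IsTriangulated := by
  rw [fgMinus_eq]; infer_instance

lemma isTriangulated_fgBounded [IsNoetherianRing (DualAlgebra k C)] :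
    (fgBounded k C).IsTriangulated := by
  rw [fgBounded_eq]; infer_instance

variable [HasDerivedCategory.{w₃} (LeftComod k C)]

/-- Exactness gives that the cohomology of Y^* in degree n is the dual of that of Y in degree -n, so
the criterion for a single comodule applies in each degree. -/
lemma qfPlus_iff (hC : WellFoundedLT {V : Submodule k C // IsLeftCoideal k C V})
    (Y : DerivedCategory.Plus (LeftComod k C)) :
    qfPlus k C Y ↔ fgMinus k C ((derivedDual k C).obj (op Y)) := by
  have key (n : ℤ) :
      IsQuasiFinite ((DerivedCategory.homologyFunctor (LeftComod k C) (-n)).obj Y.obj) ↔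
      Module.Finite (DualAlgebra k C) ((DerivedCategory.homologyFunctor
        (ModuleCat.{u} (DualAlgebra k C)) n).obj
          ((mapDerivedOp (comodDual k C)).obj (op Y.obj))) := by
    obtain ⟨e⟩ := nonempty_mapDerivedOp_homology_iso (comodDual k C) Y.obj n
    rw [isQuasiFinite_iff_finite_comodDual hC]
    exact ⟨finite_of_iso e.symm, finite_of_iso e⟩
  constructor
  · intro h n
    exact (key n).1 (h (-n))
  · intro h n
    obtain ⟨m, rfl⟩ : ∃ m, n = -m := ⟨-n, by simp⟩
    exact (key m).2 (h m)

lemma qfBounded_iff (hC : WellFoundedLT {V : Submodule k C // IsLeftCoideal k C V})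
    (Y : DerivedCategory.Plus (LeftComod k C)) :
    qfBounded k C Y ↔ fgBounded k C ((derivedDual k C).obj (op Y)) := by
  refine and_congr (qfPlus_iff k C hC Y) ⟨fun h => ⟨?_, ?_⟩, fun h => ⟨Y.property, ?_⟩⟩
  · exact mapDerivedOp_plus (comodDual k C) _ h.2
  · exact mapDerivedOp_minus (comodDual k C) _ h.1
  -- The dual reflects zero objects, so a lower bound for the cohomology of Y^* is an upper bound
  -- for that of Y.
  · obtain ⟨n, hn⟩ := h.1
    refine ⟨-n, (DerivedCategory.isLE_iff _ _).2 fun i hi => ?_⟩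
    obtain ⟨m, rfl⟩ : ∃ m, i = -m := ⟨-i, by simp⟩
    obtain ⟨e⟩ := nonempty_mapDerivedOp_homology_iso (comodDual k C) Y.obj m
    exact isZero_of_isZero_comodDual
      (((DerivedCategory.isGE_iff _ _).1 hn m (by lia)).of_iso e.symm)

end Subcategories

/-! ### Lifting morphisms and objects along a contravariant adjunction -/

section ContravariantAdjunction

open Opposite

variable {𝒜 : Type*} [Category* 𝒜] {ℬ : Type*} [Category* ℬ]
  {D : 𝒜ᵒᵖ ⥤ ℬ} {R : ℬᵒᵖ ⥤ 𝒜} (adj : D.rightOp ⊣ R)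

/-- Up to the invertible counit, D on morphisms is the adjunction bijection Hom(M, R(X)) ≅ Hom(X,
D(M)). -/
lemma bijective_map_of_isIso_counit (X : ℬ) [IsIso (adj.counit.app (op X))] (M : 𝒜) :
    Function.Bijective (fun f : M ⟶ R.obj (op X) => D.map f.op) := by
  have h : ∀ f : M ⟶ R.obj (op X), (adj.homEquiv M (op X)).symm f =
      (D.map f.op).op ≫ adj.counit.app (op X) := fun f => adj.homEquiv_counit M (op X) f
  constructor
  · intro f g hfg
    apply (adj.homEquiv M (op X)).symm.injective
    rw [h, h]
    exact congrArg (fun φ => Quiver.Hom.op φ ≫ adj.counit.app (op X)) hfg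
  · intro g
    refine ⟨adj.homEquiv M (op X) (g.op ≫ adj.counit.app (op X)), ?_⟩
    have h' := h (adj.homEquiv M (op X) (g.op ≫ adj.counit.app (op X)))
    rw [Equiv.symm_apply_apply, cancel_mono] at h'
    exact (Quiver.Hom.op_inj h').symm

variable [Abelian 𝒜] [Abelian ℬ] [D.Additive]

/-- Lifts chosen degree by degree commute with the differentials because D is faithful. -/
lemma exists_mapComplexOp_map_eq [D.Faithful] {K I : CochainComplex 𝒜 ℤ}
    (h : ∀ n, Function.Surjective (fun f : K.X n ⟶ I.X n => D.map f.op))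
    (ψ : (mapComplexOp D).obj (op I) ⟶ (mapComplexOp D).obj (op K)) :
    ∃ φ : K ⟶ I, (mapComplexOp D).map φ.op = ψ := by
  have h' : ∀ n, ∃ f : K.X (-n) ⟶ I.X (-n), D.map f.op = ψ.f n := fun n => h (-n) (ψ.f n)
  choose θ hθ using h'
  let Θ : (CochainComplex.opEquivalence 𝒜).functor.obj (op I) ⟶
      (CochainComplex.opEquivalence 𝒜).functor.obj (op K) :=
    { f := fun n => (θ n).op
      comm' := fun i j _ => by
        apply Quiver.Hom.unop_inj
        change K.d (-j) (-i) ≫ θ i = θ j ≫ I.d (-j) (-i)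
        apply Quiver.Hom.op_inj
        apply D.map_injective
        rw [op_comp, op_comp, D.map_comp, D.map_comp, hθ, hθ]
        exact ψ.comm i j }
  obtain ⟨φ, hφ⟩ := (CochainComplex.opEquivalence 𝒜).functor.map_surjective Θ
  refine ⟨φ.unop, ?_⟩
  ext n
  refine Eq.trans ?_ (hθ n)
  exact congrArg (fun t => D.map (HomologicalComplex.Hom.f t n)) hφ

variable [R.Additive]

/-- A complex of reflexive objects is isomorphic to its double dual. -/
def doubleDualIso (P : CochainComplex ℬ ℤ) (hP : ∀ n, IsIso (adj.counit.app (op (P.X n)))) :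
    (mapComplexOp D).obj (op ((mapComplexOp R).obj (op P))) ≅ P :=
  HomologicalComplex.Hom.isoOfComponents
    (fun n => (asIso (adj.counit.app (op (P.X (- -n))))).unop.symm ≪≫ P.XIsoOfEq (neg_neg n))
    (fun i j _ => by
      have nat : P.d (- -i) (- -j) ≫ (adj.counit.app (op (P.X (- -j)))).unop =
          (adj.counit.app (op (P.X (- -i)))).unop ≫ D.map (R.map (P.d (- -i) (- -j)).op).op :=
        Quiver.Hom.op_inj (adj.counit.naturality (P.d (- -i) (- -j)).op).symm
      let c := fun n => (asIso (adj.counit.app (op (P.X (- -n))))).unop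
      change ((c i).inv ≫ (P.XIsoOfEq (neg_neg i)).hom) ≫ P.d i j =
        D.map (R.map (P.d (- -i) (- -j)).op).op ≫ (c j).inv ≫ (P.XIsoOfEq (neg_neg j)).hom
      have nat' : (c i).inv ≫ P.d (- -i) (- -j) =
          D.map (R.map (P.d (- -i) (- -j)).op).op ≫ (c j).inv := by
        rw [Iso.inv_comp_eq, ← Category.assoc, Iso.eq_comp_inv]
        exact nat
      rw [Category.assoc, HomologicalComplex.XIsoOfEq_hom_comp_d, ← reassoc_of% nat',
        HomologicalComplex.d_comp_XIsoOfEq_hom])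

variable [D.Faithful] [HasDerivedCategory ℬ]

/-- If `P` is a bounded above complex of reflexive projective objects, any morphism in the derived
category from the double dual of `P` to the dual of `K` is the dual of a morphism of complexes. -/
lemma exists_Q_map_mapComplexOp_map_eq (P : CochainComplex ℬ ℤ) (N : ℤ) [P.IsStrictlyLE N]
    (hP : ∀ n, Projective (P.X n)) (hc : ∀ n, IsIso (adj.counit.app (op (P.X n))))
    (K : CochainComplex 𝒜 ℤ)
    (g : DerivedCategory.Q.obj ((mapComplexOp D).obj (op ((mapComplexOp R).obj (op P)))) ⟶
      DerivedCategory.Q.obj ((mapComplexOp D).obj (op K))) :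
    ∃ φ : K ⟶ (mapComplexOp R).obj (op P),
      DerivedCategory.Q.map ((mapComplexOp D).map φ.op) = g := by
  -- Morphisms out of a K-projective complex in the derived category are represented by chain maps,
  -- and these lift through D in each degree.
  have : P.IsKProjective := CochainComplex.isKProjective_of_projective P N
  have := CochainComplex.isKProjective_of_iso (doubleDualIso adj P hc).symm
  obtain ⟨g', hg'⟩ := (CochainComplex.IsKProjective.Qh_map_bijective _ _).surjective
    ((DerivedCategory.quotientCompQhIso ℬ).hom.app _ ≫ g ≫
      (DerivedCategory.quotientCompQhIso ℬ).inv.app _)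
  obtain ⟨ψ, rfl⟩ := (HomotopyCategory.quotient _ _).map_surjective g'
  obtain ⟨φ, rfl⟩ := exists_mapComplexOp_map_eq
    (I := (mapComplexOp R).obj (op P)) (fun n => by
      have := hc (-n)
      exact (bijective_map_of_isIso_counit adj (P.X (-n)) (K.X n)).2) ψ
  refine ⟨φ, ?_⟩
  have nat := (DerivedCategory.quotientCompQhIso ℬ).hom.naturality ((mapComplexOp D).map φ.op)
  rw [← cancel_epi ((DerivedCategory.quotientCompQhIso ℬ).hom.app _)]
  refine nat.symm.trans ?_
  refine (congrArg (· ≫ (DerivedCategory.quotientCompQhIso ℬ).hom.app _) hg').trans ?_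
  simp

variable [PreservesFiniteLimits D] [PreservesFiniteColimits D] [HasDerivedCategory 𝒜]

lemma mapDerivedOp_map_surjective_of_iso (P : CochainComplex ℬ ℤ) (N : ℤ) [P.IsStrictlyLE N]
    (hP : ∀ n, Projective (P.X n)) (hc : ∀ n, IsIso (adj.counit.app (op (P.X n))))
    {Y Y' : DerivedCategory 𝒜}
    (e : Y' ≅ DerivedCategory.Q.obj ((mapComplexOp R).obj (op P))) :
    Function.Surjective (fun f : Y ⟶ Y' => (mapDerivedOp D).map f.op) := by
  intro g
  let e' : DerivedCategory.Q.obj (DerivedCategory.Q.objPreimage Y) ≅ Y :=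
    DerivedCategory.Q.objObjPreimageIso Y
  let t := mapDerivedOpFactors D
  obtain ⟨φ, hφ⟩ := exists_Q_map_mapComplexOp_map_eq adj P N hP hc _
    (t.inv.app _ ≫ (mapDerivedOp D).map e.hom.op ≫ g ≫ (mapDerivedOp D).map e'.hom.op ≫
      t.hom.app (op (DerivedCategory.Q.objPreimage Y)))
  refine ⟨e'.inv ≫ DerivedCategory.Q.map φ ≫ e.inv, ?_⟩
  have nat : (mapDerivedOp D).map (DerivedCategory.Q.map φ).op =
      (mapDerivedOp D).map e.hom.op ≫ g ≫ (mapDerivedOp D).map e'.hom.op := by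
    have := t.hom.naturality φ.op
    rw [← cancel_mono (t.hom.app _)]
    refine this.trans ?_
    refine (congrArg (t.hom.app _ ≫ ·) hφ).trans ?_
    simp
  simp only [op_comp, Functor.map_comp, nat, Category.assoc]
  simp only [← Functor.map_comp_assoc, ← Functor.map_comp, ← op_comp]
  simp

/-- An object whose dual is represented by a bounded above complex `P` of reflexive projective
objects is represented by the dual of `P`. -/
lemma nonempty_iso_of_iso_mapDerivedOp [D.ReflectsIsomorphisms]
    (P : CochainComplex ℬ ℤ) (N : ℤ) [P.IsStrictlyLE N]
    (hP : ∀ n, Projective (P.X n)) (hc : ∀ n, IsIso (adj.counit.app (op (P.X n))))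
    {Y : DerivedCategory 𝒜} (e : DerivedCategory.Q.obj P ≅ (mapDerivedOp D).obj (op Y)) :
    Nonempty (Y ≅ DerivedCategory.Q.obj ((mapComplexOp R).obj (op P))) := by
  let e' : DerivedCategory.Q.obj (DerivedCategory.Q.objPreimage Y) ≅ Y :=
    DerivedCategory.Q.objObjPreimageIso Y
  let i : DerivedCategory.Q.obj ((mapComplexOp D).obj (op ((mapComplexOp R).obj (op P)))) ≅
      DerivedCategory.Q.obj ((mapComplexOp D).obj (op (DerivedCategory.Q.objPreimage Y))) :=
    DerivedCategory.Q.mapIso (doubleDualIso adj P hc) ≪≫ e ≪≫ (mapDerivedOp D).mapIso e'.op ≪≫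
      (mapDerivedOpFactors D).app (op (DerivedCategory.Q.objPreimage Y))
  -- The isomorphism i is the dual of a chain map φ into R(P), and D reflects quasi-isomorphisms.
  obtain ⟨φ, hφ⟩ := exists_Q_map_mapComplexOp_map_eq adj P N hP hc _ i.hom
  have : QuasiIso ((mapComplexOp D).map φ.op) := by
    rw [← DerivedCategory.isIso_Q_map_iff_quasiIso, hφ]
    infer_instance
  have : QuasiIso φ := quasiIso_of_quasiIso_mapComplexOp_map D φ
  exact ⟨e'.symm ≪≫ asIso (DerivedCategory.Q.map φ)⟩

end ContravariantAdjunction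

/-! ### The derived biduality morphism -/

section DoubleDual

open Opposite

lemma comp_comp_comp_eq_of_squares {𝒞 : Type*} [Category* 𝒞] {X₀ X₁ X₂ X₃ Y₀ Y₁ Y₂ Y₃ : 𝒞}
    {a : X₀ ⟶ X₁} {b : X₁ ⟶ X₂} {c : X₂ ⟶ X₃} {a' : Y₀ ⟶ Y₁} {b' : Y₁ ⟶ Y₂} {c' : Y₂ ⟶ Y₃}
    {x : X₀ ⟶ Y₀} {y : X₁ ⟶ Y₁} {z : X₂ ⟶ Y₂} {w : X₃ ⟶ Y₃} (h₁ : x ≫ a' = a ≫ y)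
    (h₂ : y ≫ b' = b ≫ z) (h₃ : z ≫ c' = c ≫ w) :
    x ≫ a' ≫ b' ≫ c' = (a ≫ b ≫ c) ≫ w := by
  rw [reassoc_of% h₁, reassoc_of% h₂, h₃, Category.assoc, Category.assoc]

variable {𝒜 : Type*} [Category* 𝒜] [Abelian 𝒜] {ℬ : Type*} [Category* ℬ] [Abelian ℬ]
  {ℰ : Type*} [Category* ℰ] [Abelian ℰ] (D : 𝒜ᵒᵖ ⥤ ℬ) (E : ℬᵒᵖ ⥤ ℰ) [D.Additive] [E.Additive]

/-- Applying two contravariant functors to a complex amounts to applying their composition. -/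
def mapComplexOpCompIso (K : CochainComplex 𝒜 ℤ) :
    (mapComplexOp E).obj (op ((mapComplexOp D).obj (op K))) ≅
      ((D.rightOp ⋙ E).mapHomologicalComplex (ComplexShape.up ℤ)).obj K :=
  HomologicalComplex.Hom.isoOfComponents
    (fun n => (D.rightOp ⋙ E).mapIso (K.XIsoOfEq (neg_neg n)))
    (fun i j _ => by
      change (D.rightOp ⋙ E).map (K.XIsoOfEq (neg_neg i)).hom ≫ (D.rightOp ⋙ E).map (K.d i j) =
        (D.rightOp ⋙ E).map (K.d (- -i) (- -j)) ≫
          (D.rightOp ⋙ E).map (K.XIsoOfEq (neg_neg j)).hom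
      rw [← Functor.map_comp, ← Functor.map_comp, HomologicalComplex.XIsoOfEq_hom_comp_d,
        HomologicalComplex.d_comp_XIsoOfEq_hom])

lemma mapComplexOpCompIso_hom_naturality {K L : CochainComplex 𝒜 ℤ} (f : K ⟶ L) :
    (mapComplexOp E).map ((mapComplexOp D).map f.op).op ≫ (mapComplexOpCompIso D E L).hom =
      (mapComplexOpCompIso D E K).hom ≫
        ((D.rightOp ⋙ E).mapHomologicalComplex (ComplexShape.up ℤ)).map f := by
  ext n
  change (D.rightOp ⋙ E).map (f.f (- -n)) ≫ (D.rightOp ⋙ E).map (L.XIsoOfEq (neg_neg n)).hom =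
    (D.rightOp ⋙ E).map (K.XIsoOfEq (neg_neg n)).hom ≫ (D.rightOp ⋙ E).map (f.f n)
  rw [← Functor.map_comp, ← Functor.map_comp, HomologicalComplex.XIsoOfEq_hom_naturality]

variable [PreservesFiniteLimits D] [PreservesFiniteColimits D]
  [PreservesFiniteLimits E] [PreservesFiniteColimits E]
  [HasDerivedCategory 𝒜] [HasDerivedCategory ℬ] [HasDerivedCategory ℰ]

/-- On complexes, the composition of two derived contravariant functors is given by applying the
composition termwise. -/
def mapDerivedOpCompIso :
    DerivedCategory.Q ⋙ (mapDerivedOp D).rightOp ⋙ mapDerivedOp E ≅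
      (D.rightOp ⋙ E).mapHomologicalComplex (ComplexShape.up ℤ) ⋙ DerivedCategory.Q :=
  NatIso.ofComponents
    (fun K => (mapDerivedOp E).mapIso ((mapDerivedOpFactors D).symm.app (op K)).op ≪≫
      (mapDerivedOpFactors E).app (op ((mapComplexOp D).obj (op K))) ≪≫
      DerivedCategory.Q.mapIso (mapComplexOpCompIso D E K))
    (fun {K L} f => by
      have h₁ := congrArg (fun φ => (mapDerivedOp E).map φ.op)
        ((mapDerivedOpFactors D).inv.naturality f.op)
      simp only [op_comp, Functor.map_comp] at h₁
      have h₃ := congrArg DerivedCategory.Q.map (mapComplexOpCompIso_hom_naturality D E f)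
      rw [Functor.map_comp, Functor.map_comp] at h₃
      exact comp_comp_comp_eq_of_squares h₁.symm
        ((mapDerivedOpFactors E).hom.naturality ((mapComplexOp D).map f.op).op) h₃)

/-- The comparison in the bounded below derived category. -/
def mapPlusOpCompIso :
    DerivedCategory.Plus.Q ⋙ (mapPlusOp D).rightOp ⋙ mapMinusOp E ≅
      (D.rightOp ⋙ E).mapCochainComplexPlus ⋙ DerivedCategory.Plus.Q :=
  (DerivedCategory.TStructure.t.plus.fullyFaithfulι.whiskeringRight _).preimageIso
    (show CochainComplex.Plus.ι 𝒜 ⋙ HomotopyCategory.quotient _ _ ⋙ DerivedCategory.Qh ⋙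
        (mapDerivedOp D).rightOp ⋙ mapDerivedOp E ≅
        CochainComplex.Plus.ι 𝒜 ⋙ (D.rightOp ⋙ E).mapHomologicalComplex (ComplexShape.up ℤ) ⋙
          HomotopyCategory.quotient _ _ ⋙ DerivedCategory.Qh from
      Functor.isoWhiskerLeft (CochainComplex.Plus.ι 𝒜)
        (Functor.isoWhiskerRight (DerivedCategory.quotientCompQhIso 𝒜)
            ((mapDerivedOp D).rightOp ⋙ mapDerivedOp E) ≪≫ mapDerivedOpCompIso D E ≪≫
          Functor.isoWhiskerLeft _ (DerivedCategory.quotientCompQhIso ℰ).symm))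

variable [EnoughInjectives ℰ] {D E} {Γ : ℰ ⥤ 𝒜} [Γ.Additive] (u : 𝟭 𝒜 ⟶ (D.rightOp ⋙ E) ⋙ Γ)

/-- The morphism from a complex induced termwise by a natural transformation from the identity. -/
def toDoubleDualComplex : 𝟭 (CochainComplex.Plus 𝒜) ⟶
    (D.rightOp ⋙ E).mapCochainComplexPlus ⋙ Γ.mapCochainComplexPlus where
  app K := ObjectProperty.homMk
    { f := fun n => u.app (K.obj.X n)
      comm' := fun i j _ => (u.naturality (K.obj.d i j)).symm }
  naturality K L f := by
    ext n
    exact u.naturality (f.hom.f n)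

/-- On complexes, the comparison with the derived functor of `Γ` at the double dual. -/
def toRightDerivedDoubleDual : DerivedCategory.Plus.Q ⟶
    DerivedCategory.Plus.Q ⋙ (mapPlusOp D).rightOp ⋙ mapMinusOp E ⋙ Γ.rightDerivedFunctorPlus :=
  Functor.whiskerRight (toDoubleDualComplex u) DerivedCategory.Plus.Q ≫
    Functor.whiskerLeft ((D.rightOp ⋙ E).mapCochainComplexPlus ⋙ HomotopyCategory.Plus.quotient ℰ)
      Γ.rightDerivedFunctorPlusUnit ≫
    Functor.whiskerRight (mapPlusOpCompIso D E).inv Γ.rightDerivedFunctorPlus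

instance : (DerivedCategory.Plus.Q (C := 𝒜)).IsLocalization
    (CochainComplex.Plus.quasiIso 𝒜) := by
  unfold DerivedCategory.Plus.Q
  infer_instance

/-- The natural transformation from the identity to the derived functor of `Γ` at the double
dual. -/
def derivedUnit : 𝟭 (DerivedCategory.Plus 𝒜) ⟶
    (mapPlusOp D).rightOp ⋙ mapMinusOp E ⋙ Γ.rightDerivedFunctorPlus :=
  letI : Localization.Lifting DerivedCategory.Plus.Q (CochainComplex.Plus.quasiIso 𝒜)
    DerivedCategory.Plus.Q (𝟭 (DerivedCategory.Plus 𝒜)) := ⟨Functor.rightUnitor _⟩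
  letI : Localization.Lifting DerivedCategory.Plus.Q (CochainComplex.Plus.quasiIso 𝒜)
    (DerivedCategory.Plus.Q ⋙ (mapPlusOp D).rightOp ⋙ mapMinusOp E ⋙ Γ.rightDerivedFunctorPlus)
    ((mapPlusOp D).rightOp ⋙ mapMinusOp E ⋙ Γ.rightDerivedFunctorPlus) := ⟨Iso.refl _⟩
  Localization.liftNatTrans DerivedCategory.Plus.Q (CochainComplex.Plus.quasiIso 𝒜)
    DerivedCategory.Plus.Q _ _ _ (toRightDerivedDoubleDual u)

lemma isIso_derivedUnit_app_Q (K : CochainComplex.Plus 𝒜)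
    (hu : ∀ n, IsIso (u.app (K.obj.X n)))
    (hinj : ∀ n, Injective (E.obj (op (D.obj (op (K.obj.X n)))))) :
    IsIso ((derivedUnit u).app (DerivedCategory.Plus.Q.obj K)) := by
  have h : (derivedUnit u).app (DerivedCategory.Plus.Q.obj K) =
      (toRightDerivedDoubleDual u).app K := by
    unfold derivedUnit
    rw [Localization.liftNatTrans_app]
    exact (Category.id_comp _).trans (Category.comp_id _)
  rw [h]
  -- There are three factors: the termwise unit, the comparison of Γ with its derived functor,
  -- invertible on complexes of injectives, and the identification of the double dual.
  have h₁ : IsIso ((toDoubleDualComplex u).app K) := by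
    have : ∀ n, IsIso (((toDoubleDualComplex u).app K).hom.f n) := hu
    have : IsIso ((CochainComplex.Plus.ι 𝒜).map ((toDoubleDualComplex u).app K)) :=
      HomologicalComplex.Hom.isIso_of_components ((toDoubleDualComplex u).app K).hom
    exact isIso_of_fully_faithful (CochainComplex.Plus.ι 𝒜) _
  have h₂ : IsIso (Γ.rightDerivedFunctorPlusUnit.app ((HomotopyCategory.Plus.quotient ℰ).obj
      ((D.rightOp ⋙ E).mapCochainComplexPlus.obj K))) := by
    have : ∀ n, Injective (((HomotopyCategory.Plus.quotient ℰ).obj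
      ((D.rightOp ⋙ E).mapCochainComplexPlus.obj K)).obj.as.X n) := hinj
    infer_instance
  have h₃ : IsIso ((Functor.whiskerRight (toDoubleDualComplex u) DerivedCategory.Plus.Q).app K) :=
    inferInstanceAs (IsIso (DerivedCategory.Plus.Q.map ((toDoubleDualComplex u).app K)))
  have h₄ : IsIso (Γ.rightDerivedFunctorPlus.map ((mapPlusOpCompIso D E).inv.app K)) :=
    inferInstance
  exact IsIso.comp_isIso' h₃ (IsIso.comp_isIso' h₂ h₄)

end DoubleDual

/-! ### The duality for comodules -/

section Duality

open Opposite

lemma projective_of_free {A : Type u} [Ring A] (X : ModuleCat.{u} A) [Module.Free A X] :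
    Projective X :=
  ModuleCat.projective_of_free (Module.Free.chooseBasis A X)

variable (k C : Type u) [Field k] [AddCommGroup C] [Module k C] [Coalgebra k C]

/-- Evaluation, from a comodule to the rational part of its double dual. -/
def evalComod : 𝟭 (LeftComod k C) ⟶
    ((comodDual k C).rightOp ⋙ dualLeft k (DualAlgebra k C)) ⋙ LeftComod.rat k C :=
  (comodDualAdjunction k C).unit

/-- The double dual of R(X) is X^*, the dual of a projective module. -/
lemma injective_doubleDual_ratDual (X : ModuleCat.{u} (DualAlgebra k C))
    [Module.Free (DualAlgebra k C) X] [Module.Finite (DualAlgebra k C) X] :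
    Injective ((dualLeft k (DualAlgebra k C)).obj (op ((comodDual k C).obj
      (op ((ratDual k C).obj (op X)))))) := by
  have := isIso_counit_of_free X
  have : Projective X := projective_of_free X
  have := injective_dualLeft k X
  exact Injective.of_iso ((dualLeft k (DualAlgebra k C)).mapIso
    (asIso ((comodDualAdjunction k C).counit.app (op X))).symm) this

variable {k C} in
lemma projective_and_isIso_counit (X : ModuleCat.{u} (DualAlgebra k C))
    (h : Module.Free (DualAlgebra k C) X ∧ Module.Finite (DualAlgebra k C) X) :
    Projective X ∧ IsIso ((comodDualAdjunction k C).counit.app (op X)) := by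
  obtain ⟨_, _⟩ := h
  exact ⟨projective_of_free X, isIso_counit_of_free X⟩

variable [HasDerivedCategory.{w₁} (ModuleCat.{u} (DualAlgebra k C))]
  [HasDerivedCategory.{w₃} (LeftComod k C)]

section

open scoped Pretriangulated.Opposite

instance : (derivedDual k C).CommShift ℤ := by
  dsimp only [derivedDual]
  infer_instance

instance : (derivedDual k C).IsTriangulated := by
  dsimp only [derivedDual]
  infer_instance

end

variable {k C} in
/-- The bounded below complex of comodules dual to a bounded above complex of modules. -/
def ratDualComplex (P : CochainComplex (ModuleCat.{u} (DualAlgebra k C)) ℤ) (N : ℤ)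
    [P.IsStrictlyLE N] : CochainComplex.Plus (LeftComod k C) :=
  ⟨(mapComplexOp (ratDual k C)).obj (op P), -N, by
    rw [CochainComplex.isStrictlyGE_iff]
    intro i hi
    exact (ratDual k C).map_isZero (IsZero.op (P.isZero_of_isStrictlyLE N (-i) (by lia)))⟩

/-- The objects of the bounded below derived category represented by the duals of bounded above
complexes of finitely generated free modules. -/
def IsDualOfFree (Y : DerivedCategory.Plus (LeftComod k C)) : Prop :=
  ∃ (P : CochainComplex (ModuleCat.{u} (DualAlgebra k C)) ℤ) (N : ℤ) (_ : P.IsStrictlyLE N),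
    (∀ n, Module.Free (DualAlgebra k C) (P.X n) ∧ Module.Finite (DualAlgebra k C) (P.X n)) ∧
    Nonempty (Y ≅ DerivedCategory.Plus.Q.obj (ratDualComplex P N))

variable {k C}

lemma isDualOfFree_of_iso_derivedDual
    (P : CochainComplex (ModuleCat.{u} (DualAlgebra k C)) ℤ) (N : ℤ) [P.IsStrictlyLE N]
    (hP : ∀ n, Module.Free (DualAlgebra k C) (P.X n) ∧ Module.Finite (DualAlgebra k C) (P.X n))
    {Y : DerivedCategory.Plus (LeftComod k C)}
    (e : DerivedCategory.Q.obj P ≅ ((derivedDual k C).obj (op Y)).obj) :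
    IsDualOfFree k C Y := by
  obtain ⟨i⟩ := nonempty_iso_of_iso_mapDerivedOp (comodDualAdjunction k C) P N
    (fun n => (projective_and_isIso_counit _ (hP n)).1)
    (fun n => (projective_and_isIso_counit _ (hP n)).2) (Y := Y.obj) e
  exact ⟨P, N, inferInstance, hP, ⟨DerivedCategory.Plus.ι.preimageIso
    (i ≪≫ (DerivedCategory.quotientCompQhIso _).symm.app _)⟩⟩

/-- A free resolution P of Y^* represents Y^*, and reflexivity of its terms turns this into Y ≅
R(P). -/
lemma isDualOfFree_of_fgMinus [IsNoetherianRing (DualAlgebra k C)]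
    {Y : DerivedCategory.Plus (LeftComod k C)}
    (hY : fgMinus k C ((derivedDual k C).obj (op Y))) : IsDualOfFree k C Y := by
  obtain ⟨P, N, _, hP, ⟨e⟩⟩ := exists_free_complex _ ((derivedDual k C).obj (op Y)).property hY
  exact isDualOfFree_of_iso_derivedDual P N hP e

lemma exists_derivedDual_iso [IsNoetherianRing (DualAlgebra k C)]
    (X : DerivedCategory.Minus (ModuleCat.{u} (DualAlgebra k C))) (hX : fgMinus k C X) :
    ∃ Y, Nonempty ((derivedDual k C).obj (op Y) ≅ X) := by
  obtain ⟨P, N, _, hP, ⟨e⟩⟩ := exists_free_complex _ X.property hX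
  let i : (mapDerivedOp (comodDual k C)).obj
      (op (DerivedCategory.Plus.Q.obj (ratDualComplex P N)).obj) ≅ X.obj :=
    (mapDerivedOp (comodDual k C)).mapIso ((DerivedCategory.quotientCompQhIso _).symm.app
        (ratDualComplex P N).obj).op ≪≫
      (mapDerivedOpFactors (comodDual k C)).app (op (ratDualComplex P N).obj) ≪≫
      DerivedCategory.Q.mapIso (doubleDualIso (comodDualAdjunction k C) P
        fun n => (projective_and_isIso_counit _ (hP n)).2) ≪≫ e
  exact ⟨DerivedCategory.Plus.Q.obj (ratDualComplex P N),
    ⟨DerivedCategory.Minus.ι.preimageIso i⟩⟩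

lemma derivedDual_map_surjective {Y Y' : DerivedCategory.Plus (LeftComod k C)}
    (h : IsDualOfFree k C Y') :
    Function.Surjective (fun f : Y ⟶ Y' => (derivedDual k C).map f.op) := by
  obtain ⟨P, N, _, hP, ⟨e⟩⟩ := h
  intro g
  obtain ⟨f, hf⟩ := mapDerivedOp_map_surjective_of_iso (comodDualAdjunction k C) P N
    (fun n => (projective_and_isIso_counit _ (hP n)).1)
    (fun n => (projective_and_isIso_counit _ (hP n)).2) (Y := Y.obj)
    (DerivedCategory.Plus.ι.mapIso e ≪≫ (DerivedCategory.quotientCompQhIso _).app _) g.hom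
  exact ⟨ObjectProperty.homMk f, ObjectProperty.hom_ext _ hf⟩

variable (k C) [HasDerivedCategory.{w₂} (ModuleCat.{u} (DualAlgebra k C)ᵐᵒᵖ)]

/-- The biduality morphism `M → RΓ(M^{**})` in the bounded below derived category. -/
def derivedBiduality : 𝟭 (DerivedCategory.Plus (LeftComod k C)) ⟶
    (derivedDual k C).rightOp ⋙ derivedTorsionDual k C :=
  derivedUnit (evalComod k C)

-- For Y = R(P) the unit is invertible in each degree and the double dual P^* has injective terms,
-- so RΓ° is computed termwise.
variable {k C} in
lemma isIso_derivedBiduality_app {Y : DerivedCategory.Plus (LeftComod k C)}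
    (h : IsDualOfFree k C Y) : IsIso ((derivedBiduality k C).app Y) := by
  obtain ⟨P, N, _, hP, ⟨e⟩⟩ := h
  rw [NatTrans.isIso_app_iff_of_iso _ e]
  refine isIso_derivedUnit_app_Q (evalComod k C) (ratDualComplex P N) (fun n => ?_) (fun n => ?_)
  · obtain ⟨_, _⟩ := hP (-n)
    exact isIso_unit_ratDual_of_free (P.X (-n))
  · obtain ⟨_, _⟩ := hP (-n)
    exact injective_doubleDual_ratDual k C (P.X (-n))

end Duality
end
end CoalgDuality

theorem mainTheorem6 (k C : Type u) [Field k] [IsAlgClosed k] [CharZero k]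
    [AddCommGroup C] [Module k C] [Coalgebra k C] (hC : IsArtinianCoalgebra k C)
    [HasDerivedCategory.{w₁} (ModuleCat.{u} (DualAlgebra k C))]
    [HasDerivedCategory.{w₂} (ModuleCat.{u} (DualAlgebra k C)ᵐᵒᵖ)]
    [HasDerivedCategory.{w₃} (LeftComod k C)] :
    (∀ (N : ModuleCat.{u} (DualAlgebra k C)ᵐᵒᵖ) (m : N),
      m ∈ rationalSubmodule k C N ↔ IsTorsionElement m) ∧
    IsTriangulatedDuality (fgMinus k C) (qfPlus k C)
      (derivedTorsionDual k C) (derivedDual k C) ∧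
    IsTriangulatedDuality (fgBounded k C) (qfBounded k C)
      (derivedTorsionDual k C) (derivedDual k C) := by
  have : IsNoetherianRing (DualAlgebra k C) := isNoetherianRing_dualAlgebra hC.left
  have : (fgMinus k C).IsTriangulated := isTriangulated_fgMinus k C
  have : (fgBounded k C).IsTriangulated := isTriangulated_fgBounded k C
  -- Fullness and invertibility of biduality, in both dualities, rest on the representation of Y as
  -- R(P).
  have hQ : ∀ Y, qfPlus k C Y → IsDualOfFree k C Y := fun Y hY =>
    isDualOfFree_of_fgMinus ((qfPlus_iff k C hC.left Y).1 hY)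
  refine ⟨fun N m => isRationalElement_iff_exists_radPow hC.left, ?_, ?_⟩
  · exact isTriangulatedDuality_of_full (qfPlus_iff k C hC.left)
      (fun Y Y' _ hY' => derivedDual_map_surjective (hQ Y' hY'))
      exists_derivedDual_iso (derivedBiduality k C)
      (fun Y hY => isIso_derivedBiduality_app (hQ Y hY))
  · exact isTriangulatedDuality_of_full (qfBounded_iff k C hC.left)
      (fun Y Y' _ hY' => derivedDual_map_surjective (hQ Y' hY'.1))
      (fun X hX => exists_derivedDual_iso X hX.1) (derivedBiduality k C)
      (fun Y hY => isIso_derivedBiduality_app (hQ Y hY.1))
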